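/- **Setting.** Let $\{(\mathcal H_p,\|\cdot\|_p)\}_{p\ge 0}$ be a sequence of separable complex Hilbert spaces with continuous injections $\mathcal H_{q}\hookrightarrow\mathcal H_p$ ($p\le q$), compatible with each other and Hilbert–Schmidt for $p<q$, such that the nuclear Fréchet space $\mathcal N_{\mathbb C}=\bigcap_p\mathcal H_p$ (projective limit topology) is dense in every $\mathcal H_p$. Let $\mathcal N_{\mathbb C}'$ be its dual, with pairing $\rho_x\phi^x$ and the cylinder $\sigma$-algebra, and let $\nu$ be the white noise measure on $\mathcal N'_{\mathbb C}$, i.e. the probability measure with $$\int_{\mathcal N'_{\mathbb C}} e^{i(\overline{\rho_x\phi^x}+\rho_x\phi^x)}\,D\nu(\phi)=e^{-\|\rho\|_0^2},\qquad \rho\in\mathcal N_{\mathbb C}.$$ The complex Wick monomials are determined by $$\mathcal W(\phi^n\bar\phi^m)(\rho^{\otimes n}\otimes\bar\rho^{\otimes m})=\partial_s^n\partial_t^m\exp\big(t\,\overline{\rho_x\phi^x}+s\,\rho_x\phi^x-st\|\rho\|_0^2\big)\big|_{s=t=0},$$ and every $\Psi\in L^2(\mathcal N'_{\mathbb C},D\nu)$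 has a chaos decomposition $\Psi=\sum_{n,m}\psi^{(n,m)}\mathcal W(\phi^n\bar\phi^m)$, whose coefficients $\psi^{(n,m)}\in\mathcal H_0^{\hat\otimes n}\otimes(\mathcal H_0^*)^{\hat\otimes m}$ ($^*$ is complex conjugation, $\hat\otimes$ the symmetric Hilbert space tensor power) satisfy $\langle\mathcal W(\phi^n\bar\phi^m)(\rho^{\otimes n}\otimes\bar\rho^{\otimes m}),\Psi\rangle_{L^2}=n!\,m!\,\langle\rho^{\otimes n}\otimes\bar\rho^{\otimes m},\psi^{(n,m)}\rangle_0$ for all $\rho\in\mathcal N_{\mathbb C}$. For $p\in\mathbb N_0$ and $q\in\mathbb R$ put $$|\Psi|_{p,q}^2=\sum_{n,m\ge 0}n!\,m!\,2^{q(n+m)}\,\|\psi^{(n,m)}\|^2_{\mathcal H_p^{\hat\otimes n}\otimes(\mathcal H_p^*)^{\hat\otimes m}}$$ ($=\infty$ if some $\psi^{(n,m)}$ does not come from $\mathcal H_p^{\hat\otimes n}\otimes(\mathcal H_p^*)^{\hat\otimes m}$). This is the norm of $\Gamma\mathcal H_{p,q}\otimes\Gamma\mathcal H_{p,q}^*$,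 where $\mathcal H_{p,q}$ is $\mathcal H_p$ with the norm $\|\cdot\|_{p,q}=2^{q/2}\|\cdot\|_p$. Let $\mathcal F_{p,q}=\{\Psi\in L^2(\mathcal N'_{\mathbb C},D\nu):|\Psi|_{p,q}<\infty\}$. The space of complex Hida test functions is $(\mathcal N_{\mathbb C})\otimes(\mathcal N_{\mathbb C})^*=\bigcap_{p,q\in\mathbb N_0}\mathcal F_{p,q}$. **Theorem (Algebra of complex Hida test functions).** 1. For every $p$ there is a constant $K_p\ge 0$ with $\|\rho\|_0\le K_p\|\rho\|_p$ for all $\rho\in\mathcal N_{\mathbb C}$. 2. Let $p\in\mathbb N_0$, $q\ge 0$, let $K_p\ge 0$ be any constant as in 1, and let $\alpha,\beta\in\mathbb R$ satisfy $$2^{-(\alpha+\beta)/2}K_p^2+2^{q-\alpha}+2^{q-\beta}<1 .$$ Then $$|\Psi\Phi|_{p,q}\le\frac{1-2^{-(\alpha+\beta)/2}K_p^{2}}{\big(1-2^{-(\alpha+\beta)/2}K_p^{2}-2^{q-\alpha}-2^{q-\beta}\big)^2}\,|\Psi|_{p,\alpha}\,|\Phi|_{p,\beta}$$ for all complex Hida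 test functions $\Psi,\Phi$. If moreover $\|\rho\|_0\le\|\rho\|_{p,q}$ for all $\rho\in\mathcal N_{\mathbb C}$ (so that $\Gamma\mathcal H_{p,q}\subset\Gamma\mathcal H_0$), then for all $\Psi\in\mathcal F_{p,\alpha}$ and $\Phi\in\mathcal F_{p,\beta}$ the product $\Psi\Phi$ lies in $\mathcal F_{p,q}$ and the same estimate holds. 3. $(\mathcal N_{\mathbb C})\otimes(\mathcal N_{\mathbb C})^*$ is an algebra (a unital complex subalgebra of the functions on $\mathcal N'_{\mathbb C}$) under pointwise multiplication. -/

import Mathlib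

open MeasureTheory
open scoped ENNReal ComplexConjugate

/-- A bounded operator between complex Hilbert spaces is Hilbert-Schmidt: the sums
`∑ ‖T eᵢ‖²` over finite orthonormal families are bounded. -/
def IsHilbertSchmidt {E F : Type*} [NormedAddCommGroup E] [InnerProductSpace ℂ E]
    [NormedAddCommGroup F] [InnerProductSpace ℂ F] (T : E →L[ℂ] F) : Prop :=
  ∃ M : ℝ, ∀ (d : ℕ) (e : Fin d → E), Orthonormal ℂ e → ∑ i, ‖T (e i)‖ ^ 2 ≤ M

/-- A chain of complex separable Hilbert spaces `H 0 ⊇ H 1 ⊇ H 2 ⊇ ⋯` with compatible injections,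
Hilbert-Schmidt for `p < q`, whose projective limit (intersection) is dense in each `H p`. -/
structure NFChain (H : ℕ → Type*) [∀ p, NormedAddCommGroup (H p)]
    [∀ p, InnerProductSpace ℂ (H p)] [∀ p, CompleteSpace (H p)] where
  separable : ∀ p, TopologicalSpace.SeparableSpace (H p)
  incl : ∀ {p q : ℕ}, p ≤ q → (H q →L[ℂ] H p)
  incl_refl : ∀ (p : ℕ) (x : H p), incl (le_refl p) x = x
  incl_trans : ∀ {p q r : ℕ} (hpq : p ≤ q) (hqr : q ≤ r) (x : H r),
    incl hpq (incl hqr x) = incl (hpq.trans hqr) x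
  incl_injective : ∀ {p q : ℕ} (h : p ≤ q), Function.Injective (incl h)
  incl_hilbertSchmidt : ∀ {p q : ℕ} (h : p < q), IsHilbertSchmidt (incl h.le)
  dense : ∀ p : ℕ, Dense
    {y : H p | ∃ x : (∀ r, H r), (∀ (r s : ℕ) (h : r ≤ s), incl h (x s) = x r) ∧ x p = y}

namespace NFChain

variable {H : ℕ → Type*} [∀ p, NormedAddCommGroup (H p)]
  [∀ p, InnerProductSpace ℂ (H p)] [∀ p, CompleteSpace (H p)]

/-- The nuclear Fréchet space `N = ⋂ₚ H p`, as the projective limit of the chain. As a submodule of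
the product it carries the projective limit topology. For `ρ : C.N`, the element `ρ.1 p` is `ρ`
regarded as an element of `H p`, so `‖ρ.1 p‖` is the `p`-th Hilbertian norm of `ρ`. -/
def N (C : NFChain H) : Submodule ℂ (∀ p, H p) where
  carrier := {x | ∀ (p q : ℕ) (h : p ≤ q), C.incl h (x q) = x p}
  add_mem' := by
    intro a b ha hb p q h
    simp only [Pi.add_apply, map_add, ha p q h, hb p q h]
  zero_mem' := by
    intro p q h
    simp
  smul_mem' := by
    intro c a ha p q h
    simp only [Pi.smul_apply, map_smul, ha p q h]

/-- The dual space `N'` of continuous complex-linear functionals on `N`. -/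
def Dual (C : NFChain H) : Type _ := C.N →L[ℂ] ℂ

/-- The pairing `φ, ρ ↦ ρₓφˣ` of `N'` with `N`. -/
noncomputable def pair (C : NFChain H) (φ : C.Dual) (ρ : C.N) : ℂ := (show C.N →L[ℂ] ℂ from φ) ρ

/-- The `σ`-algebra on `N'` generated by the cylinder sets. -/
noncomputable instance instMeasurableSpaceDual (C : NFChain H) : MeasurableSpace C.Dual :=
  ⨆ ρ : C.N, MeasurableSpace.comap (fun φ => C.pair φ ρ) (borel ℂ)

/-- `β` is the white noise measure on `N'`: the probability measure with characteristic functional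
`∫ exp (i (conj (ρₓφˣ) + ρₓφˣ)) dβ(φ) = exp (-‖ρ‖₀²)`. -/
structure IsWhiteNoise (C : NFChain H) (β : Measure C.Dual) : Prop where
  prob : IsProbabilityMeasure β
  charFun : ∀ ρ : C.N,
    ∫ φ, Complex.exp (Complex.I * (conj (C.pair φ ρ) + C.pair φ ρ)) ∂β
      = Complex.exp (-((‖ρ.1 0‖ : ℂ) ^ 2))

/-- The complex Wick monomial `𝒲(φⁿ φ̄ᵐ)` with respect to the white noise covariance, contracted
with `ρ^{⊗n} ⊗ ρ̄^{⊗m}`: the derivative `∂ₛⁿ ∂ₜᵐ` at `s = t = 0` of the generating function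
`exp (t conj (ρₓφˣ) + s ρₓφˣ - s t ‖ρ‖₀²)`. -/
noncomputable def wick (C : NFChain H) (n m : ℕ) (ρ : C.N) (φ : C.Dual) : ℂ :=
  iteratedDeriv n (fun s : ℂ =>
    iteratedDeriv m (fun t : ℂ =>
      Complex.exp (t * conj (C.pair φ ρ) + s * C.pair φ ρ - s * t * (‖ρ.1 0‖ : ℂ) ^ 2)) 0) 0

end NFChain

/-- `G` is a bosonic form of type `(n, m)` on `E`: conjugate-linear in each of the first `n`
variables, linear in each of the last `m`, and symmetric in either group.
A tensor `g` in `E^{⊗̂n} ⊗ (E^*)^{⊗̂m}` (`E^*` the complex conjugate of `E`, symmetric tensor powers)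
is represented by its form
`G (u₁, …, uₙ; v₁, …, vₘ) = ⟨u₁ ⊗ ⋯ ⊗ uₙ ⊗ v̄₁ ⊗ ⋯ ⊗ v̄ₘ, g⟩`;
the tensors of the Hilbert space tensor product correspond exactly to the forms with finite
Hilbert-Schmidt norm. -/
structure IsBosonicForm {E : Type*} [AddCommGroup E] [Module ℂ E] {n m : ℕ}
    (G : (Fin n → E) → (Fin m → E) → ℂ) : Prop where
  add_left : ∀ (u : Fin n → E) (v : Fin m → E) (i : Fin n) (x y : E),
    G (Function.update u i (x + y)) v
      = G (Function.update u i x) v + G (Function.update u i y) v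
  smul_left : ∀ (u : Fin n → E) (v : Fin m → E) (i : Fin n) (c : ℂ) (x : E),
    G (Function.update u i (c • x)) v = conj c * G (Function.update u i x) v
  add_right : ∀ (u : Fin n → E) (v : Fin m → E) (j : Fin m) (x y : E),
    G u (Function.update v j (x + y))
      = G u (Function.update v j x) + G u (Function.update v j y)
  smul_right : ∀ (u : Fin n → E) (v : Fin m → E) (j : Fin m) (c : ℂ) (x : E),
    G u (Function.update v j (c • x)) = c * G u (Function.update v j x)
  symm_left : ∀ (σ : Equiv.Perm (Fin n)) (u : Fin n → E) (v : Fin m → E), G (u ∘ σ) v = G u v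
  symm_right : ∀ (σ : Equiv.Perm (Fin m)) (u : Fin n → E) (v : Fin m → E), G u (v ∘ σ) = G u v

/-- The squared Hilbert-Schmidt norm of a form, which is the squared norm of the tensor it
represents: the supremum over finite orthonormal families (equivalently, the sum over an
orthonormal basis) of the squared moduli of its coefficients. -/
noncomputable def hsNormSq {E : Type*} [NormedAddCommGroup E] [InnerProductSpace ℂ E] {n m : ℕ}
    (G : (Fin n → E) → (Fin m → E) → ℂ) : ℝ≥0∞ :=
  ⨆ (d : ℕ) (e : Fin d → E) (_ : Orthonormal ℂ e),
    ∑ I : Fin n → Fin d, ∑ J : Fin m → Fin d, ‖G (e ∘ I) (e ∘ J)‖ₑ ^ 2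

namespace NFChain

variable {H : ℕ → Type*} [∀ p, NormedAddCommGroup (H p)]
  [∀ p, InnerProductSpace ℂ (H p)] [∀ p, CompleteSpace (H p)]

/-- The tensors `ψ^{(n,m)}` over `H p`, given by their forms `G n m`, are the coefficients of the
chaos decomposition `Ψ = ∑ ψ^{(n,m)} 𝒲(φⁿ φ̄ᵐ)`. With `T : H p → H 0` the injection, the image of
`ψ^{(n,m)}` over `H 0` has the form `(u; v) ↦ G n m (T^* u; T^* v)`, and the coefficients of `Ψ` are
its scalar products with the Wick monomials,
`⟨𝒲(φⁿ φ̄ᵐ)(ρ^{⊗n} ⊗ ρ̄^{⊗m}), Ψ⟩ = n! m! ⟨ρ^{⊗n} ⊗ ρ̄^{⊗m}, ψ^{(n,m)}⟩₀`. -/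
structure IsChaosExpansion (C : NFChain H) (β : Measure C.Dual) (p : ℕ) (Ψ : C.Dual → ℂ)
    (G : ∀ n m : ℕ, (Fin n → H p) → (Fin m → H p) → ℂ) : Prop where
  bosonic : ∀ n m, IsBosonicForm (G n m)
  coeff : ∀ (n m : ℕ) (ρ : C.N),
    ∫ φ, conj (C.wick n m ρ φ) * Ψ φ ∂β
      = (n.factorial : ℂ) * (m.factorial : ℂ) *
        G n m (fun _ => ContinuousLinearMap.adjoint (C.incl (Nat.zero_le p)) (ρ.1 0))
          (fun _ => ContinuousLinearMap.adjoint (C.incl (Nat.zero_le p)) (ρ.1 0))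

/-- The norm `|Ψ|_{p,q}` of `Γ H_{p,q} ⊗ Γ H_{p,q}^*`, where `H_{p,q}` is `H p` with the norm
`2^{q/2} ‖·‖ₚ`: `|Ψ|²_{p,q} = ∑ n! m! 2^{q(n+m)} ‖ψ^{(n,m)}‖ₚ²`. It is `∞` if the coefficients of `Ψ`
are not tensors over `H p` or the series diverges. (A family of forms with finite norms
representing `Ψ` is unique, so the infimum is over at most one finite value.) -/
noncomputable def fockNorm (C : NFChain H) (β : Measure C.Dual) (p : ℕ) (q : ℝ)
    (Ψ : C.Dual → ℂ) : ℝ≥0∞ :=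
  (⨅ (G : ∀ n m : ℕ, (Fin n → H p) → (Fin m → H p) → ℂ) (_ : C.IsChaosExpansion β p Ψ G),
    ∑' n : ℕ, ∑' m : ℕ,
      ENNReal.ofReal ((n.factorial : ℝ) * (m.factorial : ℝ) * (2 : ℝ) ^ (q * ((n : ℝ) + (m : ℝ))))
        * hsNormSq (G n m)) ^ (1 / 2 : ℝ)

/-- `Ψ` belongs to `𝓘⁻¹(Γ H_{p,q} ⊗ Γ H_{p,q}^*)`. -/
def InFock (C : NFChain H) (β : Measure C.Dual) (p : ℕ) (q : ℝ) (Ψ : C.Dual → ℂ) : Prop :=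
  MemLp Ψ 2 β ∧ C.fockNorm β p q Ψ < ∞

/-- `Ψ` is a complex Hida test function: it belongs to
`(N) ⊗ (N)^* = ⋂_{p,q} 𝓘⁻¹(Γ H_{p,q} ⊗ Γ H_{p,q}^*)`. -/
def IsHida (C : NFChain H) (β : Measure C.Dual) (Ψ : C.Dual → ℂ) : Prop :=
  ∀ p q : ℕ, C.InFock β p (q : ℝ) Ψ

/-- `K` bounds the injection `H p → H 0`, `‖ρ‖₀ ≤ K ‖ρ‖ₚ` for all `ρ` in `N`. -/
def EmbeddingBound (C : NFChain H) (p : ℕ) (K : ℝ) : Prop :=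
  ∀ ρ : C.N, ‖ρ.1 0‖ ≤ K * ‖ρ.1 p‖

end NFChain

/-- The constant of the product estimate. -/
noncomputable def productConst (q a b K : ℝ) : ℝ :=
  (1 - (2 : ℝ) ^ (-(a + b) / 2) * K ^ 2) /
    (1 - (2 : ℝ) ^ (-(a + b) / 2) * K ^ 2 - (2 : ℝ) ^ (q - a) - (2 : ℝ) ^ (q - b)) ^ 2

/-! The theorem reduces to finitely many complex Gaussian variables, where it is two applications of
Cauchy-Schwarz to the product formula for Hermite polynomials; weak limits then give the general
case.

Finite part. A finite-dimensional subspace of `H p` spanned by elements of `N` has a basis `g` in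
`N` that is orthonormal in `H p` and orthogonal in `H 0` (`exists_diagonal_family`). Under white
noise the pairings with the `g j` are independent rotation-invariant Gaussians of variance `v j = ‖g
j‖₀²`, and the products of complex Hermite polynomials in them are orthogonal
(`IsWhiteNoise.integral_conj_herm_mul_herm`). Products of such polynomials are linearized by
contracting a multi-index `R` of holomorphic variables of one factor with conjugate variables of the
other, at the price `v ^ R` (`multiHerm_mul`, `hermSum_mul_hermSum`). Cauchy-Schwarz over `R`
separates the two factors; Cauchy-Schwarz over the splittings `N₁ + N₂ = N` separates the surviving
indices. The binomial theorem then recombines everything into weights `a ^ |A| / A!` and `b ^ |A| /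
A!` (`sum_norm_mulCoeff_sq_le`).

With `κ = 2^(-(α+β)/2) K²`, `X = 2^(q-α)`, `Y = 2^(q-β)`, the free weights can be chosen so that the
only requirement is `κ + X + Y ≤ 1` (`coeffNormSq_mulCoeff_le`). The estimate so obtained has
constant one. The stated constant is at least one (`one_le_productConst`), so it is weaker.

Limit. A chaos expansion is handled through its forms. Compressing them to a finite span and cutting
off high degrees gives polynomials `approx` that converge weakly in `L²` to the function
(`IsWhiteNoise.tendsto_integral_approx`). This uses that Wick monomials are total
(`IsWhiteNoise.ae_eq_zero_of_wick`) and that the embedding bound `2^(q/2)` makes the `L²` norm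
smaller than the Fock norm. In the product one factor is sent to its limit at a time, so that the
other can be moved into the test function. The uniform bounds survive because `L²` norms are weakly
lower semicontinuous (`eLpNorm_le_of_tendsto_integral`) and bounded families of forms are compact
for pointwise convergence (`exists_limit_forms`). This is
`IsWhiteNoise.exists_isChaosExpansion_mul`.

For Hida functions the embedding bound at the given `q` may fail. All their Fock norms are finite,
however, so an auxiliary triple of large exponents supplies the `L²` control while the estimate is
still read off at the given exponents. The same large exponents show that products of Hida functions
are again Hida functions. -/

/-! ### Complex Hermite polynomials in one variable -/

/-- The complex Hermite polynomials of covariance `c`, as functions of `z` and `w = conj z`. -/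
noncomputable def cHerm (c z w : ℂ) : ℕ → ℕ → ℂ
  | 0, m => w ^ m
  | n + 1, m => z * cHerm c z w n m - c * m * cHerm c z w n (m - 1)

theorem cHerm_zero_left (c z w : ℂ) (m : ℕ) : cHerm c z w 0 m = w ^ m := by rw [cHerm]

theorem cHerm_succ_left (c z w : ℂ) (n m : ℕ) :
    cHerm c z w (n + 1) m = z * cHerm c z w n m - c * m * cHerm c z w n (m - 1) := by rw [cHerm]

theorem cHerm_succ_right (c z w : ℂ) (n m : ℕ) :
    cHerm c z w n (m + 1) = w * cHerm c z w n m - c * n * cHerm c z w (n - 1) m := by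
  induction n generalizing m with
  | zero => simp [cHerm_zero_left, pow_succ']
  | succ n ih =>
    -- Both sides are `-c n m` times the polynomial of degrees `(n-1, m-1)`: the left by the
    -- recursion in the first degree, the right by the induction hypothesis. For `n = 0` or `m = 0`
    -- the truncated indices are harmless, because a factor vanishes.
    have key : (n : ℂ) * (cHerm c z w n m - z * cHerm c z w (n - 1) m)
        = m * (cHerm c z w n m - w * cHerm c z w n (m - 1)) := by
      rcases n with _ | n
      · rcases m with _ | m
        · simp
        · simp [cHerm_zero_left, pow_succ']
      · rcases m with _ | m
        · simp [cHerm_succ_left]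
        · have h1 := ih m
          have h2 := cHerm_succ_left c z w n (m + 1)
          simp only [Nat.add_sub_cancel] at h1 h2 ⊢
          push_cast at *
          linear_combination (n + 1 : ℂ) * h2 - (m + 1 : ℂ) * h1
    rw [cHerm_succ_left, cHerm_succ_left c z w n m, ih m]
    simp only [Nat.add_sub_cancel]
    push_cast
    linear_combination c * key

theorem cHerm_swap (c z w : ℂ) (n m : ℕ) : cHerm c w z m n = cHerm c z w n m := by
  induction n generalizing m with
  | zero =>
    induction m with
    | zero => simp [cHerm_zero_left]
    | succ m ih => rw [cHerm_succ_left, ih]; simp [cHerm_zero_left, pow_succ']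
  | succ n ih => rw [cHerm_succ_right, cHerm_succ_left, ih, ih]

theorem cHerm_conj (c : ℝ) (z : ℂ) (n m : ℕ) :
    conj (cHerm c z (conj z) n m) = cHerm c z (conj z) m n := by
  rw [← cHerm_swap c z (conj z) m n]
  induction n generalizing m with
  | zero => simp [cHerm_zero_left]
  | succ n ih => simp [cHerm_succ_left, ih]

theorem mul_cHerm (c z w : ℂ) (n m : ℕ) :
    z * cHerm c z w n m = cHerm c z w (n + 1) m + c * m * cHerm c z w n (m - 1) := by
  rw [cHerm_succ_left]; ring

/-- The right-hand side of the product formula for complex Hermite polynomials. -/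
noncomputable def cHermProd (c z w : ℂ) (n m k l : ℕ) : ℂ :=
  ∑ r ∈ Finset.range (n + 1), ∑ s ∈ Finset.range (m + 1),
    c ^ (r + s) * (n.choose r * l.descFactorial r) * (m.choose s * k.descFactorial s) *
      cHerm c z w (n - r + (k - s)) (m - s + (l - r))

theorem cHermProd_swap (c z w : ℂ) (n m k l : ℕ) :
    cHermProd c w z m n l k = cHermProd c z w n m k l := by
  unfold cHermProd
  rw [Finset.sum_comm]
  refine Finset.sum_congr rfl fun r _ => Finset.sum_congr rfl fun s _ => ?_
  rw [cHerm_swap, add_comm s r]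
  ring

theorem natCast_sub_mul_choose (m s : ℕ) :
    ((m - s : ℕ) : ℂ) * m.choose s = m * (m - 1).choose s := by
  rcases m with _ | m
  · simp
  · have := Nat.add_one_mul_choose_eq m s
    have h2 := Nat.choose_succ_right_eq (m + 1) s
    have h3 : (m + 1 - s) * (m + 1).choose s = (m + 1) * m.choose s := by
      rw [this, h2]; ring
    simpa using congrArg (Nat.cast (R := ℂ)) h3

/-- The product formula is proved by showing that its right-hand side obeys the recursion of `cHerm`
in the first degree. Multiplication by `z` either raises a degree or contracts with a conjugate
variable; that variable belongs to the first factor, which gives the subtracted term, or to the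
second, which gives one more contraction. -/
theorem cHermProd_succ (c z w : ℂ) (n m k l : ℕ) :
    cHermProd c z w (n + 1) m k l
      = z * cHermProd c z w n m k l - c * m * cHermProd c z w n (m - 1) k l := by
  set T : ℕ → ℕ → ℂ := fun r s =>
    c ^ (r + s) * (n.choose r * l.descFactorial r) * (m.choose s * k.descFactorial s) with hT
  have hz : z * cHermProd c z w n m k l
      = (∑ r ∈ Finset.range (n + 1), ∑ s ∈ Finset.range (m + 1),
          T r s * cHerm c z w (n + 1 - r + (k - s)) (m - s + (l - r)))
        + (∑ r ∈ Finset.range (n + 1), ∑ s ∈ Finset.range (m + 1),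
          T r s * (c * (m - s : ℕ) * cHerm c z w (n - r + (k - s)) (m - 1 - s + (l - r))))
        + (∑ r ∈ Finset.range (n + 1), ∑ s ∈ Finset.range (m + 1),
          T r s * (c * (l - r : ℕ) * cHerm c z w (n - r + (k - s)) (m - s + (l - (r + 1))))) := by
    unfold cHermProd
    simp only [Finset.mul_sum, ← Finset.sum_add_distrib]
    refine Finset.sum_congr rfl fun r hr => Finset.sum_congr rfl fun s hs => ?_
    have hr' : r ≤ n := Nat.lt_succ_iff.1 (Finset.mem_range.1 hr)
    have e1 : n + 1 - r + (k - s) = n - r + (k - s) + 1 := by omega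
    rw [e1, mul_left_comm, mul_cHerm, ← mul_add, ← mul_add]
    congr 1
    push_cast
    have a1 : ((m - s : ℕ) : ℂ) * cHerm c z w (n - r + (k - s)) (m - s + (l - r) - 1)
        = ((m - s : ℕ) : ℂ) * cHerm c z w (n - r + (k - s)) (m - 1 - s + (l - r)) := by
      rcases Nat.eq_zero_or_pos (m - s) with h | h
      · simp [h]
      · congr 2; omega
    have a2 : ((l - r : ℕ) : ℂ) * cHerm c z w (n - r + (k - s)) (m - s + (l - r) - 1)
        = ((l - r : ℕ) : ℂ) * cHerm c z w (n - r + (k - s)) (m - s + (l - (r + 1))) := by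
      rcases Nat.eq_zero_or_pos (l - r) with h | h
      · simp [h]
      · congr 2; omega
    linear_combination c * a1 + c * a2
  -- Contractions within the first factor: `(m - s) * choose m s = m * choose (m - 1) s` turns them
  -- into the formula with `m - 1`, and the term `s = m` vanishes.
  have hm : (∑ r ∈ Finset.range (n + 1), ∑ s ∈ Finset.range (m + 1),
          T r s * (c * (m - s : ℕ) * cHerm c z w (n - r + (k - s)) (m - 1 - s + (l - r))))
      = c * m * cHermProd c z w n (m - 1) k l := by
    unfold cHermProd
    rw [Finset.mul_sum]
    refine Finset.sum_congr rfl fun r _ => ?_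
    rw [Finset.mul_sum]
    rcases m with _ | m
    · simp
    · rw [Finset.sum_range_succ]
      simp only [Nat.sub_self, Nat.cast_zero, mul_zero, zero_mul, add_zero, Nat.add_sub_cancel]
      refine Finset.sum_congr rfl fun s _ => ?_
      have := natCast_sub_mul_choose (m + 1) s
      simp only [Nat.add_sub_cancel] at this
      simp only [hT]
      linear_combination c * c ^ (r + s) * (n.choose r * l.descFactorial r) * k.descFactorial s *
        cHerm c z w (n - r + (k - s)) (m - s + (l - r)) * this
  -- Pascal's rule splits `choose (n + 1) (r + 1)`: one part leaves the new `z` uncontracted, the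
  -- other contracts it with one of the `l - r` conjugate variables left in the second factor.
  have hl : cHermProd c z w (n + 1) m k l
      = (∑ r ∈ Finset.range (n + 1), ∑ s ∈ Finset.range (m + 1),
          T r s * cHerm c z w (n + 1 - r + (k - s)) (m - s + (l - r)))
        + (∑ r ∈ Finset.range (n + 1), ∑ s ∈ Finset.range (m + 1),
          T r s * (c * (l - r : ℕ) * cHerm c z w (n - r + (k - s)) (m - s + (l - (r + 1))))) := by
    have e : (∑ r ∈ Finset.range (n + 1), ∑ s ∈ Finset.range (m + 1),
          T r s * cHerm c z w (n + 1 - r + (k - s)) (m - s + (l - r)))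
        = ∑ r ∈ Finset.range (n + 1 + 1), ∑ s ∈ Finset.range (m + 1),
          T r s * cHerm c z w (n + 1 - r + (k - s)) (m - s + (l - r)) := by
      rw [Finset.sum_range_succ _ (n + 1)]
      simp [hT]
    rw [e, Finset.sum_range_succ' _ (n + 1)]
    unfold cHermProd
    rw [Finset.sum_range_succ' _ (n + 1), add_right_comm, ← Finset.sum_add_distrib]
    congr 1
    · refine Finset.sum_congr rfl fun r _ => ?_
      rw [← Finset.sum_add_distrib]
      refine Finset.sum_congr rfl fun s _ => ?_
      have e1 : n + 1 - (r + 1) = n - r := by omega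
      rw [e1, Nat.choose_succ_succ', Nat.descFactorial_succ]
      simp only [hT, Nat.descFactorial_succ]
      push_cast
      ring
    · simp [hT]
  rw [hl, hz, hm]
  ring

theorem cHerm_mul_cHerm_of_cHerm_mul (c z w : ℂ) (n m k l : ℕ)
    (h0 : ∀ m, cHerm c z w 0 m * cHerm c z w k l = cHermProd c z w 0 m k l) :
    cHerm c z w n m * cHerm c z w k l = cHermProd c z w n m k l := by
  induction n generalizing m with
  | zero => exact h0 m
  | succ n ih => rw [cHermProd_succ, ← ih, ← ih, cHerm_succ_left]; ring

/-- The product formula for complex Hermite polynomials. -/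
theorem cHerm_mul_cHerm (c z w : ℂ) (n m k l : ℕ) :
    cHerm c z w n m * cHerm c z w k l = cHermProd c z w n m k l := by
  refine cHerm_mul_cHerm_of_cHerm_mul c z w n m k l fun m => ?_
  -- Exchanging `z` and `w` makes `m` the first degree, so the same recursion serves for the
  -- remaining induction.
  rw [← cHermProd_swap, ← cHerm_swap c z w, ← cHerm_swap c z w]
  induction m with
  | zero => simp [cHermProd, cHerm_zero_left]
  | succ m ih =>
    rw [cHermProd_succ, ← ih, cHerm_succ_left]; simp; ring

/-- The explicit form of the complex Hermite polynomials. -/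
theorem cHerm_eq_sum (c z w : ℂ) (n m : ℕ) :
    cHerm c z w n m = ∑ k ∈ Finset.range (n + 1),
      (-c) ^ k * n.choose k * m.descFactorial k * z ^ (n - k) * w ^ (m - k) := by
  induction n generalizing m with
  | zero => simp [cHerm_zero_left]
  | succ n ih =>
    have e : ∑ k ∈ Finset.range (n + 1),
          z * ((-c) ^ k * n.choose k * m.descFactorial k * z ^ (n - k) * w ^ (m - k))
        = ∑ k ∈ Finset.range (n + 1 + 1),
          (-c) ^ k * n.choose k * m.descFactorial k * z ^ (n + 1 - k) * w ^ (m - k) := by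
      rw [Finset.sum_range_succ _ (n + 1)]
      simp only [Nat.choose_succ_self, Nat.cast_zero, mul_zero, zero_mul, add_zero]
      refine Finset.sum_congr rfl fun k hk => ?_
      have : n + 1 - k = n - k + 1 := by have := Finset.mem_range.1 hk; omega
      rw [this]; ring
    rw [cHerm_succ_left, ih, ih, Finset.mul_sum, e, Finset.sum_range_succ',
      Finset.sum_range_succ' _ (n + 1), Finset.mul_sum, add_sub_right_comm,
      ← Finset.sum_sub_distrib]
    congr 1
    · refine Finset.sum_congr rfl fun k _ => ?_
      have e1 : n + 1 - (k + 1) = n - k := by omega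
      rw [e1, Nat.choose_succ_succ' n k, Nat.descFactorial_succ]
      rcases m with _ | m
      · simp
      · have h3 : (m + 1 - k) * (m + 1).descFactorial k = (m + 1) * m.descFactorial k := by
          rw [← Nat.descFactorial_succ, Nat.succ_descFactorial_succ]
        have h3' := congrArg (Nat.cast (R := ℂ)) h3
        push_cast at h3' ⊢
        rw [h3']
        ring
    · simp

/-! ### Multi-indices -/

/-- The factorial of a multi-index. -/
def multiFactorial {ι : Type*} [Fintype ι] (A : ι → ℕ) : ℕ := ∏ i, (A i).factorial

/-- The multi-indices all of whose entries are less than `M`. -/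
def box (ι : Type*) [Fintype ι] [DecidableEq ι] (M : ℕ) : Finset (ι → ℕ) :=
  Fintype.piFinset fun _ => Finset.range M

instance instDecidableLEMultiIndex {ι : Type*} [Fintype ι] : DecidableLE (ι → ℕ) :=
  fun A B => inferInstanceAs (Decidable (∀ i, A i ≤ B i))

section multiIndex

variable {ι : Type*} [Fintype ι]

theorem multiFactorial_pos (A : ι → ℕ) : 0 < multiFactorial A :=
  Finset.prod_pos fun _ _ => Nat.factorial_pos _

theorem multiFactorial_ne_zero (A : ι → ℕ) : (multiFactorial A : ℂ) ≠ 0 :=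
  Nat.cast_ne_zero.2 (multiFactorial_pos A).ne'

theorem multiFactorial_cast_pos (A : ι → ℕ) : (0 : ℝ) < multiFactorial A :=
  Nat.cast_pos.2 (multiFactorial_pos A)

variable [DecidableEq ι]

theorem mem_box {M : ℕ} {A : ι → ℕ} : A ∈ box ι M ↔ ∀ i, A i < M := by
  simp [box]

theorem mem_box_of_le {M : ℕ} {A B : ι → ℕ} (hB : B ∈ box ι M) (h : A ≤ B) : A ∈ box ι M :=
  mem_box.2 fun i => (h i).trans_lt (mem_box.1 hB i)

/-- Reindexing of a sum over the multi-indices `A ≥ R` by `A - R`. -/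
theorem sum_box_shift {E : Type*} [AddCommMonoid E] (M : ℕ) (R : ι → ℕ) (f : (ι → ℕ) → (ι → ℕ) → E)
    (hf : ∀ N A, A ∉ box ι M → f N A = 0) :
    ∑ A ∈ box ι M, (if R ≤ A then f (A - R) A else 0) = ∑ N ∈ box ι M, f N (N + R) := by
  rw [← Finset.sum_filter]
  have h2 : ∑ N ∈ box ι M, f N (N + R) = ∑ N ∈ box ι M with N + R ∈ box ι M, f N (N + R) := by
    rw [Finset.sum_filter]
    refine Finset.sum_congr rfl fun N _ => ?_
    split_ifs with h
    · rfl
    · exact hf _ _ h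
  rw [h2]
  refine Finset.sum_nbij' (fun A => A - R) (fun N => N + R) ?_ ?_ ?_ ?_ ?_
  · intro A hA
    rw [Finset.mem_filter] at hA ⊢
    rw [tsub_add_cancel_of_le hA.2]
    exact ⟨mem_box_of_le hA.1 tsub_le_self, hA.1⟩
  · intro N hN
    rw [Finset.mem_filter] at hN ⊢
    exact ⟨hN.2, le_add_self⟩
  · intro A hA
    exact tsub_add_cancel_of_le (Finset.mem_filter.1 hA).2
  · intro N _
    exact add_tsub_cancel_right N R
  · intro A hA
    rw [tsub_add_cancel_of_le (Finset.mem_filter.1 hA).2]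

/-- The binomial theorem for multi-indices, as an upper bound. -/
theorem sum_multinomial_le (s t : Finset (ι → ℕ)) (N : ι → ℕ) {x y : ℝ} (hx : 0 ≤ x) (hy : 0 ≤ y) :
    ∑ N₁ ∈ s, ∑ N₂ ∈ t, (if N₁ + N₂ = N then
      (multiFactorial N : ℝ) / (multiFactorial N₁ * multiFactorial N₂)
        * (x ^ (∑ i, N₁ i) * y ^ (∑ i, N₂ i)) else 0) ≤ (x + y) ^ (∑ i, N i) := by
  have h1 : ∀ N₁ ∈ s, ∑ N₂ ∈ t, (if N₁ + N₂ = N then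
      (multiFactorial N : ℝ) / (multiFactorial N₁ * multiFactorial N₂)
        * (x ^ (∑ i, N₁ i) * y ^ (∑ i, N₂ i)) else 0)
      ≤ if N₁ ≤ N then ∏ i, (x ^ N₁ i * y ^ (N i - N₁ i) * ((N i).choose (N₁ i) : ℝ)) else 0 := by
    intro N₁ _
    split_ifs with h
    · have hpos : 0 ≤ ∏ i, (x ^ N₁ i * y ^ (N i - N₁ i) * ((N i).choose (N₁ i) : ℝ)) := by
        positivity
      have : ∀ N₂ ∈ t, (if N₁ + N₂ = N then
        (multiFactorial N : ℝ) / (multiFactorial N₁ * multiFactorial N₂)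
          * (x ^ (∑ i, N₁ i) * y ^ (∑ i, N₂ i)) else 0)
          = if N₂ = N - N₁ then ∏ i, (x ^ N₁ i * y ^ (N i - N₁ i) * ((N i).choose (N₁ i) : ℝ))
            else 0 := by
        intro N₂ _
        have e : N₁ + N₂ = N ↔ N₂ = N - N₁ := by
          constructor
          · rintro rfl; simp
          · rintro rfl; exact add_tsub_cancel_of_le h
        simp only [e]
        split_ifs with h2
        · subst h2
          rw [Finset.prod_mul_distrib, Finset.prod_mul_distrib, Finset.prod_pow_eq_pow_sum,
            Finset.prod_pow_eq_pow_sum]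
          simp only [Pi.sub_apply]
          rw [mul_comm]
          congr 1
          simp only [multiFactorial, Nat.cast_prod]
          rw [← Finset.prod_mul_distrib, ← Finset.prod_div_distrib]
          refine Finset.prod_congr rfl fun i _ => ?_
          rw [Nat.cast_choose ℝ (h i)]
          rfl
        · rfl
      rw [Finset.sum_congr rfl this, Finset.sum_ite_eq']
      split_ifs
      · exact le_rfl
      · exact hpos
    · refine le_of_eq (Finset.sum_eq_zero fun N₂ _ => if_neg ?_)
      rintro rfl
      exact h le_self_add
  refine (Finset.sum_le_sum h1).trans ?_
  rw [← Finset.sum_filter, ← Finset.prod_pow_eq_pow_sum]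
  simp only [add_pow]
  rw [Finset.prod_univ_sum]
  refine Finset.sum_le_sum_of_subset_of_nonneg ?_ fun _ _ _ => by positivity
  intro N₁ h
  simp only [Fintype.mem_piFinset, Finset.mem_range]
  exact fun i => Nat.lt_succ_iff.2 ((Finset.mem_filter.1 h).2 i)

end multiIndex

/-! ### Products of complex Hermite polynomials -/

section hermite

variable {J : Type*} [Fintype J]

/-- The product over `j` of complex Hermite polynomials of covariance `v j` at `z j`, with degrees
`A (inl j)` and `A (inr j)`. -/
noncomputable def multiHerm (v : J → ℝ) (z : J → ℂ) (A : J ⊕ J → ℕ) : ℂ :=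
  ∏ j, cHerm (v j) (z j) (conj (z j)) (A (.inl j)) (A (.inr j))

theorem multiHerm_zero (v : J → ℝ) (z : J → ℂ) : multiHerm v z 0 = 1 := by
  simp [multiHerm, cHerm_zero_left]

theorem multiHerm_conj (v : J → ℝ) (z : J → ℂ) (A : J ⊕ J → ℕ) :
    conj (multiHerm v z A) = multiHerm v z (A ∘ Sum.swap) := by
  simp [multiHerm, cHerm_conj]

theorem multiFactorial_comp_swap (R : J ⊕ J → ℕ) :
    multiFactorial (R ∘ Sum.swap) = multiFactorial R := by
  unfold multiFactorial
  exact Equiv.prod_comp (Equiv.sumComm J J) fun i => (R i).factorial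

variable [DecidableEq J]

/-- The product formula for products of complex Hermite polynomials. -/
theorem multiHerm_mul (v : J → ℝ) (z : J → ℂ) (A B : J ⊕ J → ℕ) :
    multiHerm v z A * multiHerm v z B
      = ∑ R ∈ Fintype.piFinset fun i => Finset.range (A i + 1),
        (∏ i, (((Sum.elim v v i : ℝ) : ℂ) ^ R i * ((A i).choose (R i) * (B i.swap).descFactorial (R
            i))))
          * multiHerm v z (A - R + (B - R ∘ Sum.swap)) := by
  unfold multiHerm
  rw [← Finset.prod_mul_distrib]
  simp only [cHerm_mul_cHerm, cHermProd]
  simp only [← Finset.sum_product']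
  rw [Finset.prod_univ_sum]
  -- `R (inl j)` counts the holomorphic variables of the first factor contracted at `j`, and `R (inr
  -- j)` the conjugate ones. Each meets its opposite in the second factor, whence `R ∘ Sum.swap`
  -- there.
  refine Finset.sum_nbij' (fun p => Sum.elim (fun j => (p j).1) fun j => (p j).2)
    (fun R j => (R (.inl j), R (.inr j))) ?_ ?_ ?_ ?_ ?_
  · intro p hp
    simp only [Fintype.mem_piFinset, Finset.mem_product] at hp ⊢
    rintro (j | j)
    · exact (hp j).1
    · exact (hp j).2
  · intro R hR
    simp only [Fintype.mem_piFinset, Finset.mem_product] at hR ⊢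
    exact fun j => ⟨hR _, hR _⟩
  · intro p _; rfl
  · intro R _; ext (j | j) <;> rfl
  · intro p _
    rw [Fintype.prod_sum_type, ← Finset.prod_mul_distrib, ← Finset.prod_mul_distrib]
    refine Finset.prod_congr rfl fun j _ => ?_
    simp only [Pi.add_apply, Pi.sub_apply, Function.comp, Sum.elim_inl, Sum.elim_inr,
      Sum.swap_inl, Sum.swap_inr]
    ring

/-- The linear combination of Hermite products with coefficients `c A / A!`. -/
noncomputable def hermSum (v : J → ℝ) (z : J → ℂ) (M : ℕ) (c : (J ⊕ J → ℕ) → ℂ) : ℂ :=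
  ∑ A ∈ box (J ⊕ J) M, c A / multiFactorial A * multiHerm v z A

/-- The coefficients of the contractions of two sums of Hermite products. -/
noncomputable def contrCoeff (v : J → ℝ) (M : ℕ) (c d : (J ⊕ J → ℕ) → ℂ) (N₁ N₂ : J ⊕ J → ℕ) : ℂ :=
  ∑ R ∈ box (J ⊕ J) M, (∏ i, ((Sum.elim v v i : ℝ) : ℂ) ^ R i) / multiFactorial R
    * (c (N₁ + R) * d (N₂ + R ∘ Sum.swap))

/-- The coefficients of the product of two sums of Hermite products. -/
noncomputable def mulCoeff (v : J → ℝ) (M : ℕ) (c d : (J ⊕ J → ℕ) → ℂ) (N : J ⊕ J → ℕ) : ℂ :=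
  ∑ N₁ ∈ box (J ⊕ J) M, ∑ N₂ ∈ box (J ⊕ J) M, if N₁ + N₂ = N then
    (multiFactorial N : ℂ) / (multiFactorial N₁ * multiFactorial N₂) * contrCoeff v M c d N₁ N₂
    else 0

theorem comp_swap_mem_box {M : ℕ} {R : J ⊕ J → ℕ} (h : R ∈ box (J ⊕ J) M) :
    R ∘ Sum.swap ∈ box (J ⊕ J) M :=
  mem_box.2 fun i => mem_box.1 h i.swap

/-- Dividing by `A!` and `B!` turns the combinatorial factor into the reciprocal of `R! (A - R)! (B
- R ∘ swap)!`, which depends only on the contracted and the surviving indices. If `R ∘ swap ≤ B`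
fails, a falling factorial is zero. -/
theorem multiHerm_mul_div (v : J → ℝ) (z : J → ℂ) (M : ℕ) {A : J ⊕ J → ℕ}
    (hA : A ∈ box (J ⊕ J) M) (B : J ⊕ J → ℕ) (a b : ℂ) :
    a / multiFactorial A * multiHerm v z A * (b / multiFactorial B * multiHerm v z B)
      = ∑ R ∈ box (J ⊕ J) M, if R ≤ A then (if R ∘ Sum.swap ≤ B then
        (∏ i, ((Sum.elim v v i : ℝ) : ℂ) ^ R i) / multiFactorial R * (a * b) /
          (multiFactorial (A - R) * multiFactorial (B - R ∘ Sum.swap))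
          * multiHerm v z (A - R + (B - R ∘ Sum.swap)) else 0) else 0 := by
  rw [← Finset.sum_filter]
  have hs : (box (J ⊕ J) M).filter (fun R => R ≤ A)
      = Fintype.piFinset fun i => Finset.range (A i + 1) := by
    ext R
    simp only [Finset.mem_filter, Fintype.mem_piFinset, Finset.mem_range, Nat.lt_succ_iff]
    exact ⟨fun h => h.2, fun h => ⟨mem_box_of_le hA h, h⟩⟩
  rw [hs, mul_mul_mul_comm, multiHerm_mul, Finset.mul_sum]
  refine Finset.sum_congr rfl fun R hR => ?_
  have hRA : R ≤ A := by
    simp only [Fintype.mem_piFinset, Finset.mem_range, Nat.lt_succ_iff] at hR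
    exact hR
  split_ifs with hRB
  · have key : (multiFactorial A : ℂ) * multiFactorial B / (multiFactorial R *
        (multiFactorial (A - R) * multiFactorial (B - R ∘ Sum.swap)))
        = ∏ i, (((A i).choose (R i) : ℂ) * (B i.swap).descFactorial (R i)) := by
      have e1 : multiFactorial B = ∏ i : J ⊕ J, (B i.swap).factorial :=
        (Equiv.prod_comp (Equiv.sumComm J J) fun i => (B i).factorial).symm
      have e2 : multiFactorial (B - R ∘ Sum.swap) = ∏ i : J ⊕ J, (B i.swap - R i).factorial := by
        rw [← multiFactorial_comp_swap]
        simp [multiFactorial]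
      rw [e1, e2]
      simp only [multiFactorial, Nat.cast_prod]
      rw [← Finset.prod_mul_distrib, ← Finset.prod_mul_distrib, ← Finset.prod_mul_distrib,
        ← Finset.prod_div_distrib]
      refine Finset.prod_congr rfl fun i _ => ?_
      have hB : R i ≤ B i.swap := by simpa using hRB i.swap
      rw [Nat.cast_choose ℂ (hRA i), ← Nat.factorial_mul_descFactorial hB]
      have := Nat.factorial_ne_zero (R i)
      have := Nat.factorial_ne_zero (A i - R i)
      have := Nat.factorial_ne_zero (B i.swap - R i)
      push_cast
      simp only [Pi.sub_apply]
      field_simp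
    rw [Finset.prod_mul_distrib, ← key]
    have := multiFactorial_ne_zero A
    have := multiFactorial_ne_zero B
    field_simp
  · have : ∃ i, B i.swap < R i := by
      simp only [Pi.le_def, not_forall, not_le, Function.comp] at hRB
      obtain ⟨i, hi⟩ := hRB
      exact ⟨i.swap, by simpa using hi⟩
    obtain ⟨i, hi⟩ := this
    rw [Finset.prod_eq_zero (Finset.mem_univ i)]
    · simp
    · simp [Nat.descFactorial_of_lt hi]

/-- The substitution `A = N₁ + R`, `B = N₂ + R ∘ swap` makes the sums over `R`, `N₁`, `N₂`
independent. The support conditions on `c` and `d` let each of them run over the whole box. -/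
theorem hermSum_mul_hermSum (v : J → ℝ) (z : J → ℂ) (M : ℕ) (c d : (J ⊕ J → ℕ) → ℂ)
    (hc : ∀ A, A ∉ box (J ⊕ J) M → c A = 0) (hd : ∀ A, A ∉ box (J ⊕ J) M → d A = 0) :
    hermSum v z M c * hermSum v z M d = hermSum v z (2 * M) (mulCoeff v M c d) := by
  have h1 : hermSum v z M c * hermSum v z M d = ∑ N₁ ∈ box (J ⊕ J) M, ∑ N₂ ∈ box (J ⊕ J) M,
      contrCoeff v M c d N₁ N₂ / (multiFactorial N₁ * multiFactorial N₂)
        * multiHerm v z (N₁ + N₂) := by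
    unfold hermSum contrCoeff
    rw [Finset.sum_mul_sum]
    calc _ = ∑ A ∈ box (J ⊕ J) M, ∑ B ∈ box (J ⊕ J) M, ∑ R ∈ box (J ⊕ J) M, (if R ≤ A then
            (if R ∘ Sum.swap ≤ B then
            (∏ i, ((Sum.elim v v i : ℝ) : ℂ) ^ R i) / multiFactorial R * (c A * d B) /
              (multiFactorial (A - R) * multiFactorial (B - R ∘ Sum.swap))
              * multiHerm v z (A - R + (B - R ∘ Sum.swap)) else 0) else 0) :=
          Finset.sum_congr rfl fun A hA => Finset.sum_congr rfl fun B _ =>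
            multiHerm_mul_div v z M hA B _ _
      _ = ∑ R ∈ box (J ⊕ J) M, ∑ A ∈ box (J ⊕ J) M, (if R ≤ A then ∑ B ∈ box (J ⊕ J) M,
            (if R ∘ Sum.swap ≤ B then
            (∏ i, ((Sum.elim v v i : ℝ) : ℂ) ^ R i) / multiFactorial R * (c A * d B) /
              (multiFactorial (A - R) * multiFactorial (B - R ∘ Sum.swap))
              * multiHerm v z (A - R + (B - R ∘ Sum.swap)) else 0) else 0) := by
          rw [Finset.sum_comm' (t' := box (J ⊕ J) M) (s' := fun _ => box (J ⊕ J) M) (by tauto)]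
          rw [Finset.sum_congr rfl fun _ _ => Finset.sum_comm, Finset.sum_comm]
          rw [Finset.sum_congr rfl fun _ _ => Finset.sum_comm]
          refine Finset.sum_congr rfl fun R _ => Finset.sum_congr rfl fun A _ => ?_
          split_ifs <;> simp
      _ = ∑ R ∈ box (J ⊕ J) M, ∑ N₁ ∈ box (J ⊕ J) M, ∑ N₂ ∈ box (J ⊕ J) M,
            (∏ i, ((Sum.elim v v i : ℝ) : ℂ) ^ R i) / multiFactorial R
              * (c (N₁ + R) * d (N₂ + R ∘ Sum.swap)) / (multiFactorial N₁ * multiFactorial N₂)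
              * multiHerm v z (N₁ + N₂) := by
          refine Finset.sum_congr rfl fun R _ => ?_
          rw [sum_box_shift M R (fun N A => ∑ B ∈ box (J ⊕ J) M,
            (if R ∘ Sum.swap ≤ B then
            (∏ i, ((Sum.elim v v i : ℝ) : ℂ) ^ R i) / multiFactorial R * (c A * d B) /
              (multiFactorial N * multiFactorial (B - R ∘ Sum.swap))
              * multiHerm v z (N + (B - R ∘ Sum.swap)) else 0))]
          · refine Finset.sum_congr rfl fun N₁ _ => ?_
            rw [sum_box_shift M (R ∘ Sum.swap) (fun N B =>
              (∏ i, ((Sum.elim v v i : ℝ) : ℂ) ^ R i) / multiFactorial R * (c (N₁ + R) * d B) /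
                (multiFactorial N₁ * multiFactorial N) * multiHerm v z (N₁ + N))]
            intro N B hB
            simp [hd B hB]
          · intro N A hA
            simp [hc A hA]
      _ = _ := by
          rw [Finset.sum_comm]
          refine Finset.sum_congr rfl fun N₁ _ => ?_
          rw [Finset.sum_comm]
          refine Finset.sum_congr rfl fun N₂ _ => ?_
          rw [Finset.sum_div, Finset.sum_mul]
  rw [h1]
  unfold hermSum mulCoeff
  simp only [Finset.sum_div, Finset.sum_mul]
  symm
  rw [Finset.sum_comm]
  refine Finset.sum_congr rfl fun N₁ hN₁ => ?_
  rw [Finset.sum_comm]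
  refine Finset.sum_congr rfl fun N₂ hN₂ => ?_
  have hmem : N₁ + N₂ ∈ box (J ⊕ J) (2 * M) := mem_box.2 fun i => by
    have := mem_box.1 hN₁ i; have := mem_box.1 hN₂ i
    simp only [Pi.add_apply]; omega
  rw [Finset.sum_eq_single_of_mem _ hmem]
  · rw [if_pos rfl]
    have := multiFactorial_ne_zero (N₁ + N₂)
    field_simp
  · intro N _ hN
    rw [if_neg (Ne.symm hN)]
    simp

end hermite

/-! ### The product estimate for sums of Hermite products -/

section estimate

/-- Collecting the terms with `N + R = A` leaves `f A / A!` times a binomial sum bounded by `(s + k)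
^ |A|`. -/
theorem sum_shift_le {ι : Type*} [Fintype ι] [DecidableEq ι] (M : ℕ) (f : (ι → ℕ) → ℝ)
    (hf0 : ∀ A, 0 ≤ f A) (hf : ∀ A, A ∉ box ι M → f A = 0) {s k a : ℝ} (hs : 0 ≤ s) (hk : 0 ≤ k)
    (ha : s + k ≤ a) :
    ∑ N ∈ box ι M, s ^ (∑ i, N i) / multiFactorial N *
      (∑ R ∈ box ι M, k ^ (∑ i, R i) / multiFactorial R * f (N + R))
      ≤ ∑ A ∈ box ι M, f A / multiFactorial A * a ^ (∑ i, A i) := by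
  have h1 : ∀ N ∈ box ι M, ∀ R ∈ box ι M,
      s ^ (∑ i, N i) / multiFactorial N * (k ^ (∑ i, R i) / multiFactorial R * f (N + R))
      = ∑ A ∈ box ι M, f A / multiFactorial A * (if N + R = A then
          (multiFactorial A : ℝ) / (multiFactorial N * multiFactorial R)
            * (s ^ (∑ i, N i) * k ^ (∑ i, R i)) else 0) := by
    intro N _ R _
    simp only [mul_ite, mul_zero]
    rw [Finset.sum_ite_eq]
    have := (multiFactorial_cast_pos (N + R)).ne'
    split_ifs with h
    · field_simp
    · rw [hf _ h]; simp
  simp only [Finset.mul_sum]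
  rw [Finset.sum_congr rfl fun N hN => Finset.sum_congr rfl fun R hR => h1 N hN R hR,
    Finset.sum_congr rfl fun _ _ => Finset.sum_comm, Finset.sum_comm]
  refine Finset.sum_le_sum fun A _ => ?_
  simp only [← Finset.mul_sum]
  have := multiFactorial_cast_pos A
  refine mul_le_mul_of_nonneg_left ?_ (div_nonneg (hf0 A) this.le)
  exact (sum_multinomial_le _ _ A hs hk).trans (pow_le_pow_left₀ (by positivity) ha _)

variable {J : Type*} [Fintype J] [DecidableEq J]

/-- Cauchy-Schwarz over the contractions `R`. The weight `v ^ (2R)` is shared between the factors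
through `v² ≤ k l`, and the twist by `swap` disappears from the second sum by reindexing. -/
theorem norm_contrCoeff_sq_le (v : J → ℝ) (M : ℕ) (c d : (J ⊕ J → ℕ) → ℂ) {k l : ℝ}
    (hk : 0 ≤ k) (hl : 0 ≤ l) (hv : ∀ j, v j ^ 2 ≤ k * l) (N₁ N₂ : J ⊕ J → ℕ) :
    ‖contrCoeff v M c d N₁ N₂‖ ^ 2
      ≤ (∑ R ∈ box (J ⊕ J) M, k ^ (∑ i, R i) / multiFactorial R * ‖c (N₁ + R)‖ ^ 2)
        * ∑ R ∈ box (J ⊕ J) M, l ^ (∑ i, R i) / multiFactorial R * ‖d (N₂ + R)‖ ^ 2 := by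
  have hsw : ∑ R ∈ box (J ⊕ J) M, l ^ (∑ i, R i) / multiFactorial R * ‖d (N₂ + R)‖ ^ 2
      = ∑ R ∈ box (J ⊕ J) M, l ^ (∑ i, R i) / multiFactorial R * ‖d (N₂ + R ∘ Sum.swap)‖ ^ 2 := by
    refine Finset.sum_nbij' (fun R => R ∘ Sum.swap) (fun R => R ∘ Sum.swap)
      (fun _ h => comp_swap_mem_box h) (fun _ h => comp_swap_mem_box h)
      (fun R _ => by ext; simp) (fun R _ => by ext; simp) fun R _ => ?_
    rw [multiFactorial_comp_swap]
    have : ∑ i, (R ∘ Sum.swap) i = ∑ i, R i := Equiv.sum_comp (Equiv.sumComm J J) R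
    rw [this]
    congr 5
    ext; simp
  rw [hsw]
  have h1 : ‖contrCoeff v M c d N₁ N₂‖ ≤ ∑ R ∈ box (J ⊕ J) M,
      ‖(∏ i, ((Sum.elim v v i : ℝ) : ℂ) ^ R i) / multiFactorial R
        * (c (N₁ + R) * d (N₂ + R ∘ Sum.swap))‖ := norm_sum_le _ _
  refine (pow_le_pow_left₀ (norm_nonneg _) h1 2).trans ?_
  refine Finset.sum_sq_le_sum_mul_sum_of_sq_le_mul _ (fun R _ => by positivity)
    (fun R _ => by positivity) fun R _ => ?_
  have h2 : ‖∏ i, ((Sum.elim v v i : ℝ) : ℂ) ^ R i‖ ^ 2 ≤ k ^ (∑ i, R i) * l ^ (∑ i, R i) := by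
    rw [norm_prod, ← Finset.prod_pow, ← mul_pow, ← Finset.prod_pow_eq_pow_sum]
    refine Finset.prod_le_prod (fun i _ => by positivity) fun i _ => ?_
    rw [norm_pow, ← pow_mul, mul_comm, pow_mul]
    refine pow_le_pow_left₀ (by positivity) ?_ _
    rw [Complex.norm_real, Real.norm_eq_abs, sq_abs]
    rcases i with j | j <;> exact hv j
  rw [norm_mul, norm_div, norm_mul, Complex.norm_natCast, mul_pow, mul_pow, div_pow]
  have := multiFactorial_cast_pos R
  calc _ ≤ (k ^ (∑ i, R i) * l ^ (∑ i, R i)) / (multiFactorial R : ℝ) ^ 2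
        * (‖c (N₁ + R)‖ ^ 2 * ‖d (N₂ + R ∘ Sum.swap)‖ ^ 2) := by gcongr
    _ = _ := by field_simp

/-- Cauchy-Schwarz over the splittings `N₁ + N₂ = N` with weights `x ^ |N₁| y ^ |N₂|` times the
multinomial coefficient. These weights sum to at most `(x + y) ^ |N| ≤ 1`, so only their reciprocals
remain. -/
theorem norm_mulCoeff_sq_le (v : J → ℝ) (M : ℕ) (c d : (J ⊕ J → ℕ) → ℂ) {q x y : ℝ}
    (hq : 0 ≤ q) (hx : 0 < x) (hy : 0 < y) (hxy : x + y ≤ 1) (N : J ⊕ J → ℕ) :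
    ‖mulCoeff v M c d N‖ ^ 2 / multiFactorial N * q ^ (∑ i, N i)
      ≤ ∑ N₁ ∈ box (J ⊕ J) M, ∑ N₂ ∈ box (J ⊕ J) M, if N₁ + N₂ = N then
        ((q / x) ^ (∑ i, N₁ i) / multiFactorial N₁) * ((q / y) ^ (∑ i, N₂ i) / multiFactorial N₂)
          * ‖contrCoeff v M c d N₁ N₂‖ ^ 2 else 0 := by
  have hN := multiFactorial_cast_pos N
  have h1 : ‖mulCoeff v M c d N‖ ≤ ∑ p ∈ box (J ⊕ J) M ×ˢ box (J ⊕ J) M, (if p.1 + p.2 = N then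
      (multiFactorial N : ℝ) / (multiFactorial p.1 * multiFactorial p.2)
        * ‖contrCoeff v M c d p.1 p.2‖ else 0) := by
    unfold mulCoeff
    rw [← Finset.sum_product']
    refine (norm_sum_le _ _).trans (Finset.sum_le_sum fun p _ => ?_)
    split_ifs <;> simp
  have h2 := sum_multinomial_le (box (J ⊕ J) M) (box (J ⊕ J) M) N hx.le hy.le
  rw [← Finset.sum_product'] at h2 ⊢
  have h3 : ‖mulCoeff v M c d N‖ ^ 2 ≤ (∑ p ∈ box (J ⊕ J) M ×ˢ box (J ⊕ J) M,
      if p.1 + p.2 = N then (multiFactorial N : ℝ) / (multiFactorial p.1 * multiFactorial p.2)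
        * (x ^ (∑ i, p.1 i) * y ^ (∑ i, p.2 i)) else 0)
      * ∑ p ∈ box (J ⊕ J) M ×ˢ box (J ⊕ J) M,
      if p.1 + p.2 = N then (multiFactorial N : ℝ) / (multiFactorial p.1 * multiFactorial p.2)
        * (‖contrCoeff v M c d p.1 p.2‖ ^ 2 / (x ^ (∑ i, p.1 i) * y ^ (∑ i, p.2 i))) else 0 := by
    refine (pow_le_pow_left₀ (norm_nonneg _) h1 2).trans ?_
    refine Finset.sum_sq_le_sum_mul_sum_of_sq_le_mul _ (fun p _ => ?_) (fun p _ => ?_) fun p _ => ?_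
    · split_ifs <;> positivity
    · split_ifs <;> positivity
    · split_ifs
      · refine le_of_eq ?_
        have := multiFactorial_cast_pos p.1
        have := multiFactorial_cast_pos p.2
        field_simp
      · simp
  have h4 : ‖mulCoeff v M c d N‖ ^ 2 ≤ ∑ p ∈ box (J ⊕ J) M ×ˢ box (J ⊕ J) M,
      if p.1 + p.2 = N then (multiFactorial N : ℝ) / (multiFactorial p.1 * multiFactorial p.2)
        * (‖contrCoeff v M c d p.1 p.2‖ ^ 2 / (x ^ (∑ i, p.1 i) * y ^ (∑ i, p.2 i))) else 0 := by
    refine h3.trans (mul_le_of_le_one_left (Finset.sum_nonneg fun p _ => ?_)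
      (h2.trans (pow_le_one₀ (by positivity) hxy)))
    split_ifs <;> positivity
  calc _ ≤ (∑ p ∈ box (J ⊕ J) M ×ˢ box (J ⊕ J) M,
      if p.1 + p.2 = N then (multiFactorial N : ℝ) / (multiFactorial p.1 * multiFactorial p.2)
        * (‖contrCoeff v M c d p.1 p.2‖ ^ 2 / (x ^ (∑ i, p.1 i) * y ^ (∑ i, p.2 i))) else 0)
        / multiFactorial N * q ^ (∑ i, N i) := by gcongr
    _ = _ := by
      rw [Finset.sum_div, Finset.sum_mul]
      refine Finset.sum_congr rfl fun p _ => ?_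
      split_ifs with h
      · have := multiFactorial_cast_pos p.1
        have := multiFactorial_cast_pos p.2
        have e : ∑ i, N i = ∑ i, p.1 i + ∑ i, p.2 i := by
          rw [← h, ← Finset.sum_add_distrib]; rfl
        rw [e, pow_add, div_pow, div_pow]
        field_simp
      · simp

/-- The product estimate in terms of coefficients. -/
theorem sum_norm_mulCoeff_sq_le (v : J → ℝ) (M : ℕ) (c d : (J ⊕ J → ℕ) → ℂ)
    (hc : ∀ A, A ∉ box (J ⊕ J) M → c A = 0) (hd : ∀ A, A ∉ box (J ⊕ J) M → d A = 0)
    {q x y k l a b : ℝ} (hq : 0 ≤ q) (hx : 0 < x) (hy : 0 < y) (hxy : x + y ≤ 1)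
    (hk : 0 ≤ k) (hl : 0 ≤ l) (hv : ∀ j, v j ^ 2 ≤ k * l)
    (ha : q / x + k ≤ a) (hb : q / y + l ≤ b) :
    ∑ N ∈ box (J ⊕ J) (2 * M), ‖mulCoeff v M c d N‖ ^ 2 / multiFactorial N * q ^ (∑ i, N i)
      ≤ (∑ A ∈ box (J ⊕ J) M, ‖c A‖ ^ 2 / multiFactorial A * a ^ (∑ i, A i))
        * ∑ A ∈ box (J ⊕ J) M, ‖d A‖ ^ 2 / multiFactorial A * b ^ (∑ i, A i) := by
  refine (Finset.sum_le_sum fun N _ => norm_mulCoeff_sq_le v M c d hq hx hy hxy N).trans ?_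
  rw [Finset.sum_comm]
  rw [Finset.sum_congr rfl fun _ _ => Finset.sum_comm]
  have h1 : ∀ N₁ ∈ box (J ⊕ J) M, ∀ N₂ ∈ box (J ⊕ J) M,
      (∑ N ∈ box (J ⊕ J) (2 * M), if N₁ + N₂ = N then
        ((q / x) ^ (∑ i, N₁ i) / multiFactorial N₁) * ((q / y) ^ (∑ i, N₂ i) / multiFactorial N₂)
          * ‖contrCoeff v M c d N₁ N₂‖ ^ 2 else 0)
      ≤ ((q / x) ^ (∑ i, N₁ i) / multiFactorial N₁ *
          (∑ R ∈ box (J ⊕ J) M, k ^ (∑ i, R i) / multiFactorial R * ‖c (N₁ + R)‖ ^ 2))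
        * ((q / y) ^ (∑ i, N₂ i) / multiFactorial N₂ *
          ∑ R ∈ box (J ⊕ J) M, l ^ (∑ i, R i) / multiFactorial R * ‖d (N₂ + R)‖ ^ 2) := by
    intro N₁ _ N₂ _
    rw [Finset.sum_ite_eq, mul_mul_mul_comm]
    have h := norm_contrCoeff_sq_le v M c d hk hl hv N₁ N₂
    have hx' : 0 ≤ q / x := by positivity
    have hy' : 0 ≤ q / y := by positivity
    split_ifs
    · gcongr
    · positivity
  refine (Finset.sum_le_sum fun N₁ h => Finset.sum_le_sum fun N₂ h' => h1 N₁ h N₂ h').trans ?_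
  rw [← Finset.sum_mul_sum]
  refine mul_le_mul ?_ ?_ ?_ ?_
  · exact sum_shift_le M (fun A => ‖c A‖ ^ 2) (fun A => by positivity)
      (fun A h => by simp [hc A h]) (by positivity) hk ha
  · exact sum_shift_le M (fun A => ‖d A‖ ^ 2) (fun A => by positivity)
      (fun A h => by simp [hd A h]) (by positivity) hl hb
  · exact Finset.sum_nonneg fun _ _ => by positivity
  · have : 0 ≤ a := (by positivity : 0 ≤ q / x + k).trans ha
    exact Finset.sum_nonneg fun _ _ => by positivity

end estimate

/-! ### Index functions and their multi-indices -/

section count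

variable {J : Type*} [DecidableEq J] {n m : ℕ}

/-- The number of times the index function `I` takes the value `j`. -/
def idxCount (I : Fin n → J) (j : J) : ℕ := (Finset.univ.filter fun i => I i = j).card

theorem exists_perm_of_idxCount_eq {I K : Fin n → J} (h : idxCount I = idxCount K) :
    ∃ σ : Equiv.Perm (Fin n), K ∘ σ = I := by
  have e : ∀ j, Nonempty ({i // I i = j} ≃ {i // K i = j}) := by
    intro j
    refine Fintype.card_eq.1 ?_
    rw [Fintype.card_subtype, Fintype.card_subtype]
    exact congrFun h j
  refine ⟨Equiv.ofFiberEquiv fun j => (e j).some, ?_⟩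
  funext i
  exact Equiv.ofFiberEquiv_map _ i

variable [Fintype J]

theorem sum_idxCount (I : Fin n → J) : ∑ j, idxCount I j = n := by
  have := Finset.card_eq_sum_card_fiberwise (s := Finset.univ) (t := Finset.univ) (f := I)
    (fun _ _ => by simp)
  simpa [idxCount] using this.symm

theorem prod_comp_eq_prod_pow_idxCount {R : Type*} [CommMonoid R] (I : Fin n → J) (f : J → R) :
    ∏ i, f (I i) = ∏ j, f j ^ idxCount I j := by
  rw [← Finset.prod_fiberwise Finset.univ I]
  refine Finset.prod_congr rfl fun j _ => ?_
  rw [Finset.prod_congr rfl (g := fun _ => f j), Finset.prod_const]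
  · rfl
  · intro i hi
    rw [(Finset.mem_filter.1 hi).2]

/-- The coefficient of `X ^ a` in `(∑ X j) ^ n` is computed twice: by expanding over index
functions, and by the multinomial theorem. -/
theorem card_idxCount_eq (a : J → ℕ) (ha : ∑ j, a j = n) :
    (Finset.univ.filter fun I : Fin n → J => idxCount I = a).card * multiFactorial a
      = n.factorial := by
  have h1 := Fintype.sum_pow (fun j : J => (MvPolynomial.X j : MvPolynomial J ℕ)) n
  rw [Finset.sum_pow_eq_sum_piAntidiag] at h1
  have hm : ∀ b : J → ℕ, ∏ j, (MvPolynomial.X j : MvPolynomial J ℕ) ^ b j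
      = MvPolynomial.monomial (Finsupp.equivFunOnFinite.symm b) 1 := by
    intro b
    rw [MvPolynomial.monomial_eq, Finsupp.prod_fintype _ _ (by simp)]
    simp
  have h2 := congrArg (MvPolynomial.coeff (Finsupp.equivFunOnFinite.symm a)) h1
  simp only [prod_comp_eq_prod_pow_idxCount, hm] at h2
  simp only [MvPolynomial.coeff_sum, ← nsmul_eq_mul, MvPolynomial.coeff_smul,
    MvPolynomial.coeff_monomial, EmbeddingLike.apply_eq_iff_eq, Finset.sum_boole] at h2
  rw [Finset.sum_eq_single_of_mem a (by simp [ha])] at h2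
  · simp only [if_true, nsmul_eq_mul, mul_one, Nat.cast_id] at h2
    rw [← h2, ← ha, mul_comm]
    exact Nat.multinomial_spec _ _
  · intro b _ hb
    simp [hb]

/-- The multi-index of a pair of index functions. -/
def pairCount (I : Fin n → J) (K : Fin m → J) : J ⊕ J → ℕ := Sum.elim (idxCount I) (idxCount K)

/-- The sum over all pairs of index functions of a function of their multi-index. -/
theorem sum_pairCount (M n m : ℕ) (F : (J ⊕ J → ℕ) → ℝ) (hF : ∀ A, A ∉ box (J ⊕ J) M → F A = 0) :
    (∑ I : Fin n → J, ∑ K : Fin m → J, F (pairCount I K)) / (n.factorial * m.factorial)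
      = ∑ A ∈ box (J ⊕ J) M, if ∑ j, A (.inl j) = n ∧ ∑ j, A (.inr j) = m then
          F A / multiFactorial A else 0 := by
  have h1 : ∀ (I : Fin n → J) (K : Fin m → J), F (pairCount I K)
      = ∑ A ∈ box (J ⊕ J) M, if idxCount I = A ∘ Sum.inl ∧ idxCount K = A ∘ Sum.inr then F A
        else 0 := by
    intro I K
    have : ∀ A : J ⊕ J → ℕ, (idxCount I = A ∘ Sum.inl ∧ idxCount K = A ∘ Sum.inr)
        ↔ pairCount I K = A := by
      intro A
      constructor
      · rintro ⟨h, h'⟩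
        ext (j | j)
        · exact congrFun h j
        · exact congrFun h' j
      · rintro rfl
        exact ⟨rfl, rfl⟩
    simp only [this]
    rw [Finset.sum_ite_eq]
    split_ifs with h
    · rfl
    · exact hF _ h
  simp only [h1]
  rw [Finset.sum_congr rfl fun _ _ => Finset.sum_comm, Finset.sum_comm, Finset.sum_div]
  refine Finset.sum_congr rfl fun A _ => ?_
  have hn : (n.factorial : ℝ) ≠ 0 := by exact_mod_cast n.factorial_ne_zero
  have hm : (m.factorial : ℝ) ≠ 0 := by exact_mod_cast m.factorial_ne_zero
  split_ifs with h
  · have c1 := card_idxCount_eq (A ∘ Sum.inl) h.1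
    have c2 := card_idxCount_eq (A ∘ Sum.inr) h.2
    have hA : multiFactorial A = multiFactorial (A ∘ Sum.inl) * multiFactorial (A ∘ Sum.inr) := by
      simp [multiFactorial, Fintype.prod_sum_type]
    have hs : (∑ I : Fin n → J, ∑ K : Fin m → J,
        if idxCount I = A ∘ Sum.inl ∧ idxCount K = A ∘ Sum.inr then F A else 0)
        = (Finset.univ.filter fun I : Fin n → J => idxCount I = A ∘ Sum.inl).card
          * ((Finset.univ.filter fun K : Fin m → J => idxCount K = A ∘ Sum.inr).card * F A) := by
      rw [← Finset.sum_product', ← Finset.sum_filter, Finset.sum_const, nsmul_eq_mul, ← mul_assoc,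
        ← Nat.cast_mul, ← Finset.card_product, ← Finset.filter_product]
    rw [hs, hA, ← c1, ← c2]
    have := multiFactorial_cast_pos (A ∘ Sum.inl)
    have := multiFactorial_cast_pos (A ∘ Sum.inr)
    have i1 : ((Finset.univ.filter fun I : Fin n → J => idxCount I = A ∘ Sum.inl).card : ℝ) ≠ 0 :=
        by
      intro h0
      have := n.factorial_ne_zero
      rw [← c1, Nat.cast_eq_zero.1 h0] at this
      simp at this
    have i2 : ((Finset.univ.filter fun I : Fin m → J => idxCount I = A ∘ Sum.inr).card : ℝ) ≠ 0 :=
        by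
      intro h0
      have := m.factorial_ne_zero
      rw [← c2, Nat.cast_eq_zero.1 h0] at this
      simp at this
    push_cast
    field_simp
  · rw [div_eq_zero_iff]
    left
    refine Finset.sum_eq_zero fun I _ => Finset.sum_eq_zero fun K _ => if_neg ?_
    rintro ⟨h1, h2⟩
    refine h ⟨?_, ?_⟩
    · rw [← sum_idxCount I, h1]; rfl
    · rw [← sum_idxCount K, h2]; rfl

end count

/-! ### Hermite polynomials of linear combinations -/

section linearCombination

variable {J : Type*} [Fintype J]

theorem multiHerm_add_single_left [DecidableEq J] (v : J → ℝ) (z : J → ℂ) (A : J ⊕ J → ℕ) (j : J) :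
    z j * multiHerm v z A = multiHerm v z (A + Pi.single (.inl j) 1)
      + v j * A (.inr j) * multiHerm v z (A - Pi.single (.inr j) 1) := by
  unfold multiHerm
  simp only [Fintype.prod_eq_mul_prod_compl j]
  have h1 : ∀ i ∈ ({j}ᶜ : Finset J), cHerm (v i) (z i) (conj (z i))
      ((A + Pi.single (Sum.inl j) 1 : J ⊕ J → ℕ) (Sum.inl i))
      ((A + Pi.single (Sum.inl j) 1 : J ⊕ J → ℕ) (Sum.inr i))
      = cHerm (v i) (z i) (conj (z i)) (A (.inl i)) (A (.inr i)) := by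
    intro i hi
    have : i ≠ j := by simpa using hi
    simp [this]
  have h2 : ∀ i ∈ ({j}ᶜ : Finset J), cHerm (v i) (z i) (conj (z i))
      ((A - Pi.single (Sum.inr j) 1 : J ⊕ J → ℕ) (Sum.inl i))
      ((A - Pi.single (Sum.inr j) 1 : J ⊕ J → ℕ) (Sum.inr i))
      = cHerm (v i) (z i) (conj (z i)) (A (.inl i)) (A (.inr i)) := by
    intro i hi
    have : i ≠ j := by simpa using hi
    simp [this]
  rw [Finset.prod_congr rfl h1, Finset.prod_congr rfl h2]
  simp only [Pi.add_apply, Pi.sub_apply, Pi.single_eq_same]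
  rw [Pi.single_eq_of_ne (by simp), Pi.single_eq_of_ne (by simp), ← mul_assoc, mul_cHerm]
  simp only [add_zero, Nat.sub_zero]
  ring

theorem multiHerm_add_single_right [DecidableEq J] (v : J → ℝ) (z : J → ℂ) (A : J ⊕ J → ℕ) (j : J) :
    conj (z j) * multiHerm v z A = multiHerm v z (A + Pi.single (.inr j) 1)
      + v j * A (.inl j) * multiHerm v z (A - Pi.single (.inl j) 1) := by
  have h := congrArg conj (multiHerm_add_single_left v z (A ∘ Sum.swap) j)
  have e : ∀ i j : J ⊕ J, (Pi.single i 1 : J ⊕ J → ℕ) j.swap = (Pi.single i.swap 1 : J ⊕ J → ℕ) j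
      := by
    intro i j
    by_cases hij : j = i.swap
    · subst hij; simp
    · rw [Pi.single_eq_of_ne hij, Pi.single_eq_of_ne]
      rintro rfl; simp at hij
  simp only [map_mul, map_add, multiHerm_conj, Complex.conj_ofReal, Complex.conj_natCast] at h
  have a0 : (A ∘ Sum.swap) ∘ Sum.swap = A := by ext i; simp
  have a1 : (A ∘ Sum.swap + Pi.single (Sum.inl j) 1 : J ⊕ J → ℕ) ∘ Sum.swap
      = A + Pi.single (.inr j) 1 := by
    ext i
    rw [Function.comp_apply, Pi.add_apply, Pi.add_apply, e]; simp
  have a2 : (A ∘ Sum.swap - Pi.single (Sum.inr j) 1 : J ⊕ J → ℕ) ∘ Sum.swap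
      = A - Pi.single (.inl j) 1 := by
    ext i
    rw [Function.comp_apply, Pi.sub_apply, Pi.sub_apply, e]; simp
  rw [a0, a1, a2] at h
  simpa using h

/-- The linear map sending the monomials to the corresponding Hermite products. -/
noncomputable def hermMap (v : J → ℝ) (z : J → ℂ) : MvPolynomial (J ⊕ J) ℂ →ₗ[ℂ] ℂ :=
  (MvPolynomial.basisMonomials (J ⊕ J) ℂ).constr ℂ fun A => multiHerm v z A

theorem hermMap_monomial (v : J → ℝ) (z : J → ℂ) (A : J ⊕ J →₀ ℕ) (a : ℂ) :
    hermMap v z (MvPolynomial.monomial A a) = a * multiHerm v z A := by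
  have h1 : MvPolynomial.monomial A a = a • MvPolynomial.basisMonomials (J ⊕ J) ℂ A := by
    rw [MvPolynomial.coe_basisMonomials, MvPolynomial.smul_monomial, smul_eq_mul, mul_one]
  rw [h1, map_smul, hermMap, Module.Basis.constr_basis, smul_eq_mul]

/-- The Hermite recursion in operator form: under `hermMap` a holomorphic variable acts as
multiplication by `z j` minus `v j` times the derivative in the conjugate variable. Being stated for
all polynomials, it applies to powers of linear forms. -/
theorem hermMap_X_inl_mul [DecidableEq J] (v : J → ℝ) (z : J → ℂ) (P : MvPolynomial (J ⊕ J) ℂ)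
    (j : J) : hermMap v z (MvPolynomial.X (.inl j) * P)
      = z j * hermMap v z P - v j * hermMap v z (MvPolynomial.pderiv (.inr j) P) := by
  induction P using MvPolynomial.monomial_add_induction_on with
  | C a =>
    have := multiHerm_add_single_left v z 0 j
    rw [MvPolynomial.pderiv_C, map_zero, ← MvPolynomial.monomial_zero', MvPolynomial.X,
      MvPolynomial.monomial_mul, hermMap_monomial, hermMap_monomial]
    simp only [Pi.zero_apply, Nat.cast_zero, mul_zero, zero_mul, add_zero, zero_add] at this
    simp only [add_zero, Finsupp.single_eq_pi_single, one_mul, mul_zero, sub_zero, Finsupp.coe_zero]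
    rw [← this]; ring
  | monomial_add A a P _ _ ih =>
    have := multiHerm_add_single_left v z A j
    rw [mul_add, map_add, map_add, map_add, map_add, ih, MvPolynomial.pderiv_monomial,
      MvPolynomial.X, MvPolynomial.monomial_mul, hermMap_monomial, hermMap_monomial,
      hermMap_monomial]
    have e1 : ((Finsupp.single (Sum.inl j) 1 + A : J ⊕ J →₀ ℕ) : J ⊕ J → ℕ) = ⇑A + Pi.single (.inl
        j) 1 := by
      rw [Finsupp.coe_add, Finsupp.single_eq_pi_single, add_comm]
    have e2 : ((A - Finsupp.single (Sum.inr j) 1 : J ⊕ J →₀ ℕ) : J ⊕ J → ℕ) = ⇑A - Pi.single (.inr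
        j) 1 := by
      rw [Finsupp.coe_tsub, Finsupp.single_eq_pi_single]
    rw [e1, e2]
    linear_combination (-a) * this

theorem hermMap_X_inr_mul [DecidableEq J] (v : J → ℝ) (z : J → ℂ) (P : MvPolynomial (J ⊕ J) ℂ)
    (j : J) : hermMap v z (MvPolynomial.X (.inr j) * P)
      = conj (z j) * hermMap v z P - v j * hermMap v z (MvPolynomial.pderiv (.inl j) P) := by
  induction P using MvPolynomial.monomial_add_induction_on with
  | C a =>
    have := multiHerm_add_single_right v z 0 j
    rw [MvPolynomial.pderiv_C, map_zero, ← MvPolynomial.monomial_zero', MvPolynomial.X,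
      MvPolynomial.monomial_mul, hermMap_monomial, hermMap_monomial]
    simp only [Pi.zero_apply, Nat.cast_zero, mul_zero, zero_mul, add_zero, zero_add] at this
    simp only [add_zero, Finsupp.single_eq_pi_single, one_mul, mul_zero, sub_zero, Finsupp.coe_zero]
    rw [← this]; ring
  | monomial_add A a P _ _ ih =>
    have := multiHerm_add_single_right v z A j
    rw [mul_add, map_add, map_add, map_add, map_add, ih, MvPolynomial.pderiv_monomial,
      MvPolynomial.X, MvPolynomial.monomial_mul, hermMap_monomial, hermMap_monomial,
      hermMap_monomial]
    have e1 : ((Finsupp.single (Sum.inr j) 1 + A : J ⊕ J →₀ ℕ) : J ⊕ J → ℕ) = ⇑A + Pi.single (.inr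
        j) 1 := by
      rw [Finsupp.coe_add, Finsupp.single_eq_pi_single, add_comm]
    have e2 : ((A - Finsupp.single (Sum.inl j) 1 : J ⊕ J →₀ ℕ) : J ⊕ J → ℕ) = ⇑A - Pi.single (.inl
        j) 1 := by
      rw [Finsupp.coe_tsub, Finsupp.single_eq_pi_single]
    rw [e1, e2]
    linear_combination (-a) * this

/-- Both sides obey the recursion of `cHerm`. The derivative in the `j`-th conjugate variable kills
the holomorphic linear form and sends the conjugate one to `conj (c j)`, so the contractions add up
to the covariance `∑ ‖c j‖² v j`. -/
theorem hermMap_pow_mul_pow [DecidableEq J] (v : J → ℝ) (z c : J → ℂ) (n m : ℕ) :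
    hermMap v z ((∑ j, MvPolynomial.C (c j) * MvPolynomial.X (.inl j)) ^ n
        * (∑ j, MvPolynomial.C (conj (c j)) * MvPolynomial.X (.inr j)) ^ m)
      = cHerm (∑ j, (‖c j‖ ^ 2 * v j : ℝ)) (∑ j, c j * z j) (conj (∑ j, c j * z j)) n m := by
  set x : MvPolynomial (J ⊕ J) ℂ := ∑ j, MvPolynomial.C (c j) * MvPolynomial.X (.inl j) with hx
  set y : MvPolynomial (J ⊕ J) ℂ := ∑ j, MvPolynomial.C (conj (c j)) * MvPolynomial.X (.inr j)
    with hy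
  have dxr : ∀ j, MvPolynomial.pderiv (Sum.inr j : J ⊕ J) x = 0 := by
    intro j
    simp [hx, MvPolynomial.pderiv_C_mul, MvPolynomial.pderiv_X_of_ne]
  have dyl : ∀ j, MvPolynomial.pderiv (Sum.inl j : J ⊕ J) y = 0 := by
    intro j
    simp [hy, MvPolynomial.pderiv_C_mul, MvPolynomial.pderiv_X_of_ne]
  have dyr : ∀ j, MvPolynomial.pderiv (Sum.inr j : J ⊕ J) y = MvPolynomial.C (conj (c j)) := by
    intro j
    simp [hy, MvPolynomial.pderiv_C_mul, MvPolynomial.pderiv_X, Pi.single_apply]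
  induction n generalizing m with
  | zero =>
    rw [cHerm_zero_left, pow_zero, one_mul]
    induction m with
    | zero =>
      rw [pow_zero, pow_zero, ← MvPolynomial.C_1, ← MvPolynomial.monomial_zero', hermMap_monomial]
      simp [multiHerm_zero]
    | succ m ih =>
      have dP : ∀ j, MvPolynomial.pderiv (Sum.inl j : J ⊕ J) (y ^ m) = 0 := by
        intro j
        rw [Derivation.leibniz_pow, dyl]; simp
      rw [pow_succ', pow_succ', ← ih]
      nth_rewrite 1 [hy]
      rw [Finset.sum_mul, map_sum, map_sum, Finset.sum_mul]
      refine Finset.sum_congr rfl fun j _ => ?_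
      rw [mul_assoc, ← MvPolynomial.smul_eq_C_mul, map_smul, hermMap_X_inr_mul, dP, map_mul]
      simp [mul_assoc]
  | succ n ih =>
    have dP : ∀ j, MvPolynomial.pderiv (Sum.inr j : J ⊕ J) (x ^ n * y ^ m)
        = (conj (c j) * m) • (x ^ n * y ^ (m - 1)) := by
      intro j
      rw [Derivation.leibniz, Derivation.leibniz_pow, Derivation.leibniz_pow, dxr, dyr]
      simp only [smul_zero, add_zero, smul_eq_mul, MvPolynomial.smul_eq_C_mul, nsmul_eq_mul,
        map_mul, map_natCast]
      ring
    rw [cHerm_succ_left, ← ih, ← ih, pow_succ', mul_assoc]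
    nth_rewrite 1 [hx]
    push_cast
    rw [Finset.sum_mul, map_sum, mul_assoc, Finset.sum_mul, Finset.sum_mul,
      ← Finset.sum_sub_distrib]
    refine Finset.sum_congr rfl fun j _ => ?_
    rw [mul_assoc, ← MvPolynomial.smul_eq_C_mul, map_smul, hermMap_X_inl_mul, dP, map_smul,
      ← Complex.conj_mul', smul_eq_mul, smul_eq_mul]
    ring

/-- The Hermite polynomials of a linear combination of variables. -/
theorem cHerm_sum [DecidableEq J] (v : J → ℝ) (z c : J → ℂ) (n m : ℕ) :
    cHerm (∑ j, (‖c j‖ ^ 2 * v j : ℝ)) (∑ j, c j * z j) (conj (∑ j, c j * z j)) n m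
      = ∑ I : Fin n → J, ∑ K : Fin m → J,
        ((∏ i, c (I i)) * ∏ i, conj (c (K i))) * multiHerm v z (pairCount I K) := by
  rw [← hermMap_pow_mul_pow, Fintype.sum_pow, Fintype.sum_pow, Finset.sum_mul_sum]
  simp only [map_sum]
  refine Finset.sum_congr rfl fun I _ => Finset.sum_congr rfl fun K _ => ?_
  have hm : (∏ i, (MvPolynomial.X (.inl (I i)) : MvPolynomial (J ⊕ J) ℂ))
      * ∏ i, (MvPolynomial.X (.inr (K i)) : MvPolynomial (J ⊕ J) ℂ)
      = MvPolynomial.monomial (Finsupp.equivFunOnFinite.symm (pairCount I K)) 1 := by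
    rw [MvPolynomial.monomial_eq, Finsupp.prod_fintype _ _ (by simp), Fintype.prod_sum_type,
      prod_comp_eq_prod_pow_idxCount I fun j => (MvPolynomial.X (.inl j) : MvPolynomial (J ⊕ J) ℂ),
      prod_comp_eq_prod_pow_idxCount K fun j => (MvPolynomial.X (.inr j) : MvPolynomial (J ⊕ J) ℂ)]
    simp [pairCount]
  rw [Finset.prod_mul_distrib, Finset.prod_mul_distrib, mul_mul_mul_comm, hm, ← map_prod,
    ← map_prod, ← map_mul, ← MvPolynomial.smul_eq_C_mul, map_smul, hermMap_monomial]
  simp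

end linearCombination

/-! ### Functions with finite moments of all orders -/

section moments

variable {Ω : Type*} [MeasurableSpace Ω] {μ : Measure Ω}

/-- A function with finite absolute moments of all orders. -/
def HasAllMoments (f : Ω → ℂ) (μ : Measure Ω) : Prop := ∀ p : ℝ≥0∞, p ≠ ∞ → MemLp f p μ

theorem HasAllMoments.const [IsFiniteMeasure μ] (c : ℂ) : HasAllMoments (fun _ => c) μ :=
  fun _ _ => memLp_const c

theorem HasAllMoments.add {f g : Ω → ℂ} (hf : HasAllMoments f μ) (hg : HasAllMoments g μ) :
    HasAllMoments (fun x => f x + g x) μ := fun p hp => (hf p hp).add (hg p hp)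

theorem HasAllMoments.sub {f g : Ω → ℂ} (hf : HasAllMoments f μ) (hg : HasAllMoments g μ) :
    HasAllMoments (fun x => f x - g x) μ := fun p hp => (hf p hp).sub (hg p hp)

theorem HasAllMoments.conj {f : Ω → ℂ} (hf : HasAllMoments f μ) :
    HasAllMoments (fun x => conj (f x)) μ := fun p hp => (hf p hp).star

theorem HasAllMoments.mul {f g : Ω → ℂ} (hf : HasAllMoments f μ) (hg : HasAllMoments g μ) :
    HasAllMoments (fun x => f x * g x) μ := by
  intro p hp
  rcases eq_or_ne p 0 with rfl | hp0
  · exact memLp_zero_iff_aestronglyMeasurable.2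
      ((hf 0 (by simp)).aestronglyMeasurable.mul (hg 0 (by simp)).aestronglyMeasurable)
  · have h2 : 2 * p ≠ ∞ := ENNReal.mul_ne_top (by simp) hp
    have : ENNReal.HolderTriple (2 * p) (2 * p) p := ⟨by
      rw [ENNReal.mul_inv (by simp) (by simp), ← add_mul, ENNReal.inv_two_add_inv_two, one_mul]⟩
    exact (hg _ h2).mul (hf _ h2)

theorem HasAllMoments.pow [IsFiniteMeasure μ] {f : Ω → ℂ} (hf : HasAllMoments f μ) (n : ℕ) :
    HasAllMoments (fun x => f x ^ n) μ := by
  induction n with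
  | zero => simpa using HasAllMoments.const (μ := μ) 1
  | succ n ih => simpa only [pow_succ] using ih.mul hf

theorem HasAllMoments.finset_sum [IsFiniteMeasure μ] {ι : Type*} (s : Finset ι) {f : ι → Ω → ℂ}
    (hf : ∀ i ∈ s, HasAllMoments (f i) μ) : HasAllMoments (fun x => ∑ i ∈ s, f i x) μ :=
  fun p hp => memLp_finsetSum s fun i hi => hf i hi p hp

theorem HasAllMoments.finset_prod [IsFiniteMeasure μ] {ι : Type*} (s : Finset ι) {f : ι → Ω → ℂ}
    (hf : ∀ i ∈ s, HasAllMoments (f i) μ) : HasAllMoments (fun x => ∏ i ∈ s, f i x) μ := by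
  classical
  induction s using Finset.induction_on with
  | empty => simpa using HasAllMoments.const (μ := μ) 1
  | insert a s ha ih =>
    simp only [Finset.prod_insert ha]
    exact (hf a (Finset.mem_insert_self _ _)).mul
      (ih fun i hi => hf i (Finset.mem_insert_of_mem hi))

theorem HasAllMoments.integrable {f : Ω → ℂ} (hf : HasAllMoments f μ) : Integrable f μ :=
  memLp_one_iff_integrable.1 (hf 1 (by simp))

theorem HasAllMoments.cHerm [IsFiniteMeasure μ] {f : Ω → ℂ} (hf : HasAllMoments f μ) (c : ℂ)
    (n m : ℕ) : HasAllMoments (fun x => cHerm c (f x) (starRingEnd ℂ (f x)) n m) μ := by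
  induction n generalizing m with
  | zero => simpa only [cHerm_zero_left] using hf.conj.pow m
  | succ n ih =>
    simp only [cHerm_succ_left]
    exact (hf.mul (ih m)).sub ((HasAllMoments.const _).mul (ih (m - 1)))

theorem HasAllMoments.multiHerm [IsFiniteMeasure μ] {J : Type*} [Fintype J] {f : J → Ω → ℂ}
    (hf : ∀ j, HasAllMoments (f j) μ) (v : J → ℝ) (A : J ⊕ J → ℕ) :
    HasAllMoments (fun x => multiHerm v (fun j => f j x) A) μ :=
  HasAllMoments.finset_prod _ fun j _ => (hf j).cHerm _ _ _

theorem HasAllMoments.hermSum [IsFiniteMeasure μ] {J : Type*} [Fintype J] [DecidableEq J]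
    {f : J → Ω → ℂ} (hf : ∀ j, HasAllMoments (f j) μ) (v : J → ℝ) (M : ℕ)
    (c : (J ⊕ J → ℕ) → ℂ) : HasAllMoments (fun x => hermSum v (fun j => f j x) M c) μ :=
  HasAllMoments.finset_sum _ fun _ _ =>
    (HasAllMoments.const _).mul (HasAllMoments.multiHerm hf _ _)

end moments

/-! ### Moments of real Gaussian variables -/

theorem iteratedDeriv_id_mul (f : ℝ → ℝ) (hf : ContDiff ℝ (⊤ : ℕ∞) f) (k : ℕ) :
    iteratedDeriv k (fun t => t * f t)
      = fun t => t * iteratedDeriv k f t + k * iteratedDeriv (k - 1) f t := by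
  induction k with
  | zero => simp
  | succ k ih =>
    rw [iteratedDeriv_succ, ih]
    ext t
    have hd : ∀ j, DifferentiableAt ℝ (iteratedDeriv j f) t := fun j =>
      (hf.differentiable_iteratedDeriv j (by exact_mod_cast WithTop.coe_lt_top _)) t
    have h : HasDerivAt (fun t => t * iteratedDeriv k f t + k * iteratedDeriv (k - 1) f t)
        (1 * iteratedDeriv k f t + t * deriv (iteratedDeriv k f) t
          + k * deriv (iteratedDeriv (k - 1) f) t) t :=
      ((hasDerivAt_id' t).mul (hd k).hasDerivAt).add ((hd (k - 1)).hasDerivAt.const_mul (k : ℝ))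
    rw [h.deriv, ← iteratedDeriv_succ, ← iteratedDeriv_succ]
    rcases k with _ | k
    · simp; ring
    · simp; ring

/-- The moment generating function `f` satisfies `f' = v t f`; this equation is differentiated `n +
1` times at zero. -/
theorem integral_pow_add_two_gaussianReal (v : NNReal) (n : ℕ) :
    ∫ x, x ^ (n + 2) ∂(ProbabilityTheory.gaussianReal 0 v)
      = (n + 1) * v * ∫ x, x ^ n ∂(ProbabilityTheory.gaussianReal 0 v) := by
  have h0 : (0 : ℝ) ∈ interior
      (ProbabilityTheory.integrableExpSet id (ProbabilityTheory.gaussianReal 0 v)) := by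
    simp [ProbabilityTheory.integrableExpSet_id_gaussianReal]
  have hm : ProbabilityTheory.mgf id (ProbabilityTheory.gaussianReal 0 v)
      = fun t => Real.exp (v * t ^ 2 / 2) := by
    rw [ProbabilityTheory.mgf_id_gaussianReal]; simp
  have e : ∀ k, ∫ x, x ^ k ∂(ProbabilityTheory.gaussianReal 0 v)
      = iteratedDeriv k (fun t => Real.exp (v * t ^ 2 / 2)) 0 := by
    intro k
    rw [← hm, ProbabilityTheory.iteratedDeriv_mgf_zero h0]
    rfl
  set f : ℝ → ℝ := fun t => Real.exp (v * t ^ 2 / 2) with hf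
  have hfc : ContDiff ℝ (⊤ : ℕ∞) f := by fun_prop
  have hd : deriv f = fun t => v * (t * f t) := by
    ext t
    have : HasDerivAt f (Real.exp (v * t ^ 2 / 2) * (v * (2 * t) / 2)) t := by
      have h := ((((hasDerivAt_id t).pow 2).const_mul (v : ℝ)).div_const 2).exp
      simpa using h
    rw [this.deriv]; simp only [hf]; ring
  rw [e, e, iteratedDeriv_succ', hd, iteratedDeriv_const_mul_field, iteratedDeriv_id_mul f hfc]
  simp
  ring

/-! ### The white noise measure -/

theorem norm_sum_sq_of_orthogonal {E J : Type*} [NormedAddCommGroup E] [InnerProductSpace ℂ E]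
    [Fintype J] (x : J → E) (hx : ∀ i j, i ≠ j → inner ℂ (x i) (x j) = 0) :
    ‖∑ j, x j‖ ^ 2 = ∑ j, ‖x j‖ ^ 2 := by
  have h : inner ℂ (∑ j, x j) (∑ j, x j) = ∑ j, inner ℂ (x j) (x j) := by
    rw [sum_inner]
    refine Finset.sum_congr rfl fun i _ => ?_
    rw [inner_sum]
    exact Finset.sum_eq_single_of_mem i (Finset.mem_univ i) fun j _ hj => hx i j hj.symm
  simp only [inner_self_eq_norm_sq_to_K] at h
  exact_mod_cast h

namespace NFChain

variable {H : ℕ → Type*} [∀ p, NormedAddCommGroup (H p)]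
  [∀ p, InnerProductSpace ℂ (H p)] [∀ p, CompleteSpace (H p)] (C : NFChain H)

theorem measurable_pair (ρ : C.N) : Measurable fun φ => C.pair φ ρ := by
  rw [measurable_iff_comap_le]
  exact le_iSup (fun ρ : C.N => MeasurableSpace.comap (fun φ => C.pair φ ρ) (borel ℂ)) ρ

theorem pair_smul (φ : C.Dual) (c : ℂ) (ρ : C.N) : C.pair φ (c • ρ) = c * C.pair φ ρ :=
  map_smul (show C.N →L[ℂ] ℂ from φ) c ρ

theorem pair_sum {ι : Type*} (φ : C.Dual) (s : Finset ι) (ρ : ι → C.N) :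
    C.pair φ (∑ i ∈ s, ρ i) = ∑ i ∈ s, C.pair φ (ρ i) :=
  map_sum (show C.N →L[ℂ] ℂ from φ) ρ s

theorem norm_smul_apply (c : ℂ) (ρ : C.N) (p : ℕ) : ‖(c • ρ).1 p‖ = ‖c‖ * ‖ρ.1 p‖ :=
  norm_smul c (ρ.1 p)

theorem coe_sum_apply {ι : Type*} (s : Finset ι) (ρ : ι → C.N) (p : ℕ) :
    (∑ i ∈ s, ρ i).1 p = ∑ i ∈ s, (ρ i).1 p := by
  simp

variable {C} {β : Measure C.Dual}

/-- The characteristic functional involves twice the real part, so it is evaluated at `ρ / 2`; hence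
the factor `1 / 4`. -/
theorem IsWhiteNoise.integral_exp_re (hβ : C.IsWhiteNoise β) (ρ : C.N) :
    ∫ φ, Complex.exp ((C.pair φ ρ).re * Complex.I) ∂β
      = Complex.exp (-((‖ρ.1 0‖ : ℂ) ^ 2) / 4) := by
  have h := hβ.charFun ((1 / 2 : ℂ) • ρ)
  simp only [norm_smul_apply, pair_smul] at h
  have e : ∀ φ : C.Dual, Complex.I * (conj ((1 / 2 : ℂ) * C.pair φ ρ) + (1 / 2 : ℂ) * C.pair φ ρ)
      = (C.pair φ ρ).re * Complex.I := by
    intro φ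
    rw [add_comm, Complex.add_conj]
    have : ((1 / 2 : ℂ) * C.pair φ ρ).re = (C.pair φ ρ).re / 2 := by
      rw [one_div, Complex.mul_re]; simp; ring
    rw [this]; push_cast; ring
  simp only [e] at h
  rw [h]
  congr 1
  simp
  ring

theorem IsWhiteNoise.charFun_map (hβ : C.IsWhiteNoise β) (ρ : C.N) (t : ℂ) :
    MeasureTheory.charFun (β.map fun φ => C.pair φ ρ) t = Complex.exp (-((‖t‖ : ℂ) * ‖ρ.1 0‖) ^ 2 /
        4) := by
  rw [charFun_apply, integral_map (C.measurable_pair ρ).aemeasurable (by fun_prop)]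
  have h := hβ.integral_exp_re (conj t • ρ)
  simp only [norm_smul_apply, pair_smul, RCLike.norm_conj] at h
  push_cast at h
  rw [← h]
  congr 1
  ext φ
  congr 3
  rw [Complex.inner]
  simp

theorem IsWhiteNoise.map_re (hβ : C.IsWhiteNoise β) (ρ : C.N) :
    β.map (fun φ => (C.pair φ ρ).re)
      = ProbabilityTheory.gaussianReal 0 (‖ρ.1 0‖ ^ 2 / 2).toNNReal := by
  have := hβ.prob
  have hm : Measurable fun φ => (C.pair φ ρ).re := Complex.measurable_re.comp (C.measurable_pair ρ)
  have : IsProbabilityMeasure (β.map fun φ => (C.pair φ ρ).re) :=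
    Measure.isProbabilityMeasure_map hm.aemeasurable
  refine Measure.ext_of_charFun ?_
  ext t
  rw [ProbabilityTheory.charFun_gaussianReal, charFun_apply_real,
    integral_map hm.aemeasurable (by fun_prop)]
  have h := hβ.integral_exp_re ((t : ℂ) • ρ)
  simp only [norm_smul_apply, pair_smul, Complex.re_ofReal_mul] at h
  push_cast at h
  rw [h]
  congr 1
  have : ((‖(t : ℂ)‖ : ℝ) : ℂ) ^ 2 = (t : ℂ) ^ 2 := by
    rw [Complex.norm_real, Real.norm_eq_abs]
    norm_cast
    exact sq_abs t
  rw [mul_pow, this, Real.coe_toNNReal _ (by positivity)]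
  push_cast
  ring

/-- The characteristic function of the law depends on `ρ` only through `‖ρ‖₀`. This rotation
invariance makes the unbalanced moments vanish. -/
theorem IsWhiteNoise.map_pair_smul (hβ : C.IsWhiteNoise β) (ρ : C.N) {u : ℂ} (hu : ‖u‖ = 1) :
    β.map (fun φ => C.pair φ (u • ρ)) = β.map fun φ => C.pair φ ρ := by
  have := hβ.prob
  have h1 : IsProbabilityMeasure (β.map fun φ => C.pair φ (u • ρ)) :=
    Measure.isProbabilityMeasure_map (C.measurable_pair _).aemeasurable
  have h2 : IsProbabilityMeasure (β.map fun φ => C.pair φ ρ) :=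
    Measure.isProbabilityMeasure_map (C.measurable_pair _).aemeasurable
  refine Measure.ext_of_charFun ?_
  ext t
  rw [hβ.charFun_map, hβ.charFun_map, norm_smul_apply, hu, one_mul]

theorem IsWhiteNoise.hasAllMoments_pair (hβ : C.IsWhiteNoise β) (ρ : C.N) :
    HasAllMoments (fun φ => C.pair φ ρ) β := by
  intro p hp
  have hre : ∀ σ : C.N, MemLp (fun φ => (C.pair φ σ).re) p β := by
    intro σ
    have hm : Measurable fun φ => (C.pair φ σ).re :=
      Complex.measurable_re.comp (C.measurable_pair σ)
    have h := ProbabilityTheory.memLp_id_gaussianReal' (μ := 0)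
      (v := (‖σ.1 0‖ ^ 2 / 2).toNNReal) p hp
    rw [← hβ.map_re σ] at h
    exact (memLp_map_measure_iff (by fun_prop) hm.aemeasurable).1 h
  have h1 := hre ρ
  have h2 := hre ((-Complex.I) • ρ)
  simp only [pair_smul, neg_mul, Complex.neg_re, Complex.I_mul_re, neg_neg] at h2
  exact (memLp_re_im_iff (f := fun φ => C.pair φ ρ)).1 ⟨h1, h2⟩

theorem IsWhiteNoise.integral_pow_mul_conj_pow_of_ne (hβ : C.IsWhiteNoise β) (ρ : C.N) {a b : ℕ}
    (hab : a ≠ b) :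
    ∫ φ, C.pair φ ρ ^ a * conj (C.pair φ ρ) ^ b ∂β = 0 := by
  have hne : ((a : ℂ) - b) ≠ 0 := sub_ne_zero.2 (by exact_mod_cast hab)
  -- The angle is chosen so that `u ^ a * conj u ^ b = -1`; by rotation invariance the integral
  -- equals its own negative.
  set t : ℝ := Real.pi / (a - b) with ht
  set u : ℂ := Complex.exp (t * Complex.I) with hu
  have hun : ‖u‖ = 1 := Complex.norm_exp_ofReal_mul_I t
  have huc : conj u = Complex.exp (-(t * Complex.I)) := by
    rw [hu, ← Complex.exp_conj]; simp
  have hpow : u ^ a * conj u ^ b = -1 := by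
    rw [huc, hu, ← Complex.exp_nat_mul, ← Complex.exp_nat_mul, ← Complex.exp_add,
      ← Complex.exp_pi_mul_I]
    congr 1
    have : (t : ℂ) = Real.pi / (a - b) := by rw [ht]; push_cast; rfl
    rw [this]
    field_simp
    ring
  have hF : AEStronglyMeasurable (fun z : ℂ => z ^ a * conj z ^ b) (β.map fun φ => C.pair φ ρ) := by
    have : Continuous fun z : ℂ => z ^ a * conj z ^ b := by fun_prop
    exact this.aestronglyMeasurable
  have h1 : ∫ φ, C.pair φ ρ ^ a * conj (C.pair φ ρ) ^ b ∂β
      = ∫ φ, C.pair φ (u • ρ) ^ a * conj (C.pair φ (u • ρ)) ^ b ∂β := by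
    rw [← integral_map (C.measurable_pair ρ).aemeasurable hF]
    have hF' := hF
    rw [← hβ.map_pair_smul ρ hun] at hF' ⊢
    rw [integral_map (C.measurable_pair _).aemeasurable hF']
  have h2 : ∀ φ : C.Dual, C.pair φ (u • ρ) ^ a * conj (C.pair φ (u • ρ)) ^ b
      = (-1) * (C.pair φ ρ ^ a * conj (C.pair φ ρ) ^ b) := by
    intro φ
    rw [pair_smul, map_mul, mul_pow, mul_pow, mul_mul_mul_comm, hpow]
  simp only [h2] at h1
  rw [integral_const_mul] at h1
  have h3 : (2 : ℂ) * ∫ φ, C.pair φ ρ ^ a * conj (C.pair φ ρ) ^ b ∂β = 0 := by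
    linear_combination h1
  simpa using h3

theorem IsWhiteNoise.integral_re_pow (hβ : C.IsWhiteNoise β) (ρ : C.N) (n : ℕ) :
    ∫ φ, ((C.pair φ ρ).re : ℂ) ^ (n + 2) ∂β
      = (n + 1) * ((‖ρ.1 0‖ : ℂ) ^ 2 / 2) * ∫ φ, ((C.pair φ ρ).re : ℂ) ^ n ∂β := by
  have hm : Measurable fun φ => (C.pair φ ρ).re := Complex.measurable_re.comp (C.measurable_pair ρ)
  have e : ∀ k, ∫ φ, ((C.pair φ ρ).re : ℂ) ^ k ∂β = ((∫ x, x ^ k ∂(ProbabilityTheory.gaussianReal 0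
      (‖ρ.1 0‖ ^ 2 / 2).toNNReal) : ℝ) : ℂ) := by
    intro k
    rw [← hβ.map_re ρ, integral_map hm.aemeasurable (by fun_prop), ← integral_complex_ofReal]
    simp
  rw [e, e, integral_pow_add_two_gaussianReal, Real.coe_toNNReal _ (by positivity)]
  push_cast
  rfl

/-- In the expansion of `(z + conj z) ^ (2n)` only the balanced term has a nonzero integral, so the
absolute moments follow from the real Gaussian ones. The central binomial coefficients cancel by
their own recursion. -/
theorem IsWhiteNoise.integral_pow_mul_conj_pow_self (hβ : C.IsWhiteNoise β) (ρ : C.N) (n : ℕ) :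
    ∫ φ, C.pair φ ρ ^ n * conj (C.pair φ ρ) ^ n ∂β = n.factorial * ((‖ρ.1 0‖ : ℂ) ^ 2) ^ n := by
  have := hβ.prob
  have hz := hβ.hasAllMoments_pair ρ
  have h1 : ∀ n : ℕ, (4 : ℂ) ^ n * ∫ φ, ((C.pair φ ρ).re : ℂ) ^ (2 * n) ∂β
      = n.centralBinom * ∫ φ, C.pair φ ρ ^ n * conj (C.pair φ ρ) ^ n ∂β := by
    intro n
    have e : ∀ φ : C.Dual, (4 : ℂ) ^ n * ((C.pair φ ρ).re : ℂ) ^ (2 * n)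
        = ∑ k ∈ Finset.range (2 * n + 1), (C.pair φ ρ ^ k * conj (C.pair φ ρ) ^ (2 * n - k))
          * ((2 * n).choose k : ℂ) := by
      intro φ
      rw [← add_pow, Complex.add_conj]
      push_cast
      rw [mul_pow, pow_mul 2]
      norm_num
    rw [← integral_const_mul]
    simp only [e]
    rw [integral_finsetSum]
    · rw [Finset.sum_eq_single_of_mem n (by simp; omega)]
      · rw [integral_mul_const, Nat.centralBinom_eq_two_mul_choose, mul_comm]
        congr 2
        have : 2 * n - n = n := by omega
        rw [this]
      · intro k hk hkn
        rw [integral_mul_const, hβ.integral_pow_mul_conj_pow_of_ne, zero_mul]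
        have := Finset.mem_range.1 hk
        omega
    · intro k _
      exact (((hz.pow k).mul (hz.conj.pow _)).mul (HasAllMoments.const _)).integrable
  induction n with
  | zero => simp
  | succ n ih =>
    have a1 := h1 (n + 1)
    have a0 := h1 n
    have e : 2 * (n + 1) = 2 * n + 2 := by ring
    rw [e, hβ.integral_re_pow] at a1
    have hc : ((n : ℂ) + 1) * (n + 1).centralBinom = 2 * (2 * n + 1) * n.centralBinom := by
      exact_mod_cast n.succ_mul_centralBinom_succ
    have hne : ((n + 1).centralBinom : ℂ) ≠ 0 := by exact_mod_cast (n + 1).centralBinom_ne_zero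
    apply mul_left_cancel₀ hne
    rw [← a1, Nat.factorial_succ]
    push_cast at a0 ⊢
    rw [ih] at a0
    linear_combination (2 * (2 * (n : ℂ) + 1) * (‖ρ.1 0‖ : ℂ) ^ 2) * a0
      - n.factorial * ((‖ρ.1 0‖ : ℂ) ^ 2) ^ (n + 1) * hc

/-- For `n ≠ m` every moment in the explicit formula is unbalanced. For `n = m` all terms have the
same size, and the alternating sum of binomial coefficients vanishes unless `n = 0`. -/
theorem IsWhiteNoise.integral_cHerm (hβ : C.IsWhiteNoise β) (ρ : C.N) (n m : ℕ) :
    ∫ φ, cHerm ((‖ρ.1 0‖ ^ 2 : ℝ) : ℂ) (C.pair φ ρ) (conj (C.pair φ ρ)) n m ∂β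
      = if n = 0 ∧ m = 0 then 1 else 0 := by
  have := hβ.prob
  have hz := hβ.hasAllMoments_pair ρ
  simp only [cHerm_eq_sum]
  rw [integral_finsetSum]
  swap
  · intro k _
    exact (((HasAllMoments.const _).mul (hz.pow _)).mul (hz.conj.pow _)).integrable
  simp only [mul_assoc, integral_const_mul]
  by_cases hnm : n = m
  · subst hnm
    simp only [hβ.integral_pow_mul_conj_pow_self, and_self]
    have e : ∀ k ∈ Finset.range (n + 1), (-((‖ρ.1 0‖ ^ 2 : ℝ) : ℂ)) ^ k * (n.choose k
        * (n.descFactorial k * ((n - k).factorial * ((‖ρ.1 0‖ : ℂ) ^ 2) ^ (n - k))))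
        = (n.factorial * ((‖ρ.1 0‖ : ℂ) ^ 2) ^ n) * ((((-1) ^ k * n.choose k : ℤ)) : ℂ) := by
      intro k hk
      have hk' : k ≤ n := Nat.lt_succ_iff.1 (Finset.mem_range.1 hk)
      rw [← Nat.factorial_mul_descFactorial hk']
      obtain ⟨l, rfl⟩ := Nat.exists_eq_add_of_le hk'
      simp only [Nat.add_sub_cancel_left, pow_add]
      push_cast
      rw [neg_pow]
      ring
    rw [Finset.sum_congr rfl e, ← Finset.mul_sum, ← Int.cast_sum, Int.alternating_sum_range_choose]
    split_ifs with h
    · subst h; simp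
    · simp
  · rw [if_neg (by omega)]
    refine Finset.sum_eq_zero fun k hk => ?_
    have hk' : k ≤ n := Nat.lt_succ_iff.1 (Finset.mem_range.1 hk)
    by_cases hkm : m < k
    · rw [Nat.descFactorial_of_lt hkm]; simp
    · rw [hβ.integral_pow_mul_conj_pow_of_ne ρ (by omega)]; simp

/-- By Pythagoras in `H 0` the exponent of the joint characteristic function is a sum over `j`, so
the function factorizes. -/
theorem IsWhiteNoise.iIndepFun_pair (hβ : C.IsWhiteNoise β) {J : Type*} [Fintype J] (g : J → C.N)
    (hg : ∀ i j, i ≠ j → inner ℂ ((g i).1 0) ((g j).1 0) = 0) :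
    ProbabilityTheory.iIndepFun (fun j φ => C.pair φ (g j)) β := by
  have := hβ.prob
  rw [ProbabilityTheory.iIndepFun_iff_charFun_pi fun j => (C.measurable_pair (g j)).aemeasurable]
  intro t
  have hmeas : Measurable fun φ : C.Dual => WithLp.toLp 2 fun j => C.pair φ (g j) := by
    have : Measurable fun φ : C.Dual => fun j => C.pair φ (g j) :=
      measurable_pi_lambda _ fun j => C.measurable_pair (g j)
    exact (WithLp.measurable_toLp 2 _).comp this
  rw [charFun_apply, integral_map hmeas.aemeasurable (by fun_prop)]
  simp only [hβ.charFun_map]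
  rw [← Complex.exp_sum]
  have h := hβ.integral_exp_re (∑ j, conj (t j) • g j)
  have e : ∀ φ : C.Dual, inner ℝ (WithLp.toLp 2 fun j => C.pair φ (g j)) t
      = (C.pair φ (∑ j, conj (t j) • g j)).re := by
    intro φ
    rw [PiLp.inner_apply, pair_sum, Complex.re_sum]
    refine Finset.sum_congr rfl fun j _ => ?_
    rw [pair_smul, Complex.inner]
    simp
  simp only [e]
  rw [h]
  congr 1
  have hp : ‖(∑ j, conj (t j) • g j).1 0‖ ^ 2 = ∑ j, (‖t j‖ * ‖(g j).1 0‖) ^ 2 := by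
    rw [coe_sum_apply]
    rw [norm_sum_sq_of_orthogonal]
    · refine Finset.sum_congr rfl fun j _ => ?_
      rw [norm_smul_apply, RCLike.norm_conj]
    · intro i j hij
      simp [inner_smul_left, inner_smul_right, hg i j hij]
  rw [← Complex.ofReal_pow, hp]
  push_cast
  rw [← Finset.sum_neg_distrib, Finset.sum_div]

end NFChain

namespace NFChain

variable {H : ℕ → Type*} [∀ p, NormedAddCommGroup (H p)]
  [∀ p, InnerProductSpace ℂ (H p)] [∀ p, CompleteSpace (H p)] {C : NFChain H} {β : Measure C.Dual}

/-! ### Orthogonality of Hermite products -/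

/-- The Hermite products of the Gaussian variables `φ ↦ (g j)ₓφˣ`. -/
noncomputable def herm {J : Type*} [Fintype J] (C : NFChain H) (g : J → C.N) (A : J ⊕ J → ℕ)
    (φ : C.Dual) : ℂ :=
  multiHerm (fun j => ‖(g j).1 0‖ ^ 2) (fun j => C.pair φ (g j)) A

theorem IsWhiteNoise.hasAllMoments_herm (hβ : C.IsWhiteNoise β) {J : Type*} [Fintype J]
    (g : J → C.N) (A : J ⊕ J → ℕ) : HasAllMoments (C.herm g A) β := by
  have := hβ.prob
  exact HasAllMoments.multiHerm (fun j => hβ.hasAllMoments_pair (g j)) _ A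

theorem IsWhiteNoise.integral_herm (hβ : C.IsWhiteNoise β) {J : Type*} [Fintype J] (g : J → C.N)
    (hg : ∀ i j, i ≠ j → inner ℂ ((g i).1 0) ((g j).1 0) = 0) (A : J ⊕ J → ℕ) :
    ∫ φ, C.herm g A φ ∂β = if A = 0 then 1 else 0 := by
  have hp := hβ.prob
  have h := (hβ.iIndepFun_pair g hg).integral_fun_prod_comp (𝕜 := ℂ)
    (f := fun j z => cHerm ((‖(g j).1 0‖ ^ 2 : ℝ) : ℂ) z (conj z) (A (.inl j)) (A (.inr j)))
    (fun j => (C.measurable_pair (g j)).aemeasurable) (fun j => ?_)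
  · have h' : ∫ φ, C.herm g A φ ∂β = _ := h
    rw [h']
    simp only [hβ.integral_cHerm]
    split_ifs with hA
    · subst hA; simp
    · have : ∃ i, A i ≠ 0 := by
        by_contra! h0
        exact hA (funext h0)
      obtain ⟨i | i, hi⟩ := this
      · exact Finset.prod_eq_zero (Finset.mem_univ i) (if_neg fun h => hi h.1)
      · exact Finset.prod_eq_zero (Finset.mem_univ i) (if_neg fun h => hi h.2)
  · simp only [cHerm_eq_sum]
    have : Continuous fun z : ℂ => ∑ k ∈ Finset.range (A (.inl j) + 1),
        (-((‖(g j).1 0‖ ^ 2 : ℝ) : ℂ)) ^ k * (A (.inl j)).choose k * (A (.inr j)).descFactorial k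
          * z ^ (A (.inl j) - k) * conj z ^ (A (.inr j) - k) := by fun_prop
    exact this.aestronglyMeasurable

/-- After linearizing the product only the constant term has a nonzero integral. It comes from the
complete contraction, which requires `R = A ∘ swap` and `A = B`. -/
theorem IsWhiteNoise.integral_conj_herm_mul_herm (hβ : C.IsWhiteNoise β) {J : Type*} [Fintype J]
    [DecidableEq J] (g : J → C.N) (hg : ∀ i j, i ≠ j → inner ℂ ((g i).1 0) ((g j).1 0) = 0)
    (A B : J ⊕ J → ℕ) :
    ∫ φ, conj (C.herm g A φ) * C.herm g B φ ∂β
      = if A = B then (multiFactorial A : ℂ)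
          * ∏ i, ((Sum.elim (fun j => ‖(g j).1 0‖ ^ 2) (fun j => ‖(g j).1 0‖ ^ 2) i : ℝ) : ℂ) ^ A i
        else 0 := by
  have hp := hβ.prob
  set v : J → ℝ := fun j => ‖(g j).1 0‖ ^ 2 with hv
  have e : ∀ φ, conj (C.herm g A φ) * C.herm g B φ
      = ∑ R ∈ Fintype.piFinset fun i => Finset.range ((A ∘ Sum.swap) i + 1),
        (∏ i, (((Sum.elim v v i : ℝ) : ℂ) ^ R i * (((A ∘ Sum.swap) i).choose (R i)
          * (B i.swap).descFactorial (R i))))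
          * C.herm g ((A ∘ Sum.swap) - R + (B - R ∘ Sum.swap)) φ := by
    intro φ
    unfold herm
    rw [multiHerm_conj, multiHerm_mul]
  simp only [e]
  rw [integral_finsetSum _ fun R _ => ((HasAllMoments.const _).mul
    (hβ.hasAllMoments_herm g _)).integrable]
  simp only [integral_const_mul, hβ.integral_herm g hg]
  have hR : ∀ R : J ⊕ J → ℕ, R ∈ (Fintype.piFinset fun i => Finset.range ((A ∘ Sum.swap) i + 1))
      → (A ∘ Sum.swap) - R + (B - R ∘ Sum.swap) = 0 → R = A ∘ Sum.swap ∧ B ≤ A := by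
    intro R hR h0
    simp only [Fintype.mem_piFinset, Finset.mem_range, Nat.lt_succ_iff] at hR
    have h1 : R = A ∘ Sum.swap := by
      ext i
      have := congrFun h0 i
      have h2 := hR i
      simp only [Pi.add_apply, Pi.sub_apply, Pi.zero_apply, Function.comp_apply] at this h2 ⊢
      omega
    refine ⟨h1, fun i => ?_⟩
    have := congrFun h0 i
    simp only [h1, Pi.add_apply, Pi.sub_apply, Pi.zero_apply, Function.comp_apply,
      Sum.swap_swap, tsub_self, zero_add] at this
    exact tsub_eq_zero_iff_le.1 this
  by_cases hAB : A = B
  · subst hAB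
    rw [if_pos rfl, Finset.sum_eq_single_of_mem (A ∘ Sum.swap)]
    · rw [if_pos, mul_one, Finset.prod_mul_distrib]
      · have e1 : ∏ i, ((Sum.elim v v i : ℝ) : ℂ) ^ (A ∘ Sum.swap) i
            = ∏ i, ((Sum.elim v v i : ℝ) : ℂ) ^ A i := by
          rw [← Equiv.prod_comp (Equiv.sumComm J J)]
          refine Finset.prod_congr rfl fun i _ => ?_
          rcases i with i | i <;> rfl
        rw [e1, mul_comm]
        congr 1
        rw [← multiFactorial_comp_swap A]
        simp [multiFactorial, Nat.descFactorial_self]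
      · ext i
        simp
    · simp
    · intro R hRm hne
      rw [if_neg fun h0 => hne (hR R hRm h0).1, mul_zero]
  · rw [if_neg hAB]
    refine Finset.sum_eq_zero fun R hRm => ?_
    by_cases h0 : (A ∘ Sum.swap) - R + (B - R ∘ Sum.swap) = 0
    · obtain ⟨h1, h2⟩ := hR R hRm h0
      obtain ⟨i, hi⟩ : ∃ i, B i < A i := by
        by_contra! h3
        exact hAB (le_antisymm h3 h2)
      rw [Finset.prod_eq_zero (Finset.mem_univ i.swap), zero_mul]
      rw [h1, Function.comp_apply, Sum.swap_swap, Nat.descFactorial_of_lt hi]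
      simp
    · rw [if_neg h0, mul_zero]

/-! ### Wick monomials -/

/-- The function differentiated here is the `m`-th `t`-derivative at zero of the Wick generating
function. One `s`-derivative reproduces the recursion of `cHerm`. -/
theorem iteratedDeriv_pow_mul_exp (c z w : ℂ) (n m : ℕ) :
    iteratedDeriv n (fun s : ℂ => (w - s * c) ^ m * Complex.exp (s * z)) 0 = cHerm c z w n m := by
  induction n generalizing m with
  | zero => simp [cHerm_zero_left]
  | succ n ih =>
    have hd : deriv (fun s : ℂ => (w - s * c) ^ m * Complex.exp (s * z))
        = fun s => z * ((w - s * c) ^ m * Complex.exp (s * z))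
          - (c * m) * ((w - s * c) ^ (m - 1) * Complex.exp (s * z)) := by
      ext s
      have h1 : HasDerivAt (fun s : ℂ => w - s * c) (-(1 * c)) s :=
        ((hasDerivAt_id' s).mul_const c).const_sub w
      have h2 : HasDerivAt (fun s : ℂ => Complex.exp (s * z)) (Complex.exp (s * z) * (1 * z)) s :=
        ((hasDerivAt_id' s).mul_const z).cexp
      have h3 : HasDerivAt (fun s : ℂ => (w - s * c) ^ m * Complex.exp (s * z))
          (m * (w - s * c) ^ (m - 1) * -(1 * c) * Complex.exp (s * z)
            + (w - s * c) ^ m * (Complex.exp (s * z) * (1 * z))) s := (h1.pow m).mul h2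
      rw [h3.deriv]
      ring
    have hc : ∀ k : ℕ, ContDiffAt ℂ n (fun s : ℂ => (w - s * c) ^ k * Complex.exp (s * z)) 0 := by
      intro k; fun_prop
    rw [iteratedDeriv_succ', hd, iteratedDeriv_fun_sub (contDiffAt_const.mul (hc m))
      (contDiffAt_const.mul (hc (m - 1))), iteratedDeriv_const_mul_field,
      iteratedDeriv_const_mul_field, ih, ih, cHerm_succ_left]

theorem wick_eq_cHerm (n m : ℕ) (ρ : C.N) (φ : C.Dual) :
    C.wick n m ρ φ
      = cHerm ((‖ρ.1 0‖ ^ 2 : ℝ) : ℂ) (C.pair φ ρ) (conj (C.pair φ ρ)) n m := by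
  unfold wick
  rw [← iteratedDeriv_pow_mul_exp]
  congr 1
  ext s
  have e : (fun t : ℂ => Complex.exp (t * conj (C.pair φ ρ) + s * C.pair φ ρ
      - s * t * (‖ρ.1 0‖ : ℂ) ^ 2)) = fun t => Complex.exp (s * C.pair φ ρ)
        * Complex.exp ((conj (C.pair φ ρ) - s * ((‖ρ.1 0‖ ^ 2 : ℝ) : ℂ)) * t) := by
    ext t
    rw [← Complex.exp_add]
    congr 1
    push_cast
    ring
  rw [e, iteratedDeriv_const_mul_field, iteratedDeriv_cexp_const_mul]
  simp [mul_comm]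

theorem IsWhiteNoise.hasAllMoments_wick (hβ : C.IsWhiteNoise β) (n m : ℕ) (ρ : C.N) :
    HasAllMoments (C.wick n m ρ) β := by
  have := hβ.prob
  have h := (hβ.hasAllMoments_pair ρ).cHerm ((‖ρ.1 0‖ ^ 2 : ℝ) : ℂ) n m
  simpa only [← wick_eq_cHerm] using h

theorem conj_wick (n m : ℕ) (ρ : C.N) (φ : C.Dual) : conj (C.wick n m ρ φ) = C.wick m n ρ φ := by
  rw [wick_eq_cHerm, wick_eq_cHerm, cHerm_conj]

/-- The Wick monomials of a linear combination are combinations of Hermite products. -/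
theorem wick_sum {J : Type*} [Fintype J] [DecidableEq J] (g : J → C.N)
    (hg : ∀ i j, i ≠ j → inner ℂ ((g i).1 0) ((g j).1 0) = 0) (c : J → ℂ) (n m : ℕ) (φ : C.Dual) :
    C.wick n m (∑ j, c j • g j) φ = ∑ I : Fin n → J, ∑ K : Fin m → J,
        ((∏ i, c (I i)) * ∏ i, conj (c (K i))) * C.herm g (pairCount I K) φ := by
  have h := cHerm_sum (fun j => ‖(g j).1 0‖ ^ 2) (fun j => C.pair φ (g j)) c n m
  unfold herm
  rw [← h, wick_eq_cHerm, pair_sum]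
  simp only [pair_smul]
  congr 1
  norm_cast
  rw [coe_sum_apply, norm_sum_sq_of_orthogonal]
  · refine Finset.sum_congr rfl fun j _ => ?_
    rw [norm_smul_apply, mul_pow]
  · intro i j hij
    simp [inner_smul_left, inner_smul_right, hg i j hij]

end NFChain

/-! ### Completeness of the Wick monomials -/

namespace NFChain

variable {H : ℕ → Type*} [∀ p, NormedAddCommGroup (H p)]
  [∀ p, InnerProductSpace ℂ (H p)] [∀ p, CompleteSpace (H p)] {C : NFChain H} {β : Measure C.Dual}

theorem exists_pair_eq_dual (I : Finset C.N) (L : StrongDual ℝ (I → ℂ)) :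
    ∃ σ : C.N, ∀ φ : C.Dual, L (fun ρ => C.pair φ ρ) = (C.pair φ σ).re := by
  classical
  -- With `a = L 1` and `b = L i` in one coordinate, `a Re z + b Im z = Re ((a - b i) z)`.
  refine ⟨∑ ρ : I, ((L (Pi.single ρ 1) : ℂ) - L (Pi.single ρ Complex.I) * Complex.I) • (ρ : C.N),
    fun φ => ?_⟩
  rw [pair_sum, Complex.re_sum]
  have h : (fun ρ : I => C.pair φ ρ) = ∑ ρ : I, ((C.pair φ ρ).re • (Pi.single ρ (1 : ℂ) : I → ℂ)
      + (C.pair φ ρ).im • (Pi.single ρ Complex.I : I → ℂ)) := by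
    ext σ
    rw [Finset.sum_apply, Finset.sum_eq_single_of_mem σ (Finset.mem_univ σ)]
    · simp [Complex.re_add_im]
    · intro ρ _ hρ
      simp [Pi.single_eq_of_ne hρ.symm]
  rw [h, map_sum]
  refine Finset.sum_congr rfl fun ρ _ => ?_
  rw [map_add, map_smul, map_smul, pair_smul]
  simp
  ring

/-- The hypothesis determines the characteristic functions of all finite families of evaluations. A
finite measure on the product is determined by these marginals, and the cylinder `σ`-algebra is
pulled back from the product. -/
theorem measure_ext_of_integral_exp {μ ν : Measure C.Dual} [IsFiniteMeasure μ] [IsFiniteMeasure ν]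
    (h : ∀ ρ : C.N, ∫ φ, Complex.exp ((C.pair φ ρ).re * Complex.I) ∂μ
      = ∫ φ, Complex.exp ((C.pair φ ρ).re * Complex.I) ∂ν) : μ = ν := by
  set ev : C.Dual → (C.N → ℂ) := fun φ ρ => C.pair φ ρ with hev
  have hm : Measurable ev := measurable_pi_lambda _ fun ρ => C.measurable_pair ρ
  have hmI : ∀ I : Finset C.N, Measurable fun φ : C.Dual => fun ρ : I => C.pair φ ρ := fun I =>
    measurable_pi_lambda _ fun ρ => C.measurable_pair ρ
  have key : ∀ I : Finset C.N, (μ.map ev).map I.restrict = (ν.map ev).map I.restrict := by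
    intro I
    rw [Measure.map_map (Finset.measurable_restrict I) hm,
      Measure.map_map (Finset.measurable_restrict I) hm]
    refine Measure.ext_of_charFunDual ?_
    ext L
    obtain ⟨σ, hσ⟩ := exists_pair_eq_dual I L
    rw [charFunDual_apply, charFunDual_apply]
    have hI : I.restrict ∘ ev = fun φ : C.Dual => fun ρ : I => C.pair φ ρ := rfl
    rw [hI, integral_map (hmI I).aemeasurable (by fun_prop),
      integral_map (hmI I).aemeasurable (by fun_prop)]
    simp only [hσ]
    exact h σ
  have hmap : μ.map ev = ν.map ev :=
    IsProjectiveLimit.unique (P := fun I : Finset C.N => (ν.map ev).map I.restrict)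
      key (fun I => rfl)
  ext s hs
  have hcomap : MeasurableSet[MeasurableSpace.comap ev inferInstance] s := by
    have : instMeasurableSpaceDual C ≤ MeasurableSpace.comap ev inferInstance := by
      refine iSup_le fun ρ => ?_
      have h1 : @Measurable _ _ (MeasurableSpace.comap ev inferInstance) (borel ℂ)
          fun φ => C.pair φ ρ :=
        (measurable_pi_apply ρ).comp (comap_measurable ev)
      exact measurable_iff_comap_le.1 h1
    exact this s hs
  obtain ⟨t, ht, rfl⟩ := hcomap
  rw [← Measure.map_apply hm ht, hmap, Measure.map_apply hm ht]

/-- The finite measures with densities `f⁺` and `f⁻` have the same characteristic functional, hence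
coincide. -/
theorem ae_eq_zero_of_integral_exp_real [IsFiniteMeasure β] {f : C.Dual → ℝ} (hf : Integrable f β)
    (h : ∀ ρ : C.N, ∫ φ, Complex.exp ((C.pair φ ρ).re * Complex.I) * f φ ∂β = 0) : f =ᵐ[β] 0 := by
  have hexp : ∀ ρ : C.N, Measurable fun φ : C.Dual => Complex.exp ((C.pair φ ρ).re * Complex.I) :=
      by
    intro ρ
    exact Complex.measurable_exp.comp ((Complex.measurable_ofReal.comp
      (Complex.measurable_re.comp (C.measurable_pair ρ))).mul_const _)
  have fin1 : IsFiniteMeasure (β.withDensity fun φ => ENNReal.ofReal (f φ)) :=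
    isFiniteMeasure_withDensity_ofReal hf.2
  have fin2 : IsFiniteMeasure (β.withDensity fun φ => ENNReal.ofReal (-f φ)) :=
    isFiniteMeasure_withDensity_ofReal hf.neg.2
  have hm1 : AEMeasurable (fun φ => ENNReal.ofReal (f φ)) β := hf.1.aemeasurable.ennreal_ofReal
  have hm2 : AEMeasurable (fun φ => ENNReal.ofReal (-f φ)) β :=
    hf.1.aemeasurable.neg.ennreal_ofReal
  have hInt : ∀ (g : C.Dual → ℝ), Integrable g β → ∀ ρ : C.N, Integrable
      (fun φ => (ENNReal.ofReal (g φ)).toReal • Complex.exp ((C.pair φ ρ).re * Complex.I)) β := by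
    intro g hg ρ
    have h1 : Integrable (fun φ => ((max (g φ) 0 : ℝ) : ℂ)) β := hg.pos_part.ofReal
    have h2 := h1.mul_bdd (c := 1) (hexp ρ).aestronglyMeasurable
      (Filter.Eventually.of_forall fun φ => (Complex.norm_exp_ofReal_mul_I _).le)
    refine h2.congr (Filter.Eventually.of_forall fun φ => ?_)
    simp [ENNReal.toReal_ofReal', Complex.real_smul]
  have heq := measure_ext_of_integral_exp (μ := β.withDensity fun φ => ENNReal.ofReal (f φ))
    (ν := β.withDensity fun φ => ENNReal.ofReal (-f φ)) fun ρ => by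
      rw [integral_withDensity_eq_integral_toReal_smul₀ hm1 (by simp),
        integral_withDensity_eq_integral_toReal_smul₀ hm2 (by simp), ← sub_eq_zero,
        ← integral_sub (hInt f hf ρ) (hInt (fun φ => -f φ) hf.neg ρ)]
      rw [← h ρ]
      congr 1
      ext φ
      rw [← sub_smul, ENNReal.toReal_ofReal', ENNReal.toReal_ofReal', Complex.real_smul, mul_comm]
      congr 2
      rcases le_total (f φ) 0 with h0 | h0
      · rw [max_eq_right h0, max_eq_left (by linarith)]; ring
      · rw [max_eq_left h0, max_eq_right (by linarith)]; ring
  rw [withDensity_eq_iff hm1 hm2 hf.lintegral_lt_top.ne] at heq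
  filter_upwards [heq] with φ hφ
  have := congrArg ENNReal.toReal hφ
  rw [ENNReal.toReal_ofReal', ENNReal.toReal_ofReal'] at this
  rcases le_total (f φ) 0 with h0 | h0
  · rw [max_eq_right h0, max_eq_left (by linarith)] at this
    simp only [Pi.zero_apply]; linarith
  · rw [max_eq_left h0, max_eq_right (by linarith)] at this
    exact this

theorem ae_eq_zero_of_integral_exp [IsFiniteMeasure β] {Ψ : C.Dual → ℂ} (hΨ : Integrable Ψ β)
    (h : ∀ ρ : C.N, ∫ φ, Complex.exp ((C.pair φ ρ).re * Complex.I) * Ψ φ ∂β = 0) : Ψ =ᵐ[β] 0 := by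
  have hexp : ∀ ρ : C.N, Measurable fun φ : C.Dual => Complex.exp ((C.pair φ ρ).re * Complex.I) :=
      by
    intro ρ
    exact Complex.measurable_exp.comp ((Complex.measurable_ofReal.comp
      (Complex.measurable_re.comp (C.measurable_pair ρ))).mul_const _)
  have hi : ∀ (Ψ : C.Dual → ℂ), Integrable Ψ β → ∀ ρ : C.N,
      Integrable (fun φ => Complex.exp ((C.pair φ ρ).re * Complex.I) * Ψ φ) β := fun Ψ hΨ ρ =>
    hΨ.bdd_mul (c := 1) (hexp ρ).aestronglyMeasurable
      (Filter.Eventually.of_forall fun φ => (Complex.norm_exp_ofReal_mul_I _).le)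
  have hc : Integrable (fun φ => conj (Ψ φ)) β :=
    (Complex.conjCLE.toContinuousLinearMap.integrable_comp hΨ :)
  -- Conjugating the hypothesis at `-ρ` restores the sign of the exponent, so real and imaginary
  -- parts can be treated separately.
  have hconj : ∀ ρ : C.N,
      ∫ φ, Complex.exp ((C.pair φ ρ).re * Complex.I) * conj (Ψ φ) ∂β = 0 := by
    intro ρ
    have h1 := congrArg conj (h ((-1 : ℂ) • ρ))
    rw [← integral_conj, map_zero] at h1
    rw [← h1]
    congr 1
    ext φ
    rw [map_mul, ← Complex.exp_conj, pair_smul]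
    simp
  have hre : (fun φ => (Ψ φ).re) =ᵐ[β] 0 := by
    refine ae_eq_zero_of_integral_exp_real hΨ.re fun ρ => ?_
    have e : ∀ φ, Complex.exp ((C.pair φ ρ).re * Complex.I) * ((Ψ φ).re : ℂ)
        = (1 / 2) * (Complex.exp ((C.pair φ ρ).re * Complex.I) * Ψ φ
          + Complex.exp ((C.pair φ ρ).re * Complex.I) * conj (Ψ φ)) := by
      intro φ
      rw [Complex.re_eq_add_conj (Ψ φ)]; ring
    simp only [e]
    rw [integral_const_mul, integral_add (hi _ hΨ ρ) (hi _ hc ρ), h, hconj]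
    simp
  have him : (fun φ => (Ψ φ).im) =ᵐ[β] 0 := by
    refine ae_eq_zero_of_integral_exp_real hΨ.im fun ρ => ?_
    have e : ∀ φ, Complex.exp ((C.pair φ ρ).re * Complex.I) * ((Ψ φ).im : ℂ)
        = (1 / (2 * Complex.I)) * (Complex.exp ((C.pair φ ρ).re * Complex.I) * Ψ φ
          - Complex.exp ((C.pair φ ρ).re * Complex.I) * conj (Ψ φ)) := by
      intro φ
      rw [Complex.im_eq_sub_conj (Ψ φ)]; ring
    simp only [e]
    rw [integral_const_mul, integral_sub (hi _ hΨ ρ) (hi _ hc ρ), h, hconj]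
    simp
  filter_upwards [hre, him] with φ h1 h2
  exact Complex.ext h1 h2

theorem IsWhiteNoise.memLp_exp_abs_re (hβ : C.IsWhiteNoise β) (ρ : C.N) :
    MemLp (fun φ => Real.exp |(C.pair φ ρ).re|) 2 β := by
  have hm : Measurable fun φ => (C.pair φ ρ).re := Complex.measurable_re.comp (C.measurable_pair ρ)
  have h1 : ∀ t : ℝ, Integrable (fun φ => Real.exp (t * (C.pair φ ρ).re)) β := by
    intro t
    have h := ProbabilityTheory.integrable_exp_mul_gaussianReal (μ := 0)
      (v := (‖ρ.1 0‖ ^ 2 / 2).toNNReal) t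
    rw [← hβ.map_re ρ] at h
    exact h.comp_measurable hm
  have hmexp : AEStronglyMeasurable (fun φ => Real.exp |(C.pair φ ρ).re|) β :=
    (Real.measurable_exp.comp hm.abs).aestronglyMeasurable
  rw [memLp_two_iff_integrable_sq hmexp]
  refine ((h1 2).add (h1 (-2))).mono' (hmexp.pow 2) (Filter.Eventually.of_forall fun φ => ?_)
  rw [Real.norm_eq_abs, abs_of_nonneg (by positivity), ← Real.exp_nat_mul]
  simp only [Pi.add_apply]
  push_cast
  rcases abs_cases (C.pair φ ρ).re with ⟨h, _⟩ | ⟨h, _⟩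
  · rw [h]; linarith [Real.exp_pos (-2 * (C.pair φ ρ).re)]
  · rw [h, show (2 : ℝ) * -(C.pair φ ρ).re = -2 * (C.pair φ ρ).re by ring]
    linarith [Real.exp_pos (2 * (C.pair φ ρ).re)]

/-- The span of the Wick monomials in a fixed `ρ` is stable under multiplication by `z + conj z`.
The induction on `k` therefore treats all degrees `n`, `m` at once. -/
theorem IsWhiteNoise.integral_re_pow_mul_eq_zero (hβ : C.IsWhiteNoise β) {Ψ : C.Dual → ℂ}
    (hΨ : MemLp Ψ 2 β) (ρ : C.N) (h : ∀ n m, ∫ φ, conj (C.wick n m ρ φ) * Ψ φ ∂β = 0) (k : ℕ) :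
    ∫ φ, ((C.pair φ ρ).re : ℂ) ^ k * Ψ φ ∂β = 0 := by
  have := hβ.prob
  have hz := hβ.hasAllMoments_pair ρ
  have hX : HasAllMoments (fun φ => C.pair φ ρ + conj (C.pair φ ρ)) β := hz.add hz.conj
  have key : ∀ n m, ∫ φ, (C.pair φ ρ + conj (C.pair φ ρ)) ^ k * C.wick n m ρ φ * Ψ φ ∂β = 0 := by
    induction k with
    | zero =>
      intro n m
      have := h m n
      simpa [conj_wick] using this
    | succ k ih =>
      intro n m
      have e : ∀ φ, (C.pair φ ρ + conj (C.pair φ ρ)) ^ (k + 1) * C.wick n m ρ φ * Ψ φ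
          = (C.pair φ ρ + conj (C.pair φ ρ)) ^ k * C.wick (n + 1) m ρ φ * Ψ φ
          + ((‖ρ.1 0‖ ^ 2 : ℝ) : ℂ) * m *
            ((C.pair φ ρ + conj (C.pair φ ρ)) ^ k * C.wick n (m - 1) ρ φ * Ψ φ)
          + ((C.pair φ ρ + conj (C.pair φ ρ)) ^ k * C.wick n (m + 1) ρ φ * Ψ φ
          + ((‖ρ.1 0‖ ^ 2 : ℝ) : ℂ) * n *
            ((C.pair φ ρ + conj (C.pair φ ρ)) ^ k * C.wick (n - 1) m ρ φ * Ψ φ)) := by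
        intro φ
        simp only [wick_eq_cHerm]
        rw [cHerm_succ_left, cHerm_succ_right]
        ring
      have hInt : ∀ n m, Integrable
          (fun φ => (C.pair φ ρ + conj (C.pair φ ρ)) ^ k * C.wick n m ρ φ * Ψ φ) β := fun n m =>
        (((hX.pow k).mul (hβ.hasAllMoments_wick n m ρ)) 2 (by simp)).integrable_mul hΨ
      simp only [e]
      rw [integral_add, integral_add, integral_add, integral_const_mul, integral_const_mul,
        ih, ih, ih, ih]
      · simp
      · exact hInt _ _
      · exact (hInt _ _).const_mul _
      · exact hInt _ _
      · exact (hInt _ _).const_mul _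
      · exact (hInt _ _).add ((hInt _ _).const_mul _)
      · exact (hInt _ _).add ((hInt _ _).const_mul _)
  have h0 := key 0 0
  have e : ∀ φ, (C.pair φ ρ + conj (C.pair φ ρ)) ^ k * C.wick 0 0 ρ φ * Ψ φ
      = 2 ^ k * (((C.pair φ ρ).re : ℂ) ^ k * Ψ φ) := by
    intro φ
    rw [Complex.add_conj, wick_eq_cHerm, cHerm_zero_left]
    push_cast
    ring
  simp only [e] at h0
  rw [integral_const_mul] at h0
  simpa using h0

/-- The Wick monomials are total in `L²`. -/
theorem IsWhiteNoise.ae_eq_zero_of_wick (hβ : C.IsWhiteNoise β) {Ψ : C.Dual → ℂ}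
    (hΨ : MemLp Ψ 2 β) (h : ∀ n m ρ, ∫ φ, conj (C.wick n m ρ φ) * Ψ φ ∂β = 0) : Ψ =ᵐ[β] 0 := by
  have := hβ.prob
  refine ae_eq_zero_of_integral_exp (hΨ.integrable (by norm_num)) fun ρ => ?_
  have hm : Measurable fun φ => (C.pair φ ρ).re := Complex.measurable_re.comp (C.measurable_pair ρ)
  -- The exponential is integrated term by term against `Ψ`. The dominating function `exp |Re z| *
  -- ‖Ψ‖` is integrable, because both factors are in `L²`.
  have hs := hasSum_integral_of_dominated_convergence (μ := β)
    (F := fun (k : ℕ) φ => (((C.pair φ ρ).re : ℂ) * Complex.I) ^ k / k.factorial * Ψ φ)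
    (f := fun φ => Complex.exp ((C.pair φ ρ).re * Complex.I) * Ψ φ)
    (fun (k : ℕ) φ => |(C.pair φ ρ).re| ^ k / k.factorial * ‖Ψ φ‖) ?_ ?_ ?_ ?_ ?_
  · refine hs.unique ?_
    have : ∀ k : ℕ, ∫ φ, (((C.pair φ ρ).re : ℂ) * Complex.I) ^ k / k.factorial * Ψ φ ∂β = 0 := by
      intro k
      have e : ∀ φ, (((C.pair φ ρ).re : ℂ) * Complex.I) ^ k / k.factorial * Ψ φ
          = (Complex.I ^ k / k.factorial) * (((C.pair φ ρ).re : ℂ) ^ k * Ψ φ) := by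
        intro φ; rw [mul_pow]; ring
      simp only [e]
      rw [integral_const_mul, hβ.integral_re_pow_mul_eq_zero hΨ ρ (fun n m => h n m ρ), mul_zero]
    simp only [this]
    exact hasSum_zero
  · intro k
    have : Measurable fun φ => (((C.pair φ ρ).re : ℂ) * Complex.I) ^ k / (k.factorial : ℂ) :=
      (((Complex.measurable_ofReal.comp hm).mul_const _).pow_const _).div_const _
    exact this.aestronglyMeasurable.mul hΨ.1
  · intro k
    refine Filter.Eventually.of_forall fun φ => ?_
    simp
  · refine Filter.Eventually.of_forall fun φ => ?_
    exact (Real.summable_pow_div_factorial _).mul_right _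
  · have e : ∀ φ, ∑' k : ℕ, |(C.pair φ ρ).re| ^ k / k.factorial * ‖Ψ φ‖
        = Real.exp |(C.pair φ ρ).re| * ‖Ψ φ‖ := by
      intro φ
      rw [tsum_mul_right, Real.exp_eq_exp_ℝ, NormedSpace.exp_eq_tsum_div]
    simp only [e]
    exact (hβ.memLp_exp_abs_re ρ).integrable_mul hΨ.norm
  · refine Filter.Eventually.of_forall fun φ => ?_
    refine HasSum.mul_right _ ?_
    rw [Complex.exp_eq_exp_ℂ]
    exact NormedSpace.expSeries_div_hasSum_exp _

end NFChain

/-! ### Tensor powers of contractions -/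

/-- A tensor power of a contraction is a contraction: the matrix is applied to the first index with
the others fixed, then to the remaining ones by induction. -/
theorem sum_norm_sq_tensor_le {D J : Type*} [Fintype D] [Fintype J] (a : D → J → ℂ)
    (ha : ∀ x : J → ℂ, ∑ d, ‖∑ j, a d j * x j‖ ^ 2 ≤ ∑ j, ‖x j‖ ^ 2) (n : ℕ)
    (x : (Fin n → J) → ℂ) :
    ∑ I' : Fin n → D, ‖∑ I : Fin n → J, (∏ i, a (I' i) (I i)) * x I‖ ^ 2 ≤ ∑ I, ‖x I‖ ^ 2 := by
  induction n with
  | zero => simp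
  | succ n ih =>
    rw [Fintype.sum_equiv (Fin.consEquiv fun _ => D).symm _
      (fun P : D × (Fin n → D) => ‖∑ I : Fin (n + 1) → J, (∏ i, a ((Fin.cons P.1 P.2 : Fin (n + 1)
          → D) i) (I i)) * x I‖ ^ 2)
      (fun I => by simp [Fin.consEquiv, Fin.cons_self_tail]), Fintype.sum_prod_type,
          Finset.sum_comm,
      Fintype.sum_equiv (Fin.consEquiv fun _ => J).symm (fun I => ‖x I‖ ^ 2)
      (fun P : J × (Fin n → J) => ‖x (Fin.cons P.1 P.2)‖ ^ 2)
      (fun I => by simp [Fin.consEquiv, Fin.cons_self_tail]), Fintype.sum_prod_type]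
    have h1 : ∀ (I' : Fin n → D) (d : D),
        ∑ I : Fin (n + 1) → J, (∏ i, a ((Fin.cons d I' : Fin (n + 1) → D) i) (I i)) * x I
          = ∑ j, a d j * ∑ I : Fin n → J, (∏ i, a (I' i) (I i)) * x (Fin.cons j I) := by
      intro I' d
      rw [Fintype.sum_equiv (Fin.consEquiv fun _ => J).symm _
        (fun P : J × (Fin n → J) => a d P.1 * ((∏ i, a (I' i) (P.2 i)) * x (Fin.cons P.1 P.2)))
        (fun I => by
          simp [Fin.consEquiv, Fin.cons_self_tail, Fin.prod_univ_succ, Fin.tail, mul_assoc]),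
        Fintype.sum_prod_type]
      simp only [Finset.mul_sum]
    simp only [h1]
    calc _ ≤ ∑ I' : Fin n → D, ∑ j, ‖∑ I : Fin n → J, (∏ i, a (I' i) (I i)) * x (Fin.cons j I)‖ ^ 2
        :=
          Finset.sum_le_sum fun I' _ => ha _
      _ ≤ _ := by
          rw [Finset.sum_comm]
          exact Finset.sum_le_sum fun j _ => ih _

theorem sum_norm_sq_tensor_prod_le {D J : Type*} [Fintype D] [Fintype J] (a b : D → J → ℂ)
    (ha : ∀ x : J → ℂ, ∑ d, ‖∑ j, a d j * x j‖ ^ 2 ≤ ∑ j, ‖x j‖ ^ 2)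
    (hb : ∀ x : J → ℂ, ∑ d, ‖∑ j, b d j * x j‖ ^ 2 ≤ ∑ j, ‖x j‖ ^ 2) (n m : ℕ)
    (x : (Fin n → J) → (Fin m → J) → ℂ) :
    ∑ I' : Fin n → D, ∑ K' : Fin m → D, ‖∑ I : Fin n → J, ∑ K : Fin m → J,
        (∏ i, a (I' i) (I i)) * (∏ i, b (K' i) (K i)) * x I K‖ ^ 2
      ≤ ∑ I, ∑ K, ‖x I K‖ ^ 2 := by
  have e : ∀ (I' : Fin n → D) (K' : Fin m → D), ∑ I : Fin n → J, ∑ K : Fin m → J,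
        (∏ i, a (I' i) (I i)) * (∏ i, b (K' i) (K i)) * x I K
      = ∑ I : Fin n → J, (∏ i, a (I' i) (I i)) * ∑ K : Fin m → J, (∏ i, b (K' i) (K i)) * x I K :=
          by
    intro I' K'
    simp only [Finset.mul_sum, mul_assoc]
  simp only [e]
  rw [Finset.sum_comm]
  calc _ ≤ ∑ K' : Fin m → D, ∑ I : Fin n → J, ‖∑ K : Fin m → J, (∏ i, b (K' i) (K i)) * x I K‖ ^ 2
      :=
        Finset.sum_le_sum fun K' _ => sum_norm_sq_tensor_le a ha n _
    _ ≤ _ := by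
        rw [Finset.sum_comm]
        exact Finset.sum_le_sum fun I _ => sum_norm_sq_tensor_le b hb m _

/-! ### Bessel's inequality for two orthonormal families -/

section Bessel

variable {E : Type*} [NormedAddCommGroup E] [InnerProductSpace ℂ E]

theorem Orthonormal.norm_sum_smul_sq {J : Type*} [Fintype J] {g : J → E} (hg : Orthonormal ℂ g)
    (x : J → ℂ) : ‖∑ j, x j • g j‖ ^ 2 = ∑ j, ‖x j‖ ^ 2 := by
  rw [norm_sum_sq_of_orthogonal]
  · simp [norm_smul, hg.1]
  · intro i j hij
    simp [inner_smul_left, inner_smul_right, hg.2 hij]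

theorem Orthonormal.sum_norm_sq_inner_mul_le {D J : Type*} [Fintype D] [Fintype J] {e : D → E}
    {g : J → E} (he : Orthonormal ℂ e) (hg : Orthonormal ℂ g) (x : J → ℂ) :
    ∑ d, ‖∑ j, inner ℂ (e d) (g j) * x j‖ ^ 2 ≤ ∑ j, ‖x j‖ ^ 2 := by
  have h := he.sum_inner_products_le (x := ∑ j, x j • g j) (s := Finset.univ)
  rw [hg.norm_sum_smul_sq] at h
  simpa [inner_sum, inner_smul_right, mul_comm] using h

theorem Orthonormal.sum_norm_sq_inner_mul_le' {D J : Type*} [Fintype D] [Fintype J] {e : D → E}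
    {g : J → E} (he : Orthonormal ℂ e) (hg : Orthonormal ℂ g) (x : J → ℂ) :
    ∑ d, ‖∑ j, inner ℂ (g j) (e d) * x j‖ ^ 2 ≤ ∑ j, ‖x j‖ ^ 2 := by
  have h := he.sum_norm_sq_inner_mul_le hg fun j => conj (x j)
  simp only [RCLike.norm_conj] at h
  refine le_trans (le_of_eq (Finset.sum_congr rfl fun d _ => ?_)) h
  rw [← RCLike.norm_conj (∑ j, inner ℂ (g j) (e d) * x j), map_sum]
  simp [inner_conj_symm]

end Bessel

/-! ### Bosonic forms -/

namespace IsBosonicForm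

section Algebra

variable {E : Type*} [AddCommGroup E] [Module ℂ E] {n m : ℕ}
  {G G' : (Fin n → E) → (Fin m → E) → ℂ}

/-- A bosonic form as a multilinear map of its linear variables. -/
def rightMap (hG : IsBosonicForm G) (u : Fin n → E) : MultilinearMap ℂ (fun _ : Fin m => E) ℂ where
  toFun v := G u v
  map_update_add' := by
    intro _ v j x y
    convert hG.add_right u v j x y
  map_update_smul' := by
    intro _ v j c x
    rw [smul_eq_mul]
    convert hG.smul_right u v j c x

/-- The conjugate of a bosonic form as a multilinear map of its conjugate-linear variables. -/
def leftMap (hG : IsBosonicForm G) (v : Fin m → E) : MultilinearMap ℂ (fun _ : Fin n => E) ℂ where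
  toFun u := conj (G u v)
  map_update_add' := by
    intro _ u j x y
    rw [← map_add]
    convert congrArg conj (hG.add_left u v j x y)
  map_update_smul' := by
    intro _ u j c x
    have h := congrArg conj (hG.smul_left u v j c x)
    rw [map_mul, Complex.conj_conj] at h
    rw [smul_eq_mul]
    convert h

/-- A bosonic form as a real multilinear map of all its variables. -/
def realMap (hG : IsBosonicForm G) : MultilinearMap ℝ (fun _ : Fin n ⊕ Fin m => E) ℂ where
  toFun w := G (w ∘ Sum.inl) (w ∘ Sum.inr)
  map_update_add' := by
    intro _ w i x y
    rcases i with i | i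
    · simpa [Function.update_comp_eq_of_injective _ Sum.inl_injective] using
        hG.add_left (w ∘ Sum.inl) (w ∘ Sum.inr) i x y
    · simpa [Function.update_comp_eq_of_injective _ Sum.inr_injective] using
        hG.add_right (w ∘ Sum.inl) (w ∘ Sum.inr) i x y
  map_update_smul' := by
    intro _ w i c x
    rcases i with i | i
    · simpa [Function.update_comp_eq_of_injective _ Sum.inl_injective] using
        hG.smul_left (w ∘ Sum.inl) (w ∘ Sum.inr) i c x
    · simpa [Function.update_comp_eq_of_injective _ Sum.inr_injective] using
        hG.smul_right (w ∘ Sum.inl) (w ∘ Sum.inr) i c x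

theorem map_sum_sum (hG : IsBosonicForm G) {J : Type*} [Fintype J] [DecidableEq J] (e : J → E)
    (a : Fin n → J → ℂ) (b : Fin m → J → ℂ) :
    G (fun i => ∑ j, a i j • e j) (fun i => ∑ j, b i j • e j)
      = ∑ I : Fin n → J, ∑ K : Fin m → J,
        (∏ i, conj (a i (I i))) * (∏ i, b i (K i)) * G (e ∘ I) (e ∘ K) := by
  have h1 : ∀ u, G u (fun i => ∑ j, b i j • e j)
      = ∑ K : Fin m → J, (∏ i, b i (K i)) * G u (e ∘ K) := by
    intro u
    have := (hG.rightMap u).map_sum fun i j => b i j • e j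
    simp only [MultilinearMap.map_smul_univ, smul_eq_mul] at this
    exact this
  have h2 : ∀ v, G (fun i => ∑ j, a i j • e j) v
      = ∑ I : Fin n → J, (∏ i, conj (a i (I i))) * G (e ∘ I) v := by
    intro v
    have := congrArg conj ((hG.leftMap v).map_sum fun i j => a i j • e j)
    simp only [MultilinearMap.map_smul_univ, smul_eq_mul, map_sum, map_mul, map_prod] at this
    simpa [leftMap, Function.comp_def] using this
  rw [h2]
  refine Finset.sum_congr rfl fun I _ => ?_
  rw [h1, Finset.mul_sum]
  simp only [mul_assoc]

theorem comp (hG : IsBosonicForm G) (P : E →ₗ[ℂ] E) :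
    IsBosonicForm fun (u : Fin n → E) (v : Fin m → E) => G (P ∘ u) (P ∘ v) where
  add_left u v i x y := by
    simp only [Function.comp_update, map_add, hG.add_left]
  smul_left u v i c x := by
    simp only [Function.comp_update, map_smul, hG.smul_left]
  add_right u v i x y := by
    simp only [Function.comp_update, map_add, hG.add_right]
  smul_right u v i c x := by
    simp only [Function.comp_update, map_smul, hG.smul_right]
  symm_left σ u v := hG.symm_left σ (P ∘ u) (P ∘ v)
  symm_right σ u v := hG.symm_right σ (P ∘ u) (P ∘ v)

theorem zero : IsBosonicForm fun (_ : Fin n → E) (_ : Fin m → E) => (0 : ℂ) where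
  add_left u v i x y := by simp
  smul_left u v i c x := by simp
  add_right u v i x y := by simp
  smul_right u v i c x := by simp
  symm_left σ u v := rfl
  symm_right σ u v := rfl

theorem add (hG : IsBosonicForm G) (hG' : IsBosonicForm G') :
    IsBosonicForm fun u v => G u v + G' u v where
  add_left u v i x y := by simp only [hG.add_left, hG'.add_left]; ring
  smul_left u v i c x := by simp only [hG.smul_left, hG'.smul_left]; ring
  add_right u v i x y := by simp only [hG.add_right, hG'.add_right]; ring
  smul_right u v i c x := by simp only [hG.smul_right, hG'.smul_right]; ring
  symm_left σ u v := by rw [hG.symm_left, hG'.symm_left]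
  symm_right σ u v := by rw [hG.symm_right, hG'.symm_right]

end Algebra

section Norm

variable {E : Type*} [NormedAddCommGroup E] [InnerProductSpace ℂ E] {n m : ℕ}
  {G : (Fin n → E) → (Fin m → E) → ℂ}

theorem _root_.sum_enorm_sq_le_hsNormSq (G : (Fin n → E) → (Fin m → E) → ℂ) {d : ℕ}
    {e : Fin d → E} (he : Orthonormal ℂ e) :
    ∑ I : Fin n → Fin d, ∑ J : Fin m → Fin d, ‖G (e ∘ I) (e ∘ J)‖ₑ ^ 2 ≤ hsNormSq G :=
  le_iSup_of_le d (le_iSup_of_le e (le_iSup_of_le he le_rfl))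

theorem _root_.ofReal_sum_norm_sq_le_hsNormSq (G : (Fin n → E) → (Fin m → E) → ℂ) {d : ℕ}
    {e : Fin d → E} (he : Orthonormal ℂ e) :
    ENNReal.ofReal (∑ I : Fin n → Fin d, ∑ J : Fin m → Fin d, ‖G (e ∘ I) (e ∘ J)‖ ^ 2)
      ≤ hsNormSq G := by
  refine le_trans (le_of_eq ?_) (sum_enorm_sq_le_hsNormSq G he)
  rw [ENNReal.ofReal_sum_of_nonneg fun _ _ => Finset.sum_nonneg fun _ _ => sq_nonneg _]
  refine Finset.sum_congr rfl fun I _ => ?_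
  rw [ENNReal.ofReal_sum_of_nonneg fun _ _ => sq_nonneg _]
  refine Finset.sum_congr rfl fun J _ => ?_
  rw [ENNReal.ofReal_pow (norm_nonneg _), ofReal_norm]

/-- All arguments are expanded in an orthonormal basis of their finite-dimensional span, and
Cauchy-Schwarz separates the coordinates from the coefficients of `G`. This is the source of
continuity, which is not part of the definition of a bosonic form. -/
theorem norm_sq_le (hG : IsBosonicForm G) (hfin : hsNormSq G ≠ ∞) (u : Fin n → E)
    (v : Fin m → E) :
    ‖G u v‖ ^ 2 ≤ (hsNormSq G).toReal * ((∏ i, ‖u i‖ ^ 2) * ∏ i, ‖v i‖ ^ 2) := by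
  set W : Submodule ℂ E := Submodule.span ℂ (Set.range u ∪ Set.range v) with hW
  have : FiniteDimensional ℂ W :=
    FiniteDimensional.span_of_finite ℂ ((Set.finite_range u).union (Set.finite_range v))
  set b := stdOrthonormalBasis ℂ W
  set e : Fin (Module.finrank ℂ W) → E := fun k => (b k : E) with he
  have hon : Orthonormal ℂ e := by
    have := b.orthonormal.comp_linearIsometry W.subtypeₗᵢ
    exact this
  have hexp : ∀ x ∈ W, x = ∑ k, inner ℂ (e k) x • e k ∧ ‖x‖ ^ 2 = ∑ k, ‖inner ℂ (e k) x‖ ^ 2 := by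
    intro x hx
    have h1 := congrArg (Subtype.val) (b.sum_repr' ⟨x, hx⟩)
    have h2 : x = ∑ k, inner ℂ (e k) x • e k := by
      rw [Submodule.coe_sum] at h1
      exact h1.symm
    refine ⟨h2, ?_⟩
    rw [← hon.norm_sum_smul_sq, ← h2]
  have hu : ∀ i, u i ∈ W := fun i => Submodule.subset_span (Or.inl ⟨i, rfl⟩)
  have hv : ∀ i, v i ∈ W := fun i => Submodule.subset_span (Or.inr ⟨i, rfl⟩)
  have h := hG.map_sum_sum e (fun i k => inner ℂ (e k) (u i)) (fun i k => inner ℂ (e k) (v i))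
  simp only [← (hexp _ (hu _)).1, ← (hexp _ (hv _)).1] at h
  have hle : ∑ I : Fin n → Fin _, ∑ K : Fin m → Fin _, ‖G (e ∘ I) (e ∘ K)‖ ^ 2
      ≤ (hsNormSq G).toReal :=
    (ENNReal.ofReal_le_iff_le_toReal hfin).1 (ofReal_sum_norm_sq_le_hsNormSq G hon)
  have hprod : (∏ i, ‖u i‖ ^ 2) * ∏ i, ‖v i‖ ^ 2 = ∑ I : Fin n → Fin (Module.finrank ℂ W),
      ∑ K : Fin m → Fin (Module.finrank ℂ W),
      ‖(∏ i, conj (inner ℂ (e (I i)) (u i))) * ∏ i, inner ℂ (e (K i)) (v i)‖ ^ 2 := by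
    simp only [(hexp _ (hu _)).2, (hexp _ (hv _)).2, Finset.prod_univ_sum, Fintype.piFinset_univ,
      Finset.sum_mul_sum, norm_mul, norm_prod, RCLike.norm_conj, mul_pow, Finset.prod_pow]
  rw [h, hprod]
  simp only [← Fintype.sum_prod_type'] at hle ⊢
  calc _ ≤ (∑ P : (Fin n → Fin _) × (Fin m → Fin _),
        ‖(∏ i, conj (inner ℂ (e (P.1 i)) (u i))) * ∏ i, inner ℂ (e (P.2 i)) (v i)‖
          * ‖G (e ∘ P.1) (e ∘ P.2)‖) ^ 2 := by
        gcongr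
        refine (norm_sum_le _ _).trans (le_of_eq (Finset.sum_congr rfl fun P _ => ?_))
        rw [norm_mul]
    _ ≤ _ := Finset.sum_mul_sq_le_sq_mul_sq _ _ _
    _ ≤ _ := by
        rw [mul_comm]
        exact mul_le_mul_of_nonneg_right hle (Finset.sum_nonneg fun _ _ => sq_nonneg _)

theorem continuous_realMap (hG : IsBosonicForm G) (hfin : hsNormSq G ≠ ∞) :
    Continuous hG.realMap := by
  refine MultilinearMap.continuous_of_bound _ (Real.sqrt (hsNormSq G).toReal) fun w => ?_
  have h := hG.norm_sq_le hfin (w ∘ Sum.inl) (w ∘ Sum.inr)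
  refine le_of_sq_le_sq ?_ (by positivity)
  rw [mul_pow, Real.sq_sqrt ENNReal.toReal_nonneg, ← Finset.prod_pow, Fintype.prod_sum_type]
  exact h

theorem tendsto (hG : IsBosonicForm G) (hfin : hsNormSq G ≠ ∞) {ι : Type*} {l : Filter ι}
    {u : ι → Fin n → E} {v : ι → Fin m → E} {u₀ : Fin n → E} {v₀ : Fin m → E}
    (hu : ∀ i, Filter.Tendsto (fun k => u k i) l (nhds (u₀ i)))
    (hv : ∀ i, Filter.Tendsto (fun k => v k i) l (nhds (v₀ i))) :
    Filter.Tendsto (fun k => G (u k) (v k)) l (nhds (G u₀ v₀)) := by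
  have h : Filter.Tendsto (fun k => (Sum.elim (u k) (v k) : Fin n ⊕ Fin m → E)) l
      (nhds (Sum.elim u₀ v₀)) := by
    rw [tendsto_pi_nhds]
    rintro (i | i)
    · exact hu i
    · exact hv i
  exact ((hG.continuous_realMap hfin).tendsto _).comp h

end Norm

end IsBosonicForm

/-! ### Forms with given coefficients -/

theorem idxCount_comp_perm {J : Type*} [DecidableEq J] {n : ℕ} (I : Fin n → J)
    (σ : Equiv.Perm (Fin n)) : idxCount (I ∘ σ) = idxCount I := by
  ext j
  unfold idxCount
  refine Finset.card_bij (fun i _ => σ i) (fun i hi => by simpa using hi)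
    (fun i _ k _ h => σ.injective h) fun k hk => ⟨σ.symm k, by simpa using hk, by simp⟩

theorem exists_idxCount_eq {J : Type*} [Fintype J] [DecidableEq J] (a : J → ℕ) :
    ∃ I : Fin (∑ j, a j) → J, idxCount I = a := by
  have h := card_idxCount_eq a rfl
  have h0 : 0 < (Finset.univ.filter fun I : Fin (∑ j, a j) → J => idxCount I = a).card := by
    by_contra! h1
    rw [Nat.le_zero.1 h1, zero_mul] at h
    exact (Nat.factorial_ne_zero _) h.symm
  obtain ⟨I, hI⟩ := Finset.card_pos.1 h0
  exact ⟨I, (Finset.mem_filter.1 hI).2⟩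

theorem prod_apply_update {ι E R : Type*} [Fintype ι] [DecidableEq ι] [CommMonoid R]
    (f : ι → E → R) (u : ι → E) (i : ι) (x : E) :
    ∏ k, f k (Function.update u i x k) = f i x * ∏ k ∈ {i}ᶜ, f k (u k) := by
  rw [Fintype.prod_eq_mul_prod_compl i, Function.update_self]
  congr 1
  refine Finset.prod_congr rfl fun k hk => ?_
  rw [Function.update_of_ne (by simpa using hk)]

section CoeffForm

variable {E : Type*} [NormedAddCommGroup E] [InnerProductSpace ℂ E]
  {J : Type*} [Fintype J] [DecidableEq J]

/-- The form whose tensor has the coefficients `e A / (n! m!)` with respect to the family `g`. -/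
noncomputable def coeffForm (g : J → E) (e : (J ⊕ J → ℕ) → ℂ) (n m : ℕ) (u : Fin n → E)
    (v : Fin m → E) : ℂ :=
  ∑ I : Fin n → J, ∑ K : Fin m → J, (∏ i, inner ℂ (u i) (g (I i))) *
    (∏ i, inner ℂ (g (K i)) (v i)) * (e (pairCount I K) / (n.factorial * m.factorial))

theorem isBosonicForm_coeffForm (g : J → E) (e : (J ⊕ J → ℕ) → ℂ) (n m : ℕ) :
    IsBosonicForm (coeffForm g e n m) where
  add_left u v i x y := by
    unfold coeffForm
    have hp : ∀ (I : Fin n → J) (x : E), ∏ k, inner ℂ (Function.update u i x k) (g (I k))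
        = inner ℂ x (g (I i)) * ∏ k ∈ {i}ᶜ, inner ℂ (u k) (g (I k)) := fun I x =>
      prod_apply_update (fun k x => inner ℂ x (g (I k))) u i x
    simp only [hp, inner_add_left, add_mul,
      Finset.sum_add_distrib]
  smul_left u v i c x := by
    unfold coeffForm
    have hp : ∀ (I : Fin n → J) (x : E), ∏ k, inner ℂ (Function.update u i x k) (g (I k))
        = inner ℂ x (g (I i)) * ∏ k ∈ {i}ᶜ, inner ℂ (u k) (g (I k)) := fun I x =>
      prod_apply_update (fun k x => inner ℂ x (g (I k))) u i x
    simp only [hp, inner_smul_left, mul_assoc,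
      Finset.mul_sum]
  add_right u v i x y := by
    unfold coeffForm
    have hp : ∀ (K : Fin m → J) (x : E), ∏ k, inner ℂ (g (K k)) (Function.update v i x k)
        = inner ℂ (g (K i)) x * ∏ k ∈ {i}ᶜ, inner ℂ (g (K k)) (v k) := fun K x =>
      prod_apply_update (fun k x => inner ℂ (g (K k)) x) v i x
    simp only [hp, inner_add_right, add_mul,
      mul_add, Finset.sum_add_distrib]
  smul_right u v i c x := by
    unfold coeffForm
    have hp : ∀ (K : Fin m → J) (x : E), ∏ k, inner ℂ (g (K k)) (Function.update v i x k)
        = inner ℂ (g (K i)) x * ∏ k ∈ {i}ᶜ, inner ℂ (g (K k)) (v k) := fun K x =>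
      prod_apply_update (fun k x => inner ℂ (g (K k)) x) v i x
    simp only [hp, inner_smul_right,
      Finset.mul_sum]
    refine Finset.sum_congr rfl fun I _ => Finset.sum_congr rfl fun K _ => ?_
    ring
  symm_left σ u v := by
    unfold coeffForm
    refine Fintype.sum_equiv (σ.arrowCongr (Equiv.refl J)) _ _ fun I => ?_
    refine Finset.sum_congr rfl fun K _ => ?_
    have h1 : (σ.arrowCongr (Equiv.refl J)) I = I ∘ σ.symm := rfl
    have h2 : pairCount (I ∘ σ.symm) K = pairCount I K := by
      unfold pairCount; rw [idxCount_comp_perm]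
    rw [h1, h2]
    congr 2
    refine Fintype.prod_equiv σ _ _ fun i => ?_
    simp
  symm_right σ u v := by
    unfold coeffForm
    refine Finset.sum_congr rfl fun I _ => ?_
    refine Fintype.sum_equiv (σ.arrowCongr (Equiv.refl J)) _ _ fun K => ?_
    have h1 : (σ.arrowCongr (Equiv.refl J)) K = K ∘ σ.symm := rfl
    have h2 : pairCount I (K ∘ σ.symm) = pairCount I K := by
      unfold pairCount; rw [idxCount_comp_perm]
    rw [h1, h2]
    congr 2
    refine Fintype.prod_equiv σ _ _ fun i => ?_
    simp

/-- Evaluating on another orthonormal family applies to the coefficients tensor powers of the matrix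
of scalar products of the two families, which is a contraction by Bessel's inequality. -/
theorem hsNormSq_coeffForm_le {g : J → E} (hg : Orthonormal ℂ g) (e : (J ⊕ J → ℕ) → ℂ) (n m : ℕ) :
    hsNormSq (coeffForm g e n m) ≤ ENNReal.ofReal
      (∑ I : Fin n → J, ∑ K : Fin m → J, ‖e (pairCount I K) / (n.factorial * m.factorial)‖ ^ 2) :=
          by
  refine iSup_le fun d => iSup_le fun f => iSup_le fun hf => ?_
  have h := sum_norm_sq_tensor_prod_le (fun k j => inner ℂ (f k) (g j))
    (fun k j => inner ℂ (g j) (f k)) (hf.sum_norm_sq_inner_mul_le hg)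
    (hf.sum_norm_sq_inner_mul_le' hg) n m
    fun I K => e (pairCount I K) / (n.factorial * m.factorial)
  refine le_trans (le_of_eq ?_) (ENNReal.ofReal_le_ofReal h)
  rw [ENNReal.ofReal_sum_of_nonneg fun _ _ => Finset.sum_nonneg fun _ _ => sq_nonneg _]
  refine Finset.sum_congr rfl fun I _ => ?_
  rw [ENNReal.ofReal_sum_of_nonneg fun _ _ => sq_nonneg _]
  refine Finset.sum_congr rfl fun K _ => ?_
  rw [ENNReal.ofReal_pow (norm_nonneg _), ofReal_norm]
  rfl

/-- The squared Fock norm of a family of forms. -/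
noncomputable def fockSum (q : ℝ) (G : ∀ n m : ℕ, (Fin n → E) → (Fin m → E) → ℂ) : ℝ≥0∞ :=
  ∑' n : ℕ, ∑' m : ℕ,
    ENNReal.ofReal ((n.factorial : ℝ) * (m.factorial : ℝ) * (2 : ℝ) ^ (q * ((n : ℝ) + (m : ℝ))))
      * hsNormSq (G n m)


theorem two_rpow_mul_add (q : ℝ) (n m : ℕ) :
    (2 : ℝ) ^ (q * ((n : ℝ) + (m : ℝ))) = ((2 : ℝ) ^ q) ^ (n + m) := by
  rw [Real.rpow_mul (by norm_num), ← Nat.cast_add, Real.rpow_natCast]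

theorem fockSum_mono {q : ℝ} {G G' : ∀ n m : ℕ, (Fin n → E) → (Fin m → E) → ℂ}
    (h : ∀ n m, hsNormSq (G n m) ≤ hsNormSq (G' n m)) : fockSum q G ≤ fockSum q G' :=
  ENNReal.tsum_le_tsum fun n => ENNReal.tsum_le_tsum fun m => by gcongr; exact h n m

theorem fockSum_mono_exponent {q q' : ℝ} (hq : q ≤ q')
    (G : ∀ n m : ℕ, (Fin n → E) → (Fin m → E) → ℂ) : fockSum q G ≤ fockSum q' G :=
  ENNReal.tsum_le_tsum fun n => ENNReal.tsum_le_tsum fun m => by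
    gcongr
    norm_num

theorem hsNormSq_ne_top_of_fockSum {q : ℝ} {G : ∀ n m : ℕ, (Fin n → E) → (Fin m → E) → ℂ}
    (h : fockSum q G ≠ ∞) (n m : ℕ) : hsNormSq (G n m) ≠ ∞ := by
  intro h0
  have h1 := ENNReal.ne_top_of_tsum_ne_top (ENNReal.ne_top_of_tsum_ne_top h n) m
  rw [h0, ENNReal.mul_top] at h1
  · exact h1 rfl
  · have : 0 < (n.factorial : ℝ) * (m.factorial : ℝ) * (2 : ℝ) ^ (q * ((n : ℝ) + (m : ℝ))) := by
      positivity
    simpa using this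

/-- The squared norm of a finite sequence of coefficients, with weights `w ^ |A| / A!`. -/
noncomputable def coeffNormSq (w : ℝ) (M : ℕ) (e : (J ⊕ J → ℕ) → ℂ) : ℝ :=
  ∑ A ∈ box (J ⊕ J) M, ‖e A‖ ^ 2 / multiFactorial A * w ^ (∑ i, A i)

theorem coeffNormSq_nonneg {w : ℝ} (hw : 0 ≤ w) (M : ℕ) (e : (J ⊕ J → ℕ) → ℂ) :
    0 ≤ coeffNormSq w M e :=
  Finset.sum_nonneg fun _ _ => by positivity

/-- The multi-indices are sorted by their degrees `(n, m)`; each `A` arises from `n! m! / A!` pairs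
of index functions. This links sums over multi-indices with Hilbert-Schmidt norms of forms. -/
theorem ofReal_coeffNormSq {w : ℝ} (hw : 0 ≤ w) (M : ℕ) (e : (J ⊕ J → ℕ) → ℂ)
    (he : ∀ A, A ∉ box (J ⊕ J) M → e A = 0) :
    ENNReal.ofReal (coeffNormSq w M e) = ∑' n : ℕ, ∑' m : ℕ, ENNReal.ofReal (w ^ (n + m) *
      ((∑ I : Fin n → J, ∑ K : Fin m → J, ‖e (pairCount I K)‖ ^ 2)
        / (n.factorial * m.factorial))) := by
  have h1 : ∀ n m : ℕ, ENNReal.ofReal (w ^ (n + m) *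
      ((∑ I : Fin n → J, ∑ K : Fin m → J, ‖e (pairCount I K)‖ ^ 2)
        / (n.factorial * m.factorial))) = ∑ A ∈ box (J ⊕ J) M,
        if ∑ j, A (.inl j) = n then (if ∑ j, A (.inr j) = m then
          ENNReal.ofReal (‖e A‖ ^ 2 / multiFactorial A * w ^ (∑ i, A i)) else 0) else 0 := by
    intro n m
    rw [sum_pairCount M n m (fun A => ‖e A‖ ^ 2) fun A hA => by simp [he A hA], Finset.mul_sum,
      ENNReal.ofReal_sum_of_nonneg]
    · refine Finset.sum_congr rfl fun A _ => ?_
      rw [← ite_and]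
      split_ifs with h
      · rw [Fintype.sum_sum_type, h.1, h.2, mul_comm]
      · simp
    · intro A _
      split_ifs <;> positivity
  simp only [h1]
  have h2 : ∀ n : ℕ, ∑' m : ℕ, ∑ A ∈ box (J ⊕ J) M, (if ∑ j, A (.inl j) = n then
      (if ∑ j, A (.inr j) = m then
        ENNReal.ofReal (‖e A‖ ^ 2 / multiFactorial A * w ^ (∑ i, A i)) else 0) else 0)
      = ∑ A ∈ box (J ⊕ J) M, (if ∑ j, A (.inl j) = n then
        ENNReal.ofReal (‖e A‖ ^ 2 / multiFactorial A * w ^ (∑ i, A i)) else 0) := by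
    intro n
    rw [Summable.tsum_finsetSum fun _ _ => ENNReal.summable]
    refine Finset.sum_congr rfl fun A _ => ?_
    split_ifs
    · rw [tsum_eq_single (∑ j, A (.inr j)) fun b hb => if_neg (Ne.symm hb), if_pos rfl]
    · simp
  simp only [h2]
  rw [Summable.tsum_finsetSum fun _ _ => ENNReal.summable, coeffNormSq,
    ENNReal.ofReal_sum_of_nonneg fun _ _ => by positivity]
  refine Finset.sum_congr rfl fun A _ => ?_
  rw [tsum_eq_single (∑ j, A (.inl j)) fun b hb => if_neg (Ne.symm hb), if_pos rfl]

theorem fockSum_coeffForm_le {g : J → E} (hg : Orthonormal ℂ g) (q : ℝ) (M : ℕ)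
    (e : (J ⊕ J → ℕ) → ℂ) (he : ∀ A, A ∉ box (J ⊕ J) M → e A = 0) :
    fockSum q (coeffForm g e) ≤ ENNReal.ofReal (coeffNormSq ((2 : ℝ) ^ q) M e) := by
  rw [ofReal_coeffNormSq (by positivity) M e he]
  refine ENNReal.tsum_le_tsum fun n => ENNReal.tsum_le_tsum fun m => ?_
  refine (mul_le_mul_right (hsNormSq_coeffForm_le hg e n m) _).trans (le_of_eq ?_)
  rw [← ENNReal.ofReal_mul (by positivity)]
  congr 1
  have h1 : ∀ z : ℂ, ‖z / ((n.factorial : ℂ) * m.factorial)‖ ^ 2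
      = ‖z‖ ^ 2 / ((n.factorial : ℝ) * m.factorial) ^ 2 := by
    intro z
    rw [norm_div, div_pow, norm_mul, Complex.norm_natCast, Complex.norm_natCast]
  simp only [h1, ← Finset.sum_div, two_rpow_mul_add]
  have hn : (n.factorial : ℝ) ≠ 0 := by positivity
  have hm : (m.factorial : ℝ) ≠ 0 := by positivity
  field_simp

open Classical in
/-- The coefficients of a family of bosonic forms with respect to the family `g`, in the degrees
below `M`. -/
noncomputable def formCoeff (G : ∀ n m : ℕ, (Fin n → E) → (Fin m → E) → ℂ) (g : J → E) (M : ℕ)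
    (A : J ⊕ J → ℕ) : ℂ :=
  if (∑ j, A (.inl j)) < M ∧ (∑ j, A (.inr j)) < M then
    ((∑ j, A (.inl j)).factorial * (∑ j, A (.inr j)).factorial : ℂ) *
      G _ _ (g ∘ (exists_idxCount_eq fun j => A (.inl j)).choose)
        (g ∘ (exists_idxCount_eq fun j => A (.inr j)).choose)
  else 0

theorem formCoeff_eq_zero (G : ∀ n m : ℕ, (Fin n → E) → (Fin m → E) → ℂ) (g : J → E) (M : ℕ)
    (A : J ⊕ J → ℕ) (hA : A ∉ box (J ⊕ J) M) : formCoeff G g M A = 0 := by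
  refine if_neg fun h => hA (mem_box.2 ?_)
  rintro (j | j)
  · exact (Finset.single_le_sum (f := fun j => A (.inl j)) (fun _ _ => Nat.zero_le _)
      (Finset.mem_univ j)).trans_lt h.1
  · exact (Finset.single_le_sum (f := fun j => A (.inr j)) (fun _ _ => Nat.zero_le _)
      (Finset.mem_univ j)).trans_lt h.2

theorem formCoeff_pairCount {G : ∀ n m : ℕ, (Fin n → E) → (Fin m → E) → ℂ}
    (hG : ∀ n m, IsBosonicForm (G n m)) (g : J → E) (M : ℕ) {n m : ℕ} (I : Fin n → J)
    (K : Fin m → J) :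
    formCoeff G g M (pairCount I K)
      = if n < M ∧ m < M then (n.factorial * m.factorial : ℂ) * G n m (g ∘ I) (g ∘ K) else 0 := by
  -- The degrees of a multi-index agree with `n` and `m` only propositionally, so they are
  -- generalized first. The chosen index functions then differ from `I` and `K` by permutations,
  -- under which the form is invariant.
  have key : ∀ (n' m' : ℕ) (hn : n' = n) (hm : m' = m) (I' : Fin n' → J) (K' : Fin m' → J),
      idxCount I' = idxCount I → idxCount K' = idxCount K →
      (if n' < M ∧ m' < M then (n'.factorial * m'.factorial : ℂ) * G n' m' (g ∘ I') (g ∘ K') else 0)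
      = if n < M ∧ m < M then (n.factorial * m.factorial : ℂ) * G n m (g ∘ I) (g ∘ K) else 0 := by
    rintro n' m' rfl rfl I' K' hI hK
    obtain ⟨σ, rfl⟩ := exists_perm_of_idxCount_eq hI
    obtain ⟨τ, rfl⟩ := exists_perm_of_idxCount_eq hK
    rw [← Function.comp_assoc, ← Function.comp_assoc, (hG _ _).symm_left, (hG _ _).symm_right]
  have := key (∑ j, pairCount I K (.inl j)) (∑ j, pairCount I K (.inr j)) (sum_idxCount I)
    (sum_idxCount K) _ _ (exists_idxCount_eq fun j => pairCount I K (.inl j)).choose_spec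
    (exists_idxCount_eq fun j => pairCount I K (.inr j)).choose_spec
  rw [← this]
  unfold formCoeff
  congr

theorem ofReal_coeffNormSq_formCoeff_le {d : ℕ} {G : ∀ n m : ℕ, (Fin n → E) → (Fin m → E) → ℂ}
    (hG : ∀ n m, IsBosonicForm (G n m)) {g : Fin d → E} (hg : Orthonormal ℂ g) (M : ℕ) (q : ℝ) :
    ENNReal.ofReal (coeffNormSq ((2 : ℝ) ^ q) M (formCoeff G g M)) ≤ fockSum q G := by
  rw [ofReal_coeffNormSq (by positivity) M _ (formCoeff_eq_zero G g M)]
  refine ENNReal.tsum_le_tsum fun n => ENNReal.tsum_le_tsum fun m => ?_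
  refine le_trans ?_ (mul_le_mul_right (ofReal_sum_norm_sq_le_hsNormSq (G n m) hg) _)
  rw [← ENNReal.ofReal_mul (by positivity), two_rpow_mul_add]
  refine ENNReal.ofReal_le_ofReal ?_
  have hle : ∑ I : Fin n → Fin d, ∑ K : Fin m → Fin d, ‖formCoeff G g M (pairCount I K)‖ ^ 2
      ≤ ((n.factorial : ℝ) * m.factorial) ^ 2
        * ∑ I : Fin n → Fin d, ∑ K : Fin m → Fin d, ‖G n m (g ∘ I) (g ∘ K)‖ ^ 2 := by
    rw [Finset.mul_sum]
    refine Finset.sum_le_sum fun I _ => ?_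
    rw [Finset.mul_sum]
    refine Finset.sum_le_sum fun K _ => ?_
    rw [formCoeff_pairCount hG]
    split_ifs
    · simp [mul_pow]
    · rw [norm_zero, zero_pow two_ne_zero]; positivity
  have hn : (n.factorial : ℝ) ≠ 0 := by positivity
  have hm : (m.factorial : ℝ) ≠ 0 := by positivity
  calc _ ≤ ((2 : ℝ) ^ q) ^ (n + m) * ((((n.factorial : ℝ) * m.factorial) ^ 2
        * ∑ I : Fin n → Fin d, ∑ K : Fin m → Fin d, ‖G n m (g ∘ I) (g ∘ K)‖ ^ 2)
          / (n.factorial * m.factorial)) := by gcongr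
    _ = _ := by field_simp

/-- The family of forms obtained by composing with a projection and omitting the degrees `≥ M`. -/
noncomputable def truncForm (P : E →L[ℂ] E) (M : ℕ)
    (G : ∀ n m : ℕ, (Fin n → E) → (Fin m → E) → ℂ) (n m : ℕ) (u : Fin n → E) (v : Fin m → E) : ℂ :=
  if n < M ∧ m < M then G n m (P ∘ u) (P ∘ v) else 0

theorem isBosonicForm_truncForm (P : E →L[ℂ] E) (M : ℕ)
    {G : ∀ n m : ℕ, (Fin n → E) → (Fin m → E) → ℂ} (hG : ∀ n m, IsBosonicForm (G n m)) (n m : ℕ) :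
    IsBosonicForm (truncForm P M G n m) := by
  unfold truncForm
  split_ifs
  · exact (hG n m).comp (P : E →ₗ[ℂ] E)
  · exact IsBosonicForm.zero

/-- Expanding `P u` and `P v` in `g` by multilinearity produces exactly the coefficients of `G` on
`g`; the factorials in the two definitions cancel. -/
theorem coeffForm_formCoeff {G : ∀ n m : ℕ, (Fin n → E) → (Fin m → E) → ℂ}
    (hG : ∀ n m, IsBosonicForm (G n m)) (g : J → E) (P : E →L[ℂ] E)
    (hP : ∀ x, P x = ∑ j, inner ℂ (g j) x • g j) (M : ℕ) :
    coeffForm g (formCoeff G g M) = truncForm P M G := by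
  ext n m u v
  unfold coeffForm truncForm
  simp only [formCoeff_pairCount hG]
  split_ifs
  · have h := (hG n m).map_sum_sum g (fun i j => inner ℂ (g j) (u i)) (fun i j => inner ℂ (g j) (v
      i))
    have hu : (P ∘ u) = fun i => ∑ j, inner ℂ (g j) (u i) • g j := funext fun i => hP _
    have hv : (P ∘ v) = fun i => ∑ j, inner ℂ (g j) (v i) • g j := funext fun i => hP _
    rw [hu, hv, h]
    refine Finset.sum_congr rfl fun I _ => Finset.sum_congr rfl fun K _ => ?_
    simp only [inner_conj_symm]
    congr 1
    have hn : (n.factorial : ℂ) ≠ 0 := by exact_mod_cast n.factorial_ne_zero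
    have hm : (m.factorial : ℂ) ≠ 0 := by exact_mod_cast m.factorial_ne_zero
    field_simp
  · simp

theorem hsNormSq_truncForm_le {d : ℕ} {G : ∀ n m : ℕ, (Fin n → E) → (Fin m → E) → ℂ}
    (hG : ∀ n m, IsBosonicForm (G n m)) {g : Fin d → E} (hg : Orthonormal ℂ g) (P : E →L[ℂ] E)
    (hP : ∀ x, P x = ∑ j, inner ℂ (g j) x • g j) (M n m : ℕ) :
    hsNormSq (truncForm P M G n m) ≤ hsNormSq (G n m) := by
  rw [← coeffForm_formCoeff hG g P hP M]
  refine (hsNormSq_coeffForm_le hg _ n m).trans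
    (le_trans (ENNReal.ofReal_le_ofReal ?_) (ofReal_sum_norm_sq_le_hsNormSq (G n m) hg))
  refine Finset.sum_le_sum fun I _ => Finset.sum_le_sum fun K _ => ?_
  rw [formCoeff_pairCount hG]
  have hn : (n.factorial : ℂ) ≠ 0 := by exact_mod_cast n.factorial_ne_zero
  have hm : (m.factorial : ℂ) ≠ 0 := by exact_mod_cast m.factorial_ne_zero
  split_ifs
  · rw [mul_div_cancel_left₀ _ (mul_ne_zero hn hm)]
  · simp

end CoeffForm

/-! ### The square of the `L²` norm as an integral -/

theorem eLpNorm_two_sq {Ω : Type*} [MeasurableSpace Ω] {μ : Measure Ω} (f : Ω → ℂ) :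
    eLpNorm f 2 μ ^ 2 = ∫⁻ x, ‖f x‖ₑ ^ 2 ∂μ := by
  have h := eLpNorm_nnreal_pow_eq_lintegral (μ := μ) (f := f) (p := 2) (by norm_num)
  have h2 : ((2 : NNReal) : ℝ) = ((2 : ℕ) : ℝ) := by norm_num
  simp only [h2, ENNReal.rpow_natCast] at h
  exact h

theorem eLpNorm_two_sq_eq_ofReal {Ω : Type*} [MeasurableSpace Ω] {μ : Measure Ω} {f : Ω → ℂ}
    (hf : MemLp f 2 μ) : eLpNorm f 2 μ ^ 2 = ENNReal.ofReal (∫ x, conj (f x) * f x ∂μ).re := by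
  have h : ∀ x, conj (f x) * f x = ((‖f x‖ ^ 2 : ℝ) : ℂ) := by
    intro x
    rw [← Complex.normSq_eq_conj_mul_self, Complex.normSq_eq_norm_sq]
  have hi : Integrable (fun x => ‖f x‖ ^ 2) μ := hf.norm.integrable_sq
  simp only [h]
  rw [integral_complex_ofReal, Complex.ofReal_re, eLpNorm_two_sq,
    ofReal_integral_eq_lintegral_ofReal hi (Filter.Eventually.of_forall fun _ => sq_nonneg _)]
  refine lintegral_congr fun x => ?_
  rw [ENNReal.ofReal_pow (norm_nonneg _), ofReal_norm]

/-! ### Extension of multi-indices by a zero entry -/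

section Extend

variable {J : Type*}

/-- The extension by zero of a multi-index to one more element. -/
def extendIdx (A : J ⊕ J → ℕ) : Option J ⊕ Option J → ℕ :=
  Sum.elim (fun o => o.elim 0 fun j => A (.inl j)) (fun o => o.elim 0 fun j => A (.inr j))

theorem extendIdx_injective : Function.Injective (extendIdx (J := J)) := by
  intro A B h
  ext i
  rcases i with j | j
  · exact congrFun h (.inl (some j))
  · exact congrFun h (.inr (some j))

theorem idxCount_some_comp [DecidableEq J] {n : ℕ} (I : Fin n → J) :
    idxCount (some ∘ I) = fun o => o.elim 0 (idxCount I) := by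
  ext o
  rcases o with _ | j
  · simp [idxCount]
  · simp [idxCount]

theorem pairCount_some_comp [DecidableEq J] {n m : ℕ} (I : Fin n → J) (K : Fin m → J) :
    pairCount (some ∘ I) (some ∘ K) = extendIdx (pairCount I K) := by
  unfold pairCount
  rw [idxCount_some_comp, idxCount_some_comp]
  rfl

theorem multiFactorial_extendIdx [Fintype J] (A : J ⊕ J → ℕ) :
    multiFactorial (extendIdx A) = multiFactorial A := by
  simp [multiFactorial, extendIdx, Fintype.prod_sum_type, Fintype.prod_option]

theorem sum_option_comp [Fintype J] {R : Type*} [AddCommMonoid R] {n : ℕ}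
    (f : (Fin n → Option J) → R) (hf : ∀ I, (∃ i, I i = none) → f I = 0) :
    ∑ I, f I = ∑ I : Fin n → J, f (some ∘ I) := by
  symm
  refine Finset.sum_of_injOn (fun I => some ∘ I) ?_ (fun _ _ => Finset.mem_univ _) ?_ fun _ _ => rfl
  · intro I _ K _ h
    ext i
    exact Option.some_injective _ (congrFun h i)
  · intro I _ hI
    refine hf I ?_
    by_contra! h
    choose K hK using fun i => Option.ne_none_iff_exists'.1 (h i)
    exact hI ⟨K, Finset.mem_coe.2 (Finset.mem_univ _), funext fun i => (hK i).symm⟩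

theorem idxCount_pos [DecidableEq J] {n : ℕ} (I : Fin n → J) (i : Fin n) : 0 < idxCount I (I i) :=
  Finset.card_pos.2 ⟨i, by simp⟩

end Extend

namespace NFChain

variable {H : ℕ → Type*} [∀ p, NormedAddCommGroup (H p)]
  [∀ p, InnerProductSpace ℂ (H p)] [∀ p, CompleteSpace (H p)] {C : NFChain H} {β : Measure C.Dual}

/-! ### Finite chaos sums: their forms and their `L²` norms -/

section Sums

variable {J : Type*} [Fintype J] [DecidableEq J]

/-- Since `ρ` need not lie in the span of `g`, its component orthogonal in `H 0` is adjoined to the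
family under the index `none`. The Hermite product has degree zero in that variable, so by
orthogonality no term containing it survives. -/
theorem IsWhiteNoise.integral_conj_wick_mul_herm (hβ : C.IsWhiteNoise β) (g : J → C.N)
    (hg : ∀ i j, i ≠ j → inner ℂ ((g i).1 0) ((g j).1 0) = 0) (A : J ⊕ J → ℕ) (n m : ℕ) (ρ : C.N) :
    ∫ φ, conj (C.wick n m ρ φ) * C.herm g A φ ∂β
      = ∑ I : Fin n → J, ∑ K : Fin m → J, if pairCount I K = A then
        (∏ i, inner ℂ (ρ.1 0) ((g (I i)).1 0)) * (∏ i, inner ℂ ((g (K i)).1 0) (ρ.1 0))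
          * multiFactorial A else 0 := by
  have := hβ.prob
  -- If `g j` vanishes in `H 0`, the quotient is zero by convention and the identity `hcv` still
  -- holds.
  set c : J → ℂ := fun j => inner ℂ ((g j).1 0) (ρ.1 0) / ((‖(g j).1 0‖ ^ 2 : ℝ) : ℂ) with hc
  have hcv : ∀ j, c j * ((‖(g j).1 0‖ ^ 2 : ℝ) : ℂ) = inner ℂ ((g j).1 0) (ρ.1 0) := by
    intro j
    by_cases h0 : (g j).1 0 = 0
    · simp [h0]
    · refine div_mul_cancel₀ _ ?_
      have : ‖(g j).1 0‖ ≠ 0 := norm_ne_zero_iff.2 h0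
      exact_mod_cast pow_ne_zero 2 this
  set r : C.N := ρ - ∑ j, c j • g j with hr
  set g' : Option J → C.N := fun o => o.elim r g with hg'
  set c' : Option J → ℂ := fun o => o.elim 1 c with hc'
  have hρ : ρ = ∑ o, c' o • g' o := by
    rw [Fintype.sum_option]
    simp [hc', hg', hr]
  have hrg : ∀ j, inner ℂ ((g j).1 0) (r.1 0) = 0 := by
    intro j
    have h1 : r.1 0 = ρ.1 0 - ∑ k, c k • (g k).1 0 := by
      have : (∑ k, c k • g k : C.N).1 0 = ∑ k, (c k • g k).1 0 := coe_sum_apply _ _ _ _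
      rw [hr]
      change ρ.1 0 - (∑ k, c k • g k : C.N).1 0 = _
      rw [this]
      rfl
    rw [h1, inner_sub_right, inner_sum, Finset.sum_eq_single j]
    · rw [inner_smul_right, inner_self_eq_norm_sq_to_K, ← hcv j]
      simp
    · intro k _ hk
      rw [inner_smul_right, hg j k hk.symm, mul_zero]
    · simp
  have horth : ∀ i j, i ≠ j → inner ℂ ((g' i).1 0) ((g' j).1 0) = 0 := by
    rintro (_ | i) (_ | j) hij
    · exact absurd rfl hij
    · have := congrArg conj (hrg j)
      rwa [inner_conj_symm, map_zero] at this
    · exact hrg i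
    · exact hg i j fun h => hij (congrArg some h)
  have hherm : ∀ φ, C.herm g A φ = C.herm g' (extendIdx A) φ := by
    intro φ
    simp [herm, multiHerm, Fintype.prod_option, extendIdx, cHerm_zero_left, hg']
  have e : ∀ φ, conj (C.wick n m ρ φ) * C.herm g A φ
      = ∑ I : Fin n → Option J, ∑ K : Fin m → Option J,
        conj ((∏ i, c' (I i)) * ∏ i, conj (c' (K i)))
          * (conj (C.herm g' (pairCount I K) φ) * C.herm g' (extendIdx A) φ) := by
    intro φ
    rw [hherm]
    nth_rewrite 1 [hρ]
    rw [wick_sum g' horth, map_sum, Finset.sum_mul]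
    refine Finset.sum_congr rfl fun I _ => ?_
    rw [map_sum, Finset.sum_mul]
    refine Finset.sum_congr rfl fun K _ => ?_
    rw [map_mul]
    ring
  have hInt : ∀ (I : Fin n → Option J) (K : Fin m → Option J), Integrable (fun φ =>
      conj ((∏ i, c' (I i)) * ∏ i, conj (c' (K i)))
          * (conj (C.herm g' (pairCount I K) φ) * C.herm g' (extendIdx A) φ)) β := fun I K =>
    ((HasAllMoments.const _).mul ((hβ.hasAllMoments_herm g' _).conj.mul
      (hβ.hasAllMoments_herm g' _))).integrable
  simp only [e]
  rw [integral_finsetSum _ fun I _ => integrable_finsetSum _ fun K _ => hInt I K]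
  simp only [integral_finsetSum _ fun K _ => hInt _ K, integral_const_mul,
    hβ.integral_conj_herm_mul_herm g' horth]
  rw [sum_option_comp]
  · refine Finset.sum_congr rfl fun I _ => ?_
    rw [sum_option_comp]
    · refine Finset.sum_congr rfl fun K _ => ?_
      simp only [pairCount_some_comp, extendIdx_injective.eq_iff]
      split_ifs with hA
      · subst hA
        rw [multiFactorial_extendIdx, ← pairCount_some_comp, Fintype.prod_sum_type]
        simp only [pairCount, Sum.elim_inl, Sum.elim_inr]
        rw [← prod_comp_eq_prod_pow_idxCount (some ∘ I) fun o => ((‖(g' o).1 0‖ ^ 2 : ℝ) : ℂ),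
          ← prod_comp_eq_prod_pow_idxCount (some ∘ K) fun o => ((‖(g' o).1 0‖ ^ 2 : ℝ) : ℂ)]
        have h1 : ∀ j, inner ℂ (ρ.1 0) ((g j).1 0) = conj (c j) * ((‖(g j).1 0‖ ^ 2 : ℝ) : ℂ) := by
          intro j
          rw [← inner_conj_symm, ← hcv j, map_mul, Complex.conj_ofReal]
        simp only [h1, ← hcv, Finset.prod_mul_distrib, map_mul, map_prod, Complex.conj_conj, hg',
            hc',
          Function.comp_apply, Option.elim_some]
        ring
      · simp
    · rintro K ⟨i, hi⟩
      rw [if_neg, mul_zero]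
      intro h
      have h1 := idxCount_pos K i
      have h2 := congrFun h (.inr none)
      simp only [pairCount, Sum.elim_inr, extendIdx, Option.elim_none] at h2
      rw [hi] at h1
      omega
  · rintro I ⟨i, hi⟩
    refine Finset.sum_eq_zero fun K _ => ?_
    rw [if_neg, mul_zero]
    intro h
    have h1 := idxCount_pos I i
    have h2 := congrFun h (.inl none)
    simp only [pairCount, Sum.elim_inl, extendIdx, Option.elim_none] at h2
    rw [hi] at h1
    omega

/-- The sum of Hermite products of the variables `φ ↦ (g j)ₓφˣ` with coefficients `e A / A!`. -/
noncomputable def chaosSum (C : NFChain H) (g : J → C.N) (M : ℕ) (e : (J ⊕ J → ℕ) → ℂ)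
    (φ : C.Dual) : ℂ :=
  hermSum (fun j => ‖(g j).1 0‖ ^ 2) (fun j => C.pair φ (g j)) M e

theorem chaosSum_eq (g : J → C.N) (M : ℕ) (e : (J ⊕ J → ℕ) → ℂ) (φ : C.Dual) :
    C.chaosSum g M e φ = ∑ A ∈ box (J ⊕ J) M, e A / multiFactorial A * C.herm g A φ := rfl

theorem IsWhiteNoise.hasAllMoments_chaosSum (hβ : C.IsWhiteNoise β) (g : J → C.N) (M : ℕ)
    (e : (J ⊕ J → ℕ) → ℂ) : HasAllMoments (C.chaosSum g M e) β := by
  have := hβ.prob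
  exact HasAllMoments.hermSum (fun j => hβ.hasAllMoments_pair (g j)) _ M e

theorem inner_adjoint_incl (p : ℕ) (ρ σ : C.N) :
    inner ℂ (ContinuousLinearMap.adjoint (C.incl (Nat.zero_le p)) (ρ.1 0)) (σ.1 p)
      = inner ℂ (ρ.1 0) (σ.1 0) := by
  rw [ContinuousLinearMap.adjoint_inner_left, σ.2 0 p (Nat.zero_le p)]

theorem inner_adjoint_incl' (p : ℕ) (ρ σ : C.N) :
    inner ℂ (σ.1 p) (ContinuousLinearMap.adjoint (C.incl (Nat.zero_le p)) (ρ.1 0))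
      = inner ℂ (σ.1 0) (ρ.1 0) := by
  rw [ContinuousLinearMap.adjoint_inner_right, σ.2 0 p (Nat.zero_le p)]

/-- The adjoint of the inclusion turns scalar products in `H p` with `g j` into those in `H 0`,
which are the ones produced by integration against Wick monomials. -/
theorem IsWhiteNoise.isChaosExpansion_chaosSum (hβ : C.IsWhiteNoise β) (p : ℕ) (g : J → C.N)
    (hg : ∀ i j, i ≠ j → inner ℂ ((g i).1 0) ((g j).1 0) = 0) (M : ℕ) (e : (J ⊕ J → ℕ) → ℂ)
    (he : ∀ A, A ∉ box (J ⊕ J) M → e A = 0) :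
    C.IsChaosExpansion β p (C.chaosSum g M e) (coeffForm (fun j => (g j).1 p) e) where
  bosonic n m := isBosonicForm_coeffForm _ _ _ _
  coeff n m ρ := by
    have := hβ.prob
    have h1 : ∀ φ, conj (C.wick n m ρ φ) * C.chaosSum g M e φ
        = ∑ A ∈ box (J ⊕ J) M, e A / multiFactorial A * (conj (C.wick n m ρ φ) * C.herm g A φ) := by
      intro φ
      rw [chaosSum_eq, Finset.mul_sum]
      exact Finset.sum_congr rfl fun A _ => by ring
    simp only [h1]
    rw [integral_finsetSum _ fun A _ => ((HasAllMoments.const _).mul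
      ((hβ.hasAllMoments_wick n m ρ).conj.mul (hβ.hasAllMoments_herm g A))).integrable]
    simp only [integral_const_mul, hβ.integral_conj_wick_mul_herm g hg, coeffForm,
      inner_adjoint_incl, inner_adjoint_incl', Finset.mul_sum]
    rw [Finset.sum_comm]
    refine Finset.sum_congr rfl fun I _ => ?_
    rw [Finset.sum_comm]
    refine Finset.sum_congr rfl fun K _ => ?_
    have hn : (n.factorial : ℂ) ≠ 0 := by exact_mod_cast n.factorial_ne_zero
    have hm : (m.factorial : ℂ) ≠ 0 := by exact_mod_cast m.factorial_ne_zero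
    simp only [mul_ite, mul_zero]
    rw [Finset.sum_ite_eq]
    split_ifs with hA
    · have := multiFactorial_ne_zero (pairCount I K)
      field_simp
    · simp [he _ hA]

/-- Parseval: the Hermite products are orthogonal with squared norms `A! v ^ A`, and `v ≤ w`
entrywise. -/
theorem IsWhiteNoise.eLpNorm_chaosSum_sq_le (hβ : C.IsWhiteNoise β) (g : J → C.N)
    (hg : ∀ i j, i ≠ j → inner ℂ ((g i).1 0) ((g j).1 0) = 0) (M : ℕ) (e : (J ⊕ J → ℕ) → ℂ)
    {w : ℝ} (hw : ∀ j, ‖(g j).1 0‖ ^ 2 ≤ w) :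
    eLpNorm (C.chaosSum g M e) 2 β ^ 2 ≤ ENNReal.ofReal (coeffNormSq w M e) := by
  have := hβ.prob
  rw [eLpNorm_two_sq_eq_ofReal (hβ.hasAllMoments_chaosSum g M e 2 (by simp))]
  refine ENNReal.ofReal_le_ofReal ?_
  have h1 : ∀ φ, conj (C.chaosSum g M e φ) * C.chaosSum g M e φ
      = ∑ A ∈ box (J ⊕ J) M, ∑ B ∈ box (J ⊕ J) M,
        (conj (e A / multiFactorial A) * (e B / multiFactorial B))
          * (conj (C.herm g A φ) * C.herm g B φ) := by
    intro φ
    rw [chaosSum_eq, map_sum, Finset.sum_mul_sum]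
    refine Finset.sum_congr rfl fun A _ => Finset.sum_congr rfl fun B _ => ?_
    rw [map_mul]
    ring
  have hInt : ∀ A B : J ⊕ J → ℕ, Integrable (fun φ =>
      (conj (e A / multiFactorial A) * (e B / multiFactorial B))
          * (conj (C.herm g A φ) * C.herm g B φ)) β := fun A B =>
    ((HasAllMoments.const _).mul ((hβ.hasAllMoments_herm g _).conj.mul
      (hβ.hasAllMoments_herm g _))).integrable
  simp only [h1]
  rw [integral_finsetSum _ fun A _ => integrable_finsetSum _ fun B _ => hInt A B]
  simp only [integral_finsetSum _ fun B _ => hInt _ B, integral_const_mul,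
    hβ.integral_conj_herm_mul_herm g hg, mul_ite, mul_zero]
  rw [Complex.re_sum, coeffNormSq]
  refine Finset.sum_le_sum fun A hA => ?_
  rw [Finset.sum_ite_eq, if_pos hA]
  have h2 : conj (e A / multiFactorial A) * (e A / multiFactorial A) * ((multiFactorial A : ℂ)
      * ∏ i, ((Sum.elim (fun j => ‖(g j).1 0‖ ^ 2) (fun j => ‖(g j).1 0‖ ^ 2) i : ℝ) : ℂ) ^ A i)
      = ((‖e A‖ ^ 2 / multiFactorial A *
        ∏ i, (Sum.elim (fun j => ‖(g j).1 0‖ ^ 2) (fun j => ‖(g j).1 0‖ ^ 2) i) ^ A i : ℝ) : ℂ) :=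
            by
    rw [← Complex.normSq_eq_conj_mul_self, Complex.normSq_eq_norm_sq, norm_div,
      Complex.norm_natCast]
    have := multiFactorial_ne_zero A
    push_cast
    field_simp
  rw [h2, Complex.ofReal_re, ← Finset.prod_pow_eq_pow_sum]
  refine mul_le_mul_of_nonneg_left ?_ (by positivity)
  refine Finset.prod_le_prod (fun i _ => ?_) fun i _ => ?_
  · rcases i with i | i <;> simp only [Sum.elim_inl, Sum.elim_inr] <;> positivity
  · rcases i with i | i <;> simp only [Sum.elim_inl, Sum.elim_inr] <;>
      exact pow_le_pow_left₀ (by positivity) (hw i) _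

end Sums

end NFChain

/-! ### Weak convergence in `L²` -/

theorem tendsto_inner_of_total {E ι : Type*} [NormedAddCommGroup E] [InnerProductSpace ℂ E]
    {l : Filter ι} {D : Set E} (hD : (Submodule.span ℂ D).topologicalClosure = ⊤) {x : ι → E}
    {y : E} {R : ℝ} (hx : ∀ᶠ i in l, ‖x i‖ ≤ R)
    (h : ∀ d ∈ D, Filter.Tendsto (fun i => inner ℂ d (x i)) l (nhds (inner ℂ d y))) (w : E) :
    Filter.Tendsto (fun i => inner ℂ w (x i)) l (nhds (inner ℂ w y)) := by
  have hspan : ∀ d ∈ Submodule.span ℂ D,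
      Filter.Tendsto (fun i => inner ℂ d (x i)) l (nhds (inner ℂ d y)) := by
    intro d hd
    induction hd using Submodule.span_induction with
    | mem d hd => exact h d hd
    | zero => simpa using tendsto_const_nhds
    | add a b _ _ ha hb => simpa only [inner_add_left] using ha.add hb
    | smul c a _ ha => simpa only [inner_smul_left] using ha.const_mul _
  rw [Metric.tendsto_nhds]
  intro ε hε
  set T := |R| + ‖y‖ + 1 with hT
  have hTpos : 0 < T := by positivity
  have hw : w ∈ closure (Submodule.span ℂ D : Set E) := by
    rw [← Submodule.topologicalClosure_coe, hD]
    trivial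
  obtain ⟨d, hd, hwd⟩ := Metric.mem_closure_iff.1 hw (ε / (2 * T)) (by positivity)
  filter_upwards [hx, Metric.tendsto_nhds.1 (hspan d hd) (ε / 2) (by positivity)] with i hi hdi
  rw [dist_eq_norm] at hdi hwd ⊢
  have e : inner ℂ w (x i) - inner ℂ w y
      = inner ℂ (w - d) (x i - y) + (inner ℂ d (x i) - inner ℂ d y) := by
    rw [inner_sub_left, inner_sub_right, inner_sub_right]
    ring
  have h1 : ‖inner ℂ (w - d) (x i - y)‖ ≤ ε / (2 * T) * T := by
    refine (norm_inner_le_norm _ _).trans ?_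
    refine mul_le_mul hwd.le ?_ (norm_nonneg _) (by positivity)
    refine (norm_sub_le _ _).trans ?_
    have := hi.trans (le_abs_self R)
    linarith
  have h2 : ε / (2 * T) * T = ε / 2 := by field_simp
  rw [e]
  calc _ ≤ _ := norm_add_le _ _
    _ < ε / 2 + ε / 2 := by rw [h2] at h1; exact add_lt_add_of_le_of_lt h1 hdi
    _ = ε := by ring

section Weak

variable {Ω : Type*} [MeasurableSpace Ω] {μ : Measure Ω}

theorem inner_toLp {f g : Ω → ℂ} (hf : MemLp f 2 μ) (hg : MemLp g 2 μ) :
    inner ℂ (hf.toLp f) (hg.toLp g) = ∫ x, conj (f x) * g x ∂μ := by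
  rw [L2.inner_def]
  refine integral_congr_ae ?_
  filter_upwards [hf.coeFn_toLp, hg.coeFn_toLp] with x h1 h2
  rw [h1, h2, RCLike.inner_apply, mul_comm]

theorem enorm_integral_conj_mul_le {f g : Ω → ℂ} (hf : MemLp f 2 μ) (hg : MemLp g 2 μ) :
    ‖∫ x, conj (f x) * g x ∂μ‖ₑ ≤ eLpNorm f 2 μ * eLpNorm g 2 μ := by
  rw [← inner_toLp hf hg, ← Lp.enorm_toLp hf, ← Lp.enorm_toLp hg, ← ofReal_norm, ← ofReal_norm,
    ← ofReal_norm, ← ENNReal.ofReal_mul (norm_nonneg _)]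
  exact ENNReal.ofReal_le_ofReal (norm_inner_le_norm _ _)

theorem tendsto_integral_conj_mul_of_total {ι : Type*} {l : Filter ι} {D : Set (Ω → ℂ)}
    (hD : ∀ d ∈ D, MemLp d 2 μ)
    (htot : ∀ f : Ω → ℂ, MemLp f 2 μ → (∀ d ∈ D, ∫ x, conj (d x) * f x ∂μ = 0) → f =ᵐ[μ] 0)
    {F : ι → Ω → ℂ} {f : Ω → ℂ} (hF : ∀ i, MemLp (F i) 2 μ) (hf : MemLp f 2 μ) {R : ℝ≥0∞}
    (hR : R ≠ ∞) (hFR : ∀ᶠ i in l, eLpNorm (F i) 2 μ ≤ R)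
    (h : ∀ d ∈ D, Filter.Tendsto (fun i => ∫ x, conj (d x) * F i x ∂μ) l
      (nhds (∫ x, conj (d x) * f x ∂μ))) {w : Ω → ℂ} (hw : MemLp w 2 μ) :
    Filter.Tendsto (fun i => ∫ x, conj (w x) * F i x ∂μ) l (nhds (∫ x, conj (w x) * f x ∂μ)) := by
  set D' : Set (Lp ℂ 2 μ) := {d | ∃ d₀ ∈ D, ∃ h : MemLp d₀ 2 μ, d = h.toLp d₀} with hD'
  have htop : (Submodule.span ℂ D').topologicalClosure = ⊤ := by
    rw [Submodule.topologicalClosure_eq_top_iff, Submodule.eq_bot_iff]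
    intro g hg
    have h1 := htot g (Lp.memLp g) fun d hd => by
      have h2 := Submodule.inner_right_of_mem_orthogonal
        (Submodule.subset_span (R := ℂ) (s := D') ⟨d, hd, hD d hd, rfl⟩) hg
      have h3 := inner_toLp (hD d hd) (Lp.memLp g)
      rw [Lp.toLp_coeFn] at h3
      rw [← h3, h2]
    exact (Lp.eq_zero_iff_ae_eq_zero).2 h1
  have key := tendsto_inner_of_total (l := l) htop (x := fun i => (hF i).toLp (F i))
    (y := hf.toLp f) (R := R.toReal) (by
      filter_upwards [hFR] with i hi
      rw [Lp.norm_toLp]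
      exact ENNReal.toReal_mono hR hi) (by
      rintro _ ⟨d, hd, hd2, rfl⟩
      simp only [inner_toLp]
      exact h d hd) (hw.toLp w)
  simpa only [inner_toLp] using key

theorem ae_eq_zero_of_integral_bounded [IsFiniteMeasure μ] {f : Ω → ℂ} (hf : MemLp f 2 μ)
    (h : ∀ d : Ω → ℂ, AEStronglyMeasurable d μ → (∃ c, ∀ x, ‖d x‖ ≤ c) →
      ∫ x, conj (d x) * f x ∂μ = 0) : f =ᵐ[μ] 0 := by
  have hi : Integrable f μ := hf.integrable (by norm_num)
  refine hi.ae_eq_zero_of_forall_setIntegral_eq_zero fun s hs _ => ?_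
  have h1 := h (s.indicator fun _ => 1) (aestronglyMeasurable_const.indicator hs)
    ⟨1, fun x => by by_cases hx : x ∈ s <;> simp [hx]⟩
  rw [← h1, ← integral_indicator hs]
  congr 1
  ext x
  by_cases hx : x ∈ s <;> simp [hx]

/-- The limit is not assumed to be in `L²`, so it is tested against its own truncations `d k` to
`‖f‖ ≤ k`. Then `‖d k‖² = ∫ conj (d k) f ≤ ‖d k‖ R`, and Fatou's lemma removes the truncation. -/
theorem eLpNorm_le_of_tendsto_integral [IsFiniteMeasure μ] {ι : Type*} {l : Filter ι} [l.NeBot]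
    {F : ι → Ω → ℂ} {f : Ω → ℂ} (hF : ∀ i, MemLp (F i) 2 μ) (hf : AEStronglyMeasurable f μ)
    {R : ℝ≥0∞} (hFR : ∀ᶠ i in l, eLpNorm (F i) 2 μ ≤ R)
    (h : ∀ d : Ω → ℂ, AEStronglyMeasurable d μ → (∃ c, ∀ x, ‖d x‖ ≤ c) →
      Filter.Tendsto (fun i => ∫ x, conj (d x) * F i x ∂μ) l (nhds (∫ x, conj (d x) * f x ∂μ))) :
    eLpNorm f 2 μ ≤ R := by
  set f' := hf.mk f with hf'
  have hae : f =ᵐ[μ] f' := hf.ae_eq_mk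
  have hmeas : StronglyMeasurable f' := hf.stronglyMeasurable_mk
  set S : ℕ → Set Ω := fun k => {x | ‖f' x‖ ≤ k} with hS
  have hSm : ∀ k, MeasurableSet (S k) := fun k =>
    measurableSet_le hmeas.norm.measurable measurable_const
  set d : ℕ → Ω → ℂ := fun k => (S k).indicator f' with hd
  have hdm : ∀ k, AEStronglyMeasurable (d k) μ := fun k =>
    (hmeas.indicator (hSm k)).aestronglyMeasurable
  have hdb : ∀ k, ∀ x, ‖d k x‖ ≤ k := by
    intro k x
    by_cases hx : x ∈ S k
    · rw [hd]
      simp only [Set.indicator_of_mem hx]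
      exact hx
    · simp [hd, hx]
  have hdL : ∀ k, MemLp (d k) 2 μ := fun k =>
    MemLp.of_bound (hdm k) k (Filter.Eventually.of_forall (hdb k))
  have hle : ∀ k, eLpNorm (d k) 2 μ ≤ R := by
    intro k
    have h1 : ∫ x, conj (d k x) * f x ∂μ = ∫ x, conj (d k x) * d k x ∂μ := by
      refine integral_congr_ae ?_
      filter_upwards [hae] with x hx
      by_cases hxS : x ∈ S k
      · simp [hd, hxS, hx]
      · simp [hd, hxS]
    have h2 : eLpNorm (d k) 2 μ ^ 2 ≤ ‖∫ x, conj (d k x) * f x ∂μ‖ₑ := by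
      rw [eLpNorm_two_sq_eq_ofReal (hdL k), h1, ← ofReal_norm]
      exact ENNReal.ofReal_le_ofReal (Complex.re_le_norm _)
    have h3 : ‖∫ x, conj (d k x) * f x ∂μ‖ₑ ≤ eLpNorm (d k) 2 μ * R := by
      refine le_of_tendsto (h (d k) (hdm k) ⟨k, hdb k⟩).enorm ?_
      filter_upwards [hFR] with i hi
      exact (enorm_integral_conj_mul_le (hdL k) (hF i)).trans (by gcongr)
    have h4 := h2.trans h3
    rcases eq_or_ne (eLpNorm (d k) 2 μ) 0 with h0 | h0
    · rw [h0]; exact zero_le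
    · rw [sq] at h4
      exact (ENNReal.mul_le_mul_iff_right h0 (hdL k).2.ne).1 h4
  rw [eLpNorm_congr_ae hae]
  refine (Lp.eLpNorm_lim_le_liminf_eLpNorm hdm f' (Filter.Eventually.of_forall fun x => ?_)).trans
      ?_
  · refine tendsto_const_nhds.congr' ?_
    obtain ⟨k, hk⟩ := exists_nat_ge ‖f' x‖
    filter_upwards [Filter.eventually_ge_atTop k] with j hj
    have : x ∈ S j := hk.trans (by exact_mod_cast hj)
    simp [hd, this]
  · refine Filter.liminf_le_of_le (by isBoundedDefault) fun b hb => ?_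
    obtain ⟨k, hk⟩ := hb.exists
    exact hk.trans (hle k)

end Weak

/-! ### Limits of bosonic forms -/

section Limit

variable {E : Type*} [NormedAddCommGroup E] [InnerProductSpace ℂ E]

theorem weight_mul_hsNormSq_le_fockSum (q : ℝ) (G : ∀ n m : ℕ, (Fin n → E) → (Fin m → E) → ℂ)
    (n m : ℕ) : ENNReal.ofReal ((n.factorial : ℝ) * (m.factorial : ℝ)
      * (2 : ℝ) ^ (q * ((n : ℝ) + (m : ℝ)))) * hsNormSq (G n m) ≤ fockSum q G :=
  (ENNReal.le_tsum m).trans (ENNReal.le_tsum (f := fun n : ℕ => ∑' m : ℕ,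
    ENNReal.ofReal ((n.factorial : ℝ) * (m.factorial : ℝ) * (2 : ℝ) ^ (q * ((n : ℝ) + (m : ℝ))))
      * hsNormSq (G n m)) n)

theorem IsBosonicForm.of_tendsto {ι : Type*} {l : Filter ι} [l.NeBot] {n m : ℕ}
    {L : ι → (Fin n → E) → (Fin m → E) → ℂ} (hL : ∀ᶠ i in l, IsBosonicForm (L i))
    {L' : (Fin n → E) → (Fin m → E) → ℂ}
    (h : ∀ u v, Filter.Tendsto (fun i => L i u v) l (nhds (L' u v))) : IsBosonicForm L' where
  add_left u v i x y := tendsto_nhds_unique_of_eventuallyEq (h _ _) ((h _ _).add (h _ _))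
    (hL.mono fun _ hk => hk.add_left u v i x y)
  smul_left u v i c x := tendsto_nhds_unique_of_eventuallyEq (h _ _) ((h _ _).const_mul _)
    (hL.mono fun _ hk => hk.smul_left u v i c x)
  add_right u v i x y := tendsto_nhds_unique_of_eventuallyEq (h _ _) ((h _ _).add (h _ _))
    (hL.mono fun _ hk => hk.add_right u v i x y)
  smul_right u v i c x := tendsto_nhds_unique_of_eventuallyEq (h _ _) ((h _ _).const_mul _)
    (hL.mono fun _ hk => hk.smul_right u v i c x)
  symm_left σ u v := tendsto_nhds_unique_of_eventuallyEq (h _ _) (h _ _)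
    (hL.mono fun _ hk => hk.symm_left σ u v)
  symm_right σ u v := tendsto_nhds_unique_of_eventuallyEq (h _ _) (h _ _)
    (hL.mono fun _ hk => hk.symm_right σ u v)

theorem hsNormSq_le_of_tendsto {ι : Type*} {l : Filter ι} [l.NeBot] {n m : ℕ}
    {L : ι → (Fin n → E) → (Fin m → E) → ℂ} {L' : (Fin n → E) → (Fin m → E) → ℂ}
    (h : ∀ u v, Filter.Tendsto (fun i => L i u v) l (nhds (L' u v))) {c : ℝ≥0∞}
    (hc : Filter.Tendsto (fun i => hsNormSq (L i)) l (nhds c)) : hsNormSq L' ≤ c := by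
  refine iSup_le fun d => iSup_le fun e => iSup_le fun he => ?_
  refine le_of_tendsto_of_tendsto' (tendsto_finsetSum _ fun I _ => tendsto_finsetSum _ fun K _ =>
    ?_) hc fun i => sum_enorm_sq_le_hsNormSq (L i) he
  exact ((ENNReal.continuous_pow 2).tendsto _).comp (h _ _).enorm

/-- Bounded sets of families of bosonic forms are weakly compact. -/
theorem exists_limit_forms {ι : Type*} (U : Ultrafilter ι)
    {L : ι → ∀ n m : ℕ, (Fin n → E) → (Fin m → E) → ℂ}
    (hL : ∀ᶠ i in (U : Filter ι), ∀ n m, IsBosonicForm (L i n m)) {B : ℝ → ℝ≥0∞}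
    (hB : ∀ q, ∀ᶠ i in (U : Filter ι), fockSum q (L i) ≤ B q) {q₀ : ℝ} (hq₀ : B q₀ ≠ ∞) :
    ∃ L' : ∀ n m : ℕ, (Fin n → E) → (Fin m → E) → ℂ, (∀ n m, IsBosonicForm (L' n m)) ∧
      (∀ n m u v, Filter.Tendsto (fun i => L i n m u v) U (nhds (L' n m u v))) ∧
      ∀ q, fockSum q L' ≤ B q := by
  -- A finite bound for the single exponent `q₀` confines each value to a compact disc, where an
  -- ultrafilter converges.
  have hlim : ∀ n m u v, ∃ z, Filter.Tendsto (fun i => L i n m u v) U (nhds z) := by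
    intro n m u v
    set w := ENNReal.ofReal ((n.factorial : ℝ) * (m.factorial : ℝ)
      * (2 : ℝ) ^ (q₀ * ((n : ℝ) + (m : ℝ)))) with hw
    have hw0 : w ≠ 0 := by
      have : 0 < (n.factorial : ℝ) * (m.factorial : ℝ) * (2 : ℝ) ^ (q₀ * ((n : ℝ) + (m : ℝ))) := by
        positivity
      simpa [hw] using this
    set R := (B q₀ / w).toReal * ((∏ i, ‖u i‖ ^ 2) * ∏ i, ‖v i‖ ^ 2) with hR
    have hmem : ∀ᶠ i in (U : Filter ι), L i n m u v ∈ Metric.closedBall (0 : ℂ) (Real.sqrt R) := by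
      filter_upwards [hL, hB q₀] with i h1 h2
      have h3 : hsNormSq (L i n m) ≤ B q₀ / w := by
        rw [ENNReal.le_div_iff_mul_le (Or.inl hw0) (Or.inl ENNReal.ofReal_ne_top), mul_comm]
        exact (weight_mul_hsNormSq_le_fockSum q₀ (L i) n m).trans h2
      have h4 : B q₀ / w ≠ ∞ := ENNReal.div_ne_top hq₀ hw0
      rw [mem_closedBall_zero_iff]
      refine Real.le_sqrt_of_sq_le (((h1 n m).norm_sq_le (ne_top_of_le_ne_top h4 h3) u v).trans ?_)
      exact mul_le_mul_of_nonneg_right (ENNReal.toReal_mono h4 h3) (by positivity)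
    obtain ⟨z, -, hz⟩ := (isCompact_closedBall (0 : ℂ) (Real.sqrt R)).ultrafilter_le_nhds
      (U.map fun i => L i n m u v) (by
        rw [Filter.le_principal_iff]
        exact hmem)
    exact ⟨z, hz⟩
  choose L' hL' using hlim
  refine ⟨L', fun n m => IsBosonicForm.of_tendsto (hL.mono fun i h => h n m) (hL' n m), hL',
    fun q => ?_⟩
  -- The norms converge along `U` because `[0, ∞]` is compact. Limits then commute with finite
  -- partial sums, which gives lower semicontinuity for every `q` with the same limit forms.
  have hhs : ∀ n m, ∃ c, Filter.Tendsto (fun i => hsNormSq (L i n m)) U (nhds c) := fun n m =>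
    ⟨_, (U.map fun i => hsNormSq (L i n m)).le_nhds_lim⟩
  choose c hc using hhs
  have h1 : fockSum q L' ≤ ∑' P : ℕ × ℕ, ENNReal.ofReal ((P.1.factorial : ℝ) * (P.2.factorial : ℝ)
      * (2 : ℝ) ^ (q * ((P.1 : ℝ) + (P.2 : ℝ)))) * c P.1 P.2 := by
    rw [ENNReal.tsum_prod (f := fun n m : ℕ => ENNReal.ofReal ((n.factorial : ℝ) * (m.factorial : ℝ)
      * (2 : ℝ) ^ (q * ((n : ℝ) + (m : ℝ)))) * c n m)]
    refine ENNReal.tsum_le_tsum fun n => ENNReal.tsum_le_tsum fun m => ?_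
    gcongr
    exact hsNormSq_le_of_tendsto (hL' n m) (hc n m)
  refine h1.trans ?_
  rw [ENNReal.tsum_eq_iSup_sum]
  refine iSup_le fun s => ?_
  refine le_of_tendsto (tendsto_finsetSum s fun P _ => ENNReal.Tendsto.const_mul (hc P.1 P.2)
    (Or.inr ENNReal.ofReal_ne_top)) ?_
  filter_upwards [hB q] with i hi
  refine le_trans (ENNReal.sum_le_tsum s) (le_trans (le_of_eq ?_) hi)
  exact ENNReal.tsum_prod (f := fun n m : ℕ => ENNReal.ofReal ((n.factorial : ℝ) * (m.factorial : ℝ)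
      * (2 : ℝ) ^ (q * ((n : ℝ) + (m : ℝ)))) * hsNormSq (L i n m))

end Limit

namespace NFChain

variable {H : ℕ → Type*} [∀ p, NormedAddCommGroup (H p)]
  [∀ p, InnerProductSpace ℂ (H p)] [∀ p, CompleteSpace (H p)] {C : NFChain H} {β : Measure C.Dual}

/-- Both sides of the coefficient identity converge along an ultrafilter finer than `l`: the
integrals by hypothesis, the forms by compactness. -/
theorem exists_isChaosExpansion_of_tendsto {ι : Type*} {l : Filter ι} [l.NeBot] {p : ℕ}
    {F : ι → C.Dual → ℂ} {f : C.Dual → ℂ} {B : ℝ → ℝ≥0∞} {q₀ : ℝ} (hq₀ : B q₀ ≠ ∞)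
    (h : ∀ᶠ i in l, ∃ L, C.IsChaosExpansion β p (F i) L ∧ ∀ q, fockSum q L ≤ B q)
    (hlim : ∀ n m ρ, Filter.Tendsto (fun i => ∫ φ, conj (C.wick n m ρ φ) * F i φ ∂β) l
      (nhds (∫ φ, conj (C.wick n m ρ φ) * f φ ∂β))) :
    ∃ L, C.IsChaosExpansion β p f L ∧ ∀ q, fockSum q L ≤ B q := by
  obtain ⟨L, hL⟩ := h.choice
  set U := Ultrafilter.of l
  have hU : (U : Filter ι) ≤ l := Ultrafilter.of_le l
  have hLU := hU hL
  obtain ⟨L', h1, h2, h3⟩ := exists_limit_forms U (L := L)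
    (Filter.Eventually.mono hLU fun i hi => hi.1.bosonic)
    (fun q => Filter.Eventually.mono hLU fun i hi => hi.2 q) hq₀
  refine ⟨L', ⟨h1, fun n m ρ => ?_⟩, h3⟩
  refine tendsto_nhds_unique_of_eventuallyEq ((hlim n m ρ).mono_left hU)
    ((h2 n m _ _).const_mul _) ?_
  filter_upwards [hLU] with i hi
  exact hi.1.coeff n m ρ

/-! ### Finite-dimensional subspaces -/

/-- The subspace of `H p` spanned by a finite set of elements of `N`. -/
def spanAt (C : NFChain H) (p : ℕ) (s : Finset C.N) : Submodule ℂ (H p) :=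
  Submodule.span ℂ ((fun ρ : C.N => ρ.1 p) '' s)

instance (p : ℕ) (s : Finset C.N) : FiniteDimensional ℂ (C.spanAt p s) :=
  FiniteDimensional.span_of_finite ℂ (s.finite_toSet.image _)

theorem spanAt_mono (p : ℕ) : Monotone (C.spanAt p) := fun _ _ h =>
  Submodule.span_mono (Set.image_mono (Finset.coe_subset.2 h))

theorem tendsto_starProjection_spanAt (p : ℕ) (x : H p) :
    Filter.Tendsto (fun s => (C.spanAt p s).starProjection x) Filter.atTop (nhds x) := by
  refine Submodule.starProjection_tendsto_self _ (spanAt_mono p) x ?_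
  rintro y -
  refine closure_mono ?_ (C.dense p y)
  rintro _ ⟨z, hz, rfl⟩
  have : z p ∈ C.spanAt p {⟨z, fun r s h => hz r s h⟩} :=
    Submodule.subset_span ⟨⟨z, fun r s h => hz r s h⟩, by simp, rfl⟩
  exact Submodule.mem_iSup_of_mem _ this

/-- A finite-dimensional subspace has a basis in `N` which is orthonormal in `H p` and orthogonal
in `H 0`. -/
theorem exists_diagonal_family (C : NFChain H) (p : ℕ) (s : Finset C.N) :
    ∃ (d : ℕ) (g : Fin d → C.N), Orthonormal ℂ (fun j => (g j).1 p) ∧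
      (∀ i j, i ≠ j → inner ℂ ((g i).1 0) ((g j).1 0) = 0) ∧
      ∀ x, (C.spanAt p s).starProjection x = ∑ j, inner ℂ ((g j).1 p) x • (g j).1 p := by
  set W := C.spanAt p s with hW
  -- An orthonormal eigenbasis of `T^* T` is orthogonal in `H 0`, since `⟨T b, T b'⟩ = ⟨b, T^* T
  -- b'⟩` is a multiple of `⟨b, b'⟩`.
  set T : W →L[ℂ] H 0 := (C.incl (Nat.zero_le p)).comp W.subtypeL with hT
  have hsymm : ((ContinuousLinearMap.adjoint T ∘L T : W →L[ℂ] W) : W →ₗ[ℂ] W).IsSymmetric := by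
    intro x y
    simp only [ContinuousLinearMap.coe_coe, ContinuousLinearMap.comp_apply]
    rw [ContinuousLinearMap.adjoint_inner_left, ContinuousLinearMap.adjoint_inner_right]
  set b := hsymm.eigenvectorBasis rfl with hb
  have hspan : ∀ x ∈ W, ∃ ρ : C.N, ρ.1 p = x := by
    intro x hx
    induction hx using Submodule.span_induction with
    | mem x hx => obtain ⟨ρ, -, rfl⟩ := hx; exact ⟨ρ, rfl⟩
    | zero => exact ⟨0, rfl⟩
    | add x y _ _ h1 h2 =>
      obtain ⟨ρ, rfl⟩ := h1
      obtain ⟨σ, rfl⟩ := h2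
      exact ⟨ρ + σ, rfl⟩
    | smul c x _ h1 =>
      obtain ⟨ρ, rfl⟩ := h1
      exact ⟨c • ρ, rfl⟩
  choose g hg using fun j => hspan (b j) (b j).2
  refine ⟨_, g, ?_, ?_, ?_⟩
  · simp only [hg]
    exact b.orthonormal.comp_linearIsometry W.subtypeₗᵢ
  · intro i j hij
    have h1 : ∀ k, (g k).1 0 = T (b k) := by
      intro k
      rw [← (g k).2 0 p (Nat.zero_le p), hg]
      rfl
    rw [h1, h1, ← ContinuousLinearMap.adjoint_inner_right]
    have h2 := hsymm.apply_eigenvectorBasis rfl j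
    simp only [ContinuousLinearMap.coe_coe, ContinuousLinearMap.comp_apply] at h2
    rw [hb, h2, inner_smul_right, ← hb, b.orthonormal.2 hij, mul_zero]
  · intro x
    simp only [hg]
    rw [Submodule.starProjection_apply, b.orthogonalProjectionOnto_apply_eq_sum, Submodule.coe_sum]
    rfl

end NFChain

/-! ### The product estimate for finite sums -/

/-- The exponents for which the product estimate holds. -/
def IsAdmissible (K q a b : ℝ) : Prop :=
  (2 : ℝ) ^ (-(a + b) / 2) * K ^ 2 + (2 : ℝ) ^ (q - a) + (2 : ℝ) ^ (q - b) < 1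

theorem IsAdmissible.le_left {K q a b : ℝ} (h : IsAdmissible K q a b) : q ≤ a := by
  unfold IsAdmissible at h
  have h1 : 0 ≤ (2 : ℝ) ^ (-(a + b) / 2) * K ^ 2 := by positivity
  have h2 : 0 < (2 : ℝ) ^ (q - b) := by positivity
  have h3 : (2 : ℝ) ^ (q - a) < (2 : ℝ) ^ (0 : ℝ) := by rw [Real.rpow_zero]; linarith
  have := (Real.rpow_lt_rpow_left_iff (by norm_num : (1 : ℝ) < 2)).1 h3
  linarith

theorem IsAdmissible.symm {K q a b : ℝ} (h : IsAdmissible K q a b) : IsAdmissible K q b a := by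
  unfold IsAdmissible at h ⊢
  rw [add_comm b a]
  linarith

theorem coeffNormSq_mulCoeff_le {J : Type*} [Fintype J] [DecidableEq J] {v : J → ℝ} {K q a b : ℝ}
    (hv0 : ∀ j, 0 ≤ v j) (hv : ∀ j, v j ≤ K ^ 2) (h : IsAdmissible K q a b) (M : ℕ)
    (c d : (J ⊕ J → ℕ) → ℂ) (hc : ∀ A, A ∉ box (J ⊕ J) M → c A = 0)
    (hd : ∀ A, A ∉ box (J ⊕ J) M → d A = 0) :
    coeffNormSq ((2 : ℝ) ^ q) (2 * M) (mulCoeff v M c d)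
      ≤ coeffNormSq ((2 : ℝ) ^ a) M c * coeffNormSq ((2 : ℝ) ^ b) M d := by
  unfold IsAdmissible at h
  set κ := (2 : ℝ) ^ (-(a + b) / 2) * K ^ 2 with hκ
  set X := (2 : ℝ) ^ (q - a) with hX
  set Y := (2 : ℝ) ^ (q - b) with hY
  have hκ0 : 0 ≤ κ := by positivity
  have hX0 : 0 < X := by positivity
  have hY0 : 0 < Y := by positivity
  have hXa : (2 : ℝ) ^ q = (2 : ℝ) ^ a * X := by
    rw [hX, ← Real.rpow_add (by norm_num)]; ring_nf
  have hYb : (2 : ℝ) ^ q = (2 : ℝ) ^ b * Y := by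
    rw [hY, ← Real.rpow_add (by norm_num)]; ring_nf
  have ha0 : (0 : ℝ) < 2 ^ a := by positivity
  have hb0 : (0 : ℝ) < 2 ^ b := by positivity
  have hkl : (2 : ℝ) ^ a * κ * ((2 : ℝ) ^ b * κ) = (K ^ 2) ^ 2 := by
    have h1 : (2 : ℝ) ^ a * (2 : ℝ) ^ b * ((2 : ℝ) ^ (-(a + b) / 2) * (2 : ℝ) ^ (-(a + b) / 2)) = 1
        := by
      rw [← Real.rpow_add (by norm_num), ← Real.rpow_add (by norm_num),
        ← Real.rpow_add (by norm_num)]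
      ring_nf
      exact Real.rpow_zero 2
    calc _ = (2 : ℝ) ^ a * (2 : ℝ) ^ b * ((2 : ℝ) ^ (-(a + b) / 2) * (2 : ℝ) ^ (-(a + b) / 2))
          * (K ^ 2) ^ 2 := by rw [hκ]; ring
      _ = _ := by rw [h1, one_mul]
  -- With `x` and `y` proportional to `X` and `Y`, `2^q / x = 2^a (X + Y)` and `2^q / y = 2^b (X +
  -- Y)`. The choice of `k` and `l` gives `k l = K⁴`, and both remaining conditions become `X + Y +
  -- κ ≤ 1`.
  refine sum_norm_mulCoeff_sq_le v M c d hc hd (x := X / (X + Y)) (y := Y / (X + Y))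
    (k := (2 : ℝ) ^ a * κ) (l := (2 : ℝ) ^ b * κ) (by positivity) (by positivity) (by positivity)
    (by rw [← add_div]; exact (div_self (by positivity)).le) (by positivity) (by positivity)
    (fun j => ?_) ?_ ?_
  · rw [hkl]
    exact pow_le_pow_left₀ (hv0 j) (hv j) 2
  · have e : (2 : ℝ) ^ q / (X / (X + Y)) = (2 : ℝ) ^ a * (X + Y) := by
      rw [hXa]; field_simp
    rw [e]
    nlinarith
  · have e : (2 : ℝ) ^ q / (Y / (X + Y)) = (2 : ℝ) ^ b * (X + Y) := by
      rw [hYb]; field_simp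
    rw [e]
    nlinarith

theorem ENNReal.le_rpow_half_of_sq_le {x R : ℝ≥0∞} (h : x ^ 2 ≤ R) : x ≤ R ^ (1 / 2 : ℝ) := by
  have := ENNReal.rpow_le_rpow h (by norm_num : (0 : ℝ) ≤ 1 / 2)
  rwa [← ENNReal.rpow_natCast, ← ENNReal.rpow_mul, show ((2 : ℕ) : ℝ) * (1 / 2) = 1 by norm_num,
    ENNReal.rpow_one] at this

namespace NFChain

variable {H : ℕ → Type*} [∀ p, NormedAddCommGroup (H p)]
  [∀ p, InnerProductSpace ℂ (H p)] [∀ p, CompleteSpace (H p)] {C : NFChain H} {β : Measure C.Dual}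

theorem IsChaosExpansion.congr_ae {p : ℕ} {Ψ Φ : C.Dual → ℂ}
    {G : ∀ n m : ℕ, (Fin n → H p) → (Fin m → H p) → ℂ} (hG : C.IsChaosExpansion β p Ψ G)
    (h : Ψ =ᵐ[β] Φ) : C.IsChaosExpansion β p Φ G where
  bosonic := hG.bosonic
  coeff n m ρ := by
    rw [← hG.coeff n m ρ]
    refine integral_congr_ae ?_
    filter_upwards [h] with φ hφ
    rw [hφ]

theorem IsWhiteNoise.integrable_conj_wick_mul (hβ : C.IsWhiteNoise β) {Ψ : C.Dual → ℂ}
    (hΨ : MemLp Ψ 2 β) (n m : ℕ) (ρ : C.N) :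
    Integrable (fun φ => conj (C.wick n m ρ φ) * Ψ φ) β :=
  ((hβ.hasAllMoments_wick n m ρ).conj 2 (by simp)).integrable_mul hΨ

theorem IsWhiteNoise.ae_eq_of_isChaosExpansion (hβ : C.IsWhiteNoise β) {p : ℕ} {Ψ Φ : C.Dual → ℂ}
    (hΨ : MemLp Ψ 2 β) (hΦ : MemLp Φ 2 β)
    {G : ∀ n m : ℕ, (Fin n → H p) → (Fin m → H p) → ℂ} (hG : C.IsChaosExpansion β p Ψ G)
    (hG' : C.IsChaosExpansion β p Φ G) : Ψ =ᵐ[β] Φ := by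
  have := hβ.ae_eq_zero_of_wick (hΨ.sub hΦ) fun n m ρ => by
    simp only [Pi.sub_apply, mul_sub]
    rw [integral_sub (hβ.integrable_conj_wick_mul hΨ n m ρ) (hβ.integrable_conj_wick_mul hΦ n m ρ),
        hG.coeff, hG'.coeff, sub_self]
  filter_upwards [this] with φ hφ
  exact sub_eq_zero.1 hφ

section Finite

variable {p : ℕ} {d : ℕ} {g : Fin d → C.N}

theorem EmbeddingBound.norm_sq_le {K : ℝ} (hK : C.EmbeddingBound p K)
    (hg : Orthonormal ℂ (fun j => (g j).1 p)) (j : Fin d) : ‖(g j).1 0‖ ^ 2 ≤ K ^ 2 := by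
  have h := hK (g j)
  rw [hg.1 j, mul_one] at h
  exact pow_le_pow_left₀ (norm_nonneg _) h 2

theorem EmbeddingBound.norm_sq_le_rpow {q : ℝ} (hK : C.EmbeddingBound p ((2 : ℝ) ^ (q / 2)))
    (hg : Orthonormal ℂ (fun j => (g j).1 p)) (j : Fin d) : ‖(g j).1 0‖ ^ 2 ≤ (2 : ℝ) ^ q := by
  refine (hK.norm_sq_le hg j).trans (le_of_eq ?_)
  rw [← Real.rpow_natCast, ← Real.rpow_mul (by norm_num)]
  congr 1
  push_cast
  ring

/-- The product estimate for finite chaos sums. -/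
theorem IsWhiteNoise.chaosSum_mul_chaosSum (hβ : C.IsWhiteNoise β) {K : ℝ}
    (hK : C.EmbeddingBound p K) (hg : Orthonormal ℂ (fun j => (g j).1 p))
    (hg0 : ∀ i j, i ≠ j → inner ℂ ((g i).1 0) ((g j).1 0) = 0)
    {G G' : ∀ n m : ℕ, (Fin n → H p) → (Fin m → H p) → ℂ} (hG : ∀ n m, IsBosonicForm (G n m))
    (hG' : ∀ n m, IsBosonicForm (G' n m)) (M : ℕ) :
    (∃ L, C.IsChaosExpansion β p (fun φ =>
        C.chaosSum g M (formCoeff G (fun j => (g j).1 p) M) φ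
          * C.chaosSum g M (formCoeff G' (fun j => (g j).1 p) M) φ) L ∧
      ∀ q a b, IsAdmissible K q a b → fockSum q L ≤ fockSum a G * fockSum b G') ∧
    ∀ q a b, IsAdmissible K q a b → C.EmbeddingBound p ((2 : ℝ) ^ (q / 2)) →
      eLpNorm (fun φ => C.chaosSum g M (formCoeff G (fun j => (g j).1 p) M) φ
          * C.chaosSum g M (formCoeff G' (fun j => (g j).1 p) M) φ) 2 β ^ 2
        ≤ fockSum a G * fockSum b G' := by
  set c := formCoeff G (fun j => (g j).1 p) M with hc
  set c' := formCoeff G' (fun j => (g j).1 p) M with hc'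
  have hc0 := formCoeff_eq_zero G (fun j => (g j).1 p) M
  have hc0' := formCoeff_eq_zero G' (fun j => (g j).1 p) M
  set v : Fin d → ℝ := fun j => ‖(g j).1 0‖ ^ 2 with hv
  -- The cut-off leaves the chaos sum over the box unchanged and provides the required support
  -- condition.
  set e : (Fin d ⊕ Fin d → ℕ) → ℂ := fun A =>
    if A ∈ box (Fin d ⊕ Fin d) (2 * M) then mulCoeff v M c c' A else 0 with he
  have he0 : ∀ A, A ∉ box (Fin d ⊕ Fin d) (2 * M) → e A = 0 := fun A hA => if_neg hA
  have hprod : (fun φ => C.chaosSum g M c φ * C.chaosSum g M c' φ) = C.chaosSum g (2 * M) e := by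
    ext φ
    unfold chaosSum
    rw [hermSum_mul_hermSum _ _ M c c' hc0 hc0']
    refine Finset.sum_congr rfl fun A hA => ?_
    simp only [he, if_pos hA]
    rfl
  have hnorm : ∀ q a b, IsAdmissible K q a b →
      ENNReal.ofReal (coeffNormSq ((2 : ℝ) ^ q) (2 * M) e) ≤ fockSum a G * fockSum b G' := by
    intro q a b h
    have h1 : coeffNormSq ((2 : ℝ) ^ q) (2 * M) e
        = coeffNormSq ((2 : ℝ) ^ q) (2 * M) (mulCoeff v M c c') := by
      refine Finset.sum_congr rfl fun A hA => ?_
      simp only [he, if_pos hA]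
    rw [h1]
    refine (ENNReal.ofReal_le_ofReal (coeffNormSq_mulCoeff_le (fun j => sq_nonneg _)
      (hK.norm_sq_le hg) h M c c' hc0 hc0')).trans ?_
    rw [ENNReal.ofReal_mul (coeffNormSq_nonneg (by positivity) _ _)]
    exact mul_le_mul' (ofReal_coeffNormSq_formCoeff_le hG hg M a)
      (ofReal_coeffNormSq_formCoeff_le hG' hg M b)
  rw [hprod]
  refine ⟨⟨_, hβ.isChaosExpansion_chaosSum p g hg0 (2 * M) e he0, fun q a b h =>
    (fockSum_coeffForm_le hg q (2 * M) e he0).trans (hnorm q a b h)⟩, fun q a b h hq => ?_⟩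
  exact (hβ.eLpNorm_chaosSum_sq_le g hg0 (2 * M) e (hq.norm_sq_le_rpow hg)).trans (hnorm q a b h)

end Finite

/-! ### Approximation by finite sums -/

/-- A family in `N` which is an orthonormal basis of the span of `s` in `H p`, and is orthogonal in
`H 0`. -/
noncomputable def diagFamily (C : NFChain H) (p : ℕ) (s : Finset C.N) :
    Fin (C.exists_diagonal_family p s).choose → C.N :=
  (C.exists_diagonal_family p s).choose_spec.choose

theorem orthonormal_diagFamily (p : ℕ) (s : Finset C.N) :
    Orthonormal ℂ fun j => (C.diagFamily p s j).1 p :=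
  (C.exists_diagonal_family p s).choose_spec.choose_spec.1

theorem inner_diagFamily (p : ℕ) (s : Finset C.N) (i j) (hij : i ≠ j) :
    inner ℂ ((C.diagFamily p s i).1 0) ((C.diagFamily p s j).1 0) = 0 :=
  (C.exists_diagonal_family p s).choose_spec.choose_spec.2.1 i j hij

theorem starProjection_spanAt_apply (p : ℕ) (s : Finset C.N) (x : H p) :
    (C.spanAt p s).starProjection x
      = ∑ j, inner ℂ ((C.diagFamily p s j).1 p) x • (C.diagFamily p s j).1 p :=
  (C.exists_diagonal_family p s).choose_spec.choose_spec.2.2 x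

/-- The finite chaos sum whose forms are those of `G`, restricted to the span of a finite set and
to the degrees below a bound. -/
noncomputable def approx (C : NFChain H) (p : ℕ)
    (G : ∀ n m : ℕ, (Fin n → H p) → (Fin m → H p) → ℂ) (i : Finset C.N × ℕ) : C.Dual → ℂ :=
  C.chaosSum (C.diagFamily p i.1) i.2 (formCoeff G (fun j => (C.diagFamily p i.1 j).1 p) i.2)

/-- The forms of `approx`. -/
noncomputable def approxForm (C : NFChain H) (p : ℕ)
    (G : ∀ n m : ℕ, (Fin n → H p) → (Fin m → H p) → ℂ) (i : Finset C.N × ℕ) :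
    ∀ n m : ℕ, (Fin n → H p) → (Fin m → H p) → ℂ :=
  truncForm (C.spanAt p i.1).starProjection i.2 G

section Approx

variable {p : ℕ} {G : ∀ n m : ℕ, (Fin n → H p) → (Fin m → H p) → ℂ}

theorem isBosonicForm_approxForm (hG : ∀ n m, IsBosonicForm (G n m)) (i : Finset C.N × ℕ)
    (n m : ℕ) : IsBosonicForm (C.approxForm p G i n m) :=
  isBosonicForm_truncForm _ _ hG n m

theorem fockSum_approxForm_le (hG : ∀ n m, IsBosonicForm (G n m)) (i : Finset C.N × ℕ) (q : ℝ) :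
    fockSum q (C.approxForm p G i) ≤ fockSum q G :=
  fockSum_mono fun n m => hsNormSq_truncForm_le hG (orthonormal_diagFamily p i.1) _
    (starProjection_spanAt_apply p i.1) i.2 n m

/-- The projection onto the smaller span absorbs the one onto the larger span. -/
theorem approxForm_approxForm {i j : Finset C.N × ℕ} (h : j ≤ i) :
    C.approxForm p (C.approxForm p G j) i = C.approxForm p G j := by
  ext n m u v
  have hP : ∀ x, (C.spanAt p j.1).starProjection ((C.spanAt p i.1).starProjection x)
      = (C.spanAt p j.1).starProjection x := fun x =>
    DFunLike.congr_fun (Submodule.starProjection_comp_starProjection_of_le (spanAt_mono p h.1)) x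
  have hu : ∀ (k : ℕ) (u : Fin k → H p), (C.spanAt p j.1).starProjection ∘
      ((C.spanAt p i.1).starProjection ∘ u) = (C.spanAt p j.1).starProjection ∘ u := fun k u =>
    funext fun x => hP (u x)
  have h2 : j.2 ≤ i.2 := h.2
  unfold approxForm truncForm
  simp only [hu]
  split_ifs <;> first | rfl | omega

theorem IsWhiteNoise.hasAllMoments_approx (hβ : C.IsWhiteNoise β)
    (G : ∀ n m : ℕ, (Fin n → H p) → (Fin m → H p) → ℂ) (i : Finset C.N × ℕ) :
    HasAllMoments (C.approx p G i) β := hβ.hasAllMoments_chaosSum _ _ _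

theorem IsWhiteNoise.isChaosExpansion_approx (hβ : C.IsWhiteNoise β)
    (hG : ∀ n m, IsBosonicForm (G n m)) (i : Finset C.N × ℕ) :
    C.IsChaosExpansion β p (C.approx p G i) (C.approxForm p G i) := by
  have h := hβ.isChaosExpansion_chaosSum p (C.diagFamily p i.1) (inner_diagFamily p i.1) i.2 _
    (formCoeff_eq_zero G (fun j => (C.diagFamily p i.1 j).1 p) i.2)
  rwa [coeffForm_formCoeff hG _ _ (starProjection_spanAt_apply p i.1)] at h

theorem IsWhiteNoise.eLpNorm_approx_sq_le (hβ : C.IsWhiteNoise β)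
    (hG : ∀ n m, IsBosonicForm (G n m)) (i : Finset C.N × ℕ) {q a : ℝ} (hqa : q ≤ a)
    (hq : C.EmbeddingBound p ((2 : ℝ) ^ (q / 2))) :
    eLpNorm (C.approx p G i) 2 β ^ 2 ≤ fockSum a G :=
  (hβ.eLpNorm_chaosSum_sq_le _ (inner_diagFamily p i.1) i.2 _ fun j =>
    (hq.norm_sq_le_rpow (orthonormal_diagFamily p i.1) j).trans
      (Real.rpow_le_rpow_of_exponent_le (by norm_num) hqa)).trans
    (ofReal_coeffNormSq_formCoeff_le hG (orthonormal_diagFamily p i.1) i.2 a)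

theorem tendsto_approxForm {n m : ℕ} (hG : IsBosonicForm (G n m)) (hfin : hsNormSq (G n m) ≠ ∞)
    (u : Fin n → H p) (v : Fin m → H p) :
    Filter.Tendsto (fun i => C.approxForm p G i n m u v) Filter.atTop (nhds (G n m u v)) := by
  have hfst : Filter.Tendsto (fun i : Finset C.N × ℕ => i.1) Filter.atTop Filter.atTop := by
    rw [← Filter.prod_atTop_atTop_eq]
    exact Filter.tendsto_fst
  have hsnd : Filter.Tendsto (fun i : Finset C.N × ℕ => i.2) Filter.atTop Filter.atTop := by
    rw [← Filter.prod_atTop_atTop_eq]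
    exact Filter.tendsto_snd
  have h := hG.tendsto hfin
    (u := fun i : Finset C.N × ℕ => (C.spanAt p i.1).starProjection ∘ u)
    (v := fun i : Finset C.N × ℕ => (C.spanAt p i.1).starProjection ∘ v)
    (fun k => (tendsto_starProjection_spanAt p (u k)).comp hfst)
    (fun k => (tendsto_starProjection_spanAt p (v k)).comp hfst)
  refine h.congr' ?_
  filter_upwards [hsnd.eventually_gt_atTop n, hsnd.eventually_gt_atTop m] with i h1 h2
  exact (if_pos ⟨h1, h2⟩).symm

/-- The finite approximations of `Ψ` converge to `Ψ` weakly in `L²`. -/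
theorem IsWhiteNoise.tendsto_integral_approx (hβ : C.IsWhiteNoise β) {Ψ : C.Dual → ℂ}
    (hΨ : MemLp Ψ 2 β) (hG : C.IsChaosExpansion β p Ψ G) {q a : ℝ} (hqa : q ≤ a)
    (hq : C.EmbeddingBound p ((2 : ℝ) ^ (q / 2))) (hfin : fockSum a G ≠ ∞) {w : C.Dual → ℂ}
    (hw : MemLp w 2 β) :
    Filter.Tendsto (fun i => ∫ φ, conj (w φ) * C.approx p G i φ ∂β) Filter.atTop
      (nhds (∫ φ, conj (w φ) * Ψ φ ∂β)) := by
  refine tendsto_integral_conj_mul_of_total (D := {d | ∃ n m ρ, d = C.wick n m ρ})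
    (R := fockSum a G ^ (1 / 2 : ℝ)) ?_ ?_ (fun i => hβ.hasAllMoments_approx G i 2 (by simp)) hΨ
    (ENNReal.rpow_ne_top_of_nonneg (by norm_num) hfin) ?_ ?_ hw
  · rintro _ ⟨n, m, ρ, rfl⟩
    exact hβ.hasAllMoments_wick n m ρ 2 (by simp)
  · intro f hf h
    exact hβ.ae_eq_zero_of_wick hf fun n m ρ => h _ ⟨n, m, ρ, rfl⟩
  · exact Filter.Eventually.of_forall fun i =>
      ENNReal.le_rpow_half_of_sq_le (hβ.eLpNorm_approx_sq_le hG.bosonic i hqa hq)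
  · rintro _ ⟨n, m, ρ, rfl⟩
    rw [hG.coeff]
    simp only [(hβ.isChaosExpansion_approx hG.bosonic _).coeff]
    exact (tendsto_approxForm (hG.bosonic n m) (hsNormSq_ne_top_of_fockSum hfin n m) _ _).const_mul
        _

/-- Both functions have the same coefficients, and Wick monomials are total. An approximation can
thus be rewritten over a larger diagonal family, although the two families need not be nested; this
brings two factors of different size under the finite product estimate. -/
theorem IsWhiteNoise.approx_approxForm_ae_eq (hβ : C.IsWhiteNoise β)
    (hG : ∀ n m, IsBosonicForm (G n m)) {i j : Finset C.N × ℕ} (h : j ≤ i) :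
    C.approx p (C.approxForm p G j) i =ᵐ[β] C.approx p G j := by
  have h1 := hβ.isChaosExpansion_approx (isBosonicForm_approxForm hG j) i
  rw [approxForm_approxForm h] at h1
  exact hβ.ae_eq_of_isChaosExpansion (hβ.hasAllMoments_approx _ i 2 (by simp))
    (hβ.hasAllMoments_approx _ j 2 (by simp)) h1 (hβ.isChaosExpansion_approx hG j)

end Approx

end NFChain

namespace NFChain

variable {H : ℕ → Type*} [∀ p, NormedAddCommGroup (H p)]
  [∀ p, InnerProductSpace ℂ (H p)] [∀ p, CompleteSpace (H p)] {C : NFChain H} {β : Measure C.Dual}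

/-! ### The product estimate -/

section Product

variable {p : ℕ} {G G' : ∀ n m : ℕ, (Fin n → H p) → (Fin m → H p) → ℂ}

theorem IsWhiteNoise.approx_mul_approx (hβ : C.IsWhiteNoise β) {K : ℝ}
    (hK : C.EmbeddingBound p K) (hG : ∀ n m, IsBosonicForm (G n m))
    (hG' : ∀ n m, IsBosonicForm (G' n m)) {i j : Finset C.N × ℕ} (h : j ≤ i) :
    (∃ L, C.IsChaosExpansion β p (fun φ => C.approx p G i φ * C.approx p G' j φ) L ∧
      ∀ q a b, IsAdmissible K q a b → fockSum q L ≤ fockSum a G * fockSum b G') ∧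
    ∀ q a b, IsAdmissible K q a b → C.EmbeddingBound p ((2 : ℝ) ^ (q / 2)) →
      eLpNorm (fun φ => C.approx p G i φ * C.approx p G' j φ) 2 β ^ 2
        ≤ fockSum a G * fockSum b G' := by
  obtain ⟨⟨L, h1, h2⟩, h3⟩ := hβ.chaosSum_mul_chaosSum hK (orthonormal_diagFamily p i.1)
    (inner_diagFamily p i.1) hG (isBosonicForm_approxForm hG' j) i.2
  have hae : (fun φ => C.approx p G i φ * C.approx p (C.approxForm p G' j) i φ)
      =ᵐ[β] fun φ => C.approx p G i φ * C.approx p G' j φ := by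
    filter_upwards [hβ.approx_approxForm_ae_eq hG' h] with φ hφ
    rw [hφ]
  have hle : ∀ a b, fockSum a G * fockSum b (C.approxForm p G' j) ≤ fockSum a G * fockSum b G' :=
    fun a b => mul_le_mul_right (fockSum_approxForm_le hG' j b) _
  refine ⟨⟨L, h1.congr_ae hae, fun q a b h => (h2 q a b h).trans (hle a b)⟩, fun q a b h hq => ?_⟩
  rw [← eLpNorm_congr_ae hae]
  exact (h3 q a b h hq).trans (hle a b)

theorem _root_.MeasureTheory.MemLp.mul_of_bounded {Ω : Type*} [MeasurableSpace Ω] {μ : Measure Ω}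
    {f d : Ω → ℂ} (hf : MemLp f 2 μ) (hd : AEStronglyMeasurable d μ) (hb : ∃ c, ∀ x, ‖d x‖ ≤ c) :
    MemLp (fun x => d x * f x) 2 μ := by
  obtain ⟨c, hc⟩ := hb
  refine hf.of_le_mul (c := c) (hd.mul hf.1) (Filter.Eventually.of_forall fun x => ?_)
  rw [norm_mul]
  exact mul_le_mul_of_nonneg_right (hc x) (norm_nonneg _)

/-- The product estimate in terms of forms. -/
theorem IsWhiteNoise.exists_isChaosExpansion_mul (hβ : C.IsWhiteNoise β) {K : ℝ}
    (hK : C.EmbeddingBound p K) {Ψ Φ : C.Dual → ℂ} (hΨ : MemLp Ψ 2 β) (hΦ : MemLp Φ 2 β)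
    (hG : C.IsChaosExpansion β p Ψ G) (hG' : C.IsChaosExpansion β p Φ G') {q₀ a₀ b₀ : ℝ}
    (h₀ : IsAdmissible K q₀ a₀ b₀) (hemb : C.EmbeddingBound p ((2 : ℝ) ^ (q₀ / 2)))
    (hfG : fockSum a₀ G ≠ ∞) (hfG' : fockSum b₀ G' ≠ ∞) :
    MemLp (fun φ => Ψ φ * Φ φ) 2 β ∧ ∃ L, C.IsChaosExpansion β p (fun φ => Ψ φ * Φ φ) L ∧
      ∀ q a b, IsAdmissible K q a b → fockSum q L ≤ fockSum a G * fockSum b G' := by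
  classical
  have hprob := hβ.prob
  -- Taking the infimum over all admissible exponents lets one family of limit forms satisfy all the
  -- estimates simultaneously.
  set B : ℝ → ℝ≥0∞ := fun q => ⨅ (a : ℝ) (b : ℝ) (_ : IsAdmissible K q a b),
    fockSum a G * fockSum b G' with hB
  have hBle : ∀ q a b, IsAdmissible K q a b → B q ≤ fockSum a G * fockSum b G' := fun q a b h =>
    iInf_le_of_le a (iInf_le_of_le b (iInf_le_of_le h le_rfl))
  have hleB : ∀ L : ∀ n m : ℕ, (Fin n → H p) → (Fin m → H p) → ℂ,
      (∀ q a b, IsAdmissible K q a b → fockSum q L ≤ fockSum a G * fockSum b G') →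
      ∀ q, fockSum q L ≤ B q := fun L h q =>
    le_iInf fun a => le_iInf fun b => le_iInf fun hab => h q a b hab
  have hfin : fockSum a₀ G * fockSum b₀ G' ≠ ∞ := ENNReal.mul_ne_top hfG hfG'
  have hB₀ : B q₀ ≠ ∞ := ne_top_of_le_ne_top hfin (hBle _ _ _ h₀)
  set R := (fockSum a₀ G * fockSum b₀ G') ^ (1 / 2 : ℝ) with hR
  have hRtop : R ≠ ∞ := ENNReal.rpow_ne_top_of_nonneg (by norm_num) hfin
  have hwΨ := fun {w : C.Dual → ℂ} (hw : MemLp w 2 β) =>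
    hβ.tendsto_integral_approx hΨ hG h₀.le_left hemb hfG hw
  have hwΦ := fun {w : C.Dual → ℂ} (hw : MemLp w 2 β) =>
    hβ.tendsto_integral_approx hΦ hG' h₀.symm.le_left hemb hfG' hw
  -- The first limit: the approximation of `Φ` is fixed. It has moments of all orders, so its
  -- conjugate times a bounded function or a Wick monomial is an admissible `L²` test function.
  have hstep : ∀ j : Finset C.N × ℕ, eLpNorm (fun φ => Ψ φ * C.approx p G' j φ) 2 β ≤ R ∧
      ∃ L, C.IsChaosExpansion β p (fun φ => Ψ φ * C.approx p G' j φ) L ∧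
        ∀ q, fockSum q L ≤ B q := by
    intro j
    have hj := hβ.hasAllMoments_approx G' j
    have hconv : ∀ w : C.Dual → ℂ, MemLp (fun φ => w φ * conj (C.approx p G' j φ)) 2 β →
        Filter.Tendsto (fun i => ∫ φ, conj (w φ) * (C.approx p G i φ * C.approx p G' j φ) ∂β)
          Filter.atTop (nhds (∫ φ, conj (w φ) * (Ψ φ * C.approx p G' j φ) ∂β)) := by
      intro w hw
      have e : ∀ f : C.Dual → ℂ, (fun φ => conj (w φ * conj (C.approx p G' j φ)) * f φ)
          = fun φ => conj (w φ) * (f φ * C.approx p G' j φ) := by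
        intro f
        ext φ
        rw [map_mul, Complex.conj_conj]
        ring
      simpa only [e] using hwΨ hw
    refine ⟨?_, ?_⟩
    · refine eLpNorm_le_of_tendsto_integral (l := (Filter.atTop : Filter (Finset C.N × ℕ)))
        (F := fun i φ => C.approx p G i φ * C.approx p G' j φ)
        (fun i => ((hβ.hasAllMoments_approx G i).mul hj) 2 (by simp)) (hΨ.1.mul (hj 2 (by simp)).1)
        ?_ ?_
      · filter_upwards [Filter.eventually_ge_atTop j] with i hi
        exact ENNReal.le_rpow_half_of_sq_le
          ((hβ.approx_mul_approx hK hG.bosonic hG'.bosonic hi).2 q₀ a₀ b₀ h₀ hemb)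
      · intro d hd hb
        exact hconv d ((hj.conj 2 (by simp)).mul_of_bounded hd hb)
    · refine exists_isChaosExpansion_of_tendsto (l := (Filter.atTop : Filter (Finset C.N × ℕ))) (q₀
        := q₀)
        (F := fun i φ => C.approx p G i φ * C.approx p G' j φ) hB₀ ?_ ?_
      · filter_upwards [Filter.eventually_ge_atTop j] with i hi
        obtain ⟨L, h1, h2⟩ := (hβ.approx_mul_approx hK hG.bosonic hG'.bosonic hi).1
        exact ⟨L, h1, hleB L h2⟩
      · intro n m ρ
        exact hconv _ (((hβ.hasAllMoments_wick n m ρ).mul hj.conj) 2 (by simp))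
  have hmem : ∀ j, MemLp (fun φ => Ψ φ * C.approx p G' j φ) 2 β := fun j =>
    ⟨hΨ.1.mul (hβ.hasAllMoments_approx G' j 2 (by simp)).1, (hstep j).1.trans_lt hRtop.lt_top⟩
  -- The second limit: `Ψ` is only in `L²`, so at this stage only bounded functions can be paired
  -- with the product. They suffice for the norm bound and, being total, then give convergence
  -- against Wick monomials.
  have hconv : ∀ d : C.Dual → ℂ, AEStronglyMeasurable d β → (∃ c, ∀ φ, ‖d φ‖ ≤ c) →
      Filter.Tendsto (fun j => ∫ φ, conj (d φ) * (Ψ φ * C.approx p G' j φ) ∂β) Filter.atTop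
        (nhds (∫ φ, conj (d φ) * (Ψ φ * Φ φ) ∂β)) := by
    intro d hd hb
    have e : ∀ f : C.Dual → ℂ, (fun φ => conj (d φ * conj (Ψ φ)) * f φ)
        = fun φ => conj (d φ) * (Ψ φ * f φ) := by
      intro f
      ext φ
      rw [map_mul, Complex.conj_conj]
      ring
    have hmem : MemLp (fun φ => d φ * conj (Ψ φ)) 2 β := MemLp.mul_of_bounded hΨ.star hd hb
    simpa only [e] using hwΦ hmem
  have hle : eLpNorm (fun φ => Ψ φ * Φ φ) 2 β ≤ R :=
    eLpNorm_le_of_tendsto_integral (l := (Filter.atTop : Filter (Finset C.N × ℕ))) hmem (hΨ.1.mul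
        hΦ.1)
      (Filter.Eventually.of_forall fun j => (hstep j).1) hconv
  have hL2 : MemLp (fun φ => Ψ φ * Φ φ) 2 β := ⟨hΨ.1.mul hΦ.1, hle.trans_lt hRtop.lt_top⟩
  refine ⟨hL2, ?_⟩
  obtain ⟨L, h1, h2⟩ := exists_isChaosExpansion_of_tendsto (l := (Filter.atTop : Filter (Finset C.N
      × ℕ))) (q₀ := q₀) hB₀
    (Filter.Eventually.of_forall fun j => (hstep j).2) (f := fun φ => Ψ φ * Φ φ) fun n m ρ =>
      tendsto_integral_conj_mul_of_total
        (D := {d | AEStronglyMeasurable d β ∧ ∃ c, ∀ φ, ‖d φ‖ ≤ c})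
        (fun d hd => by
          obtain ⟨hd1, c, hc⟩ := hd
          exact MemLp.of_bound hd1 c (Filter.Eventually.of_forall hc))
        (fun f hf h => ae_eq_zero_of_integral_bounded hf fun d hd hb => h d ⟨hd, hb⟩)
        hmem hL2 hRtop (Filter.Eventually.of_forall fun j => (hstep j).1)
        (fun d hd => hconv d hd.1 hd.2) (hβ.hasAllMoments_wick n m ρ 2 (by simp))
  exact ⟨L, h1, fun q a b h => (h2 q).trans (hBle q a b h)⟩

end Product

/-! ### Fock norms -/

section FockNorm

variable {p : ℕ} {Ψ Φ : C.Dual → ℂ}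

/-- The square of `fockNorm`. -/
noncomputable def fockInf (C : NFChain H) (β : Measure C.Dual) (p : ℕ) (q : ℝ)
    (Ψ : C.Dual → ℂ) : ℝ≥0∞ :=
  ⨅ (G : ∀ n m : ℕ, (Fin n → H p) → (Fin m → H p) → ℂ) (_ : C.IsChaosExpansion β p Ψ G),
    fockSum q G

theorem fockNorm_eq (q : ℝ) (Ψ : C.Dual → ℂ) :
    C.fockNorm β p q Ψ = C.fockInf β p q Ψ ^ (1 / 2 : ℝ) := rfl

theorem fockInf_le {q : ℝ} {G : ∀ n m : ℕ, (Fin n → H p) → (Fin m → H p) → ℂ}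
    (hG : C.IsChaosExpansion β p Ψ G) : C.fockInf β p q Ψ ≤ fockSum q G :=
  iInf_le_of_le G (iInf_le_of_le hG le_rfl)

theorem exists_fockSum_lt {q : ℝ} {x : ℝ≥0∞} (h : C.fockInf β p q Ψ < x) :
    ∃ G, C.IsChaosExpansion β p Ψ G ∧ fockSum q G < x := by
  simpa only [fockInf, iInf_lt_iff, exists_prop] using h

theorem fockNorm_lt_top_iff {q : ℝ} : C.fockNorm β p q Ψ < ∞ ↔ C.fockInf β p q Ψ < ∞ := by
  rw [fockNorm_eq]
  exact ENNReal.rpow_lt_top_iff_of_pos (by norm_num)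

theorem fockNorm_lt_top_iff_exists {q : ℝ} :
    C.fockNorm β p q Ψ < ∞ ↔ ∃ G, C.IsChaosExpansion β p Ψ G ∧ fockSum q G < ∞ :=
  fockNorm_lt_top_iff.trans ⟨exists_fockSum_lt, fun ⟨_, h1, h2⟩ => (fockInf_le h1).trans_lt h2⟩

theorem fockInf_mono {q q' : ℝ} (h : q ≤ q') : C.fockInf β p q Ψ ≤ C.fockInf β p q' Ψ :=
  iInf_mono fun G => iInf_mono fun _ => fockSum_mono_exponent h G

/-- A near-optimal family of forms that is also finite for another exponent. -/
theorem exists_fockSum_lt_and_ne_top {q q' : ℝ} {x : ℝ≥0∞} (h : C.fockInf β p q Ψ < x)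
    (h' : C.fockInf β p q' Ψ < ∞) :
    ∃ G, C.IsChaosExpansion β p Ψ G ∧ fockSum q G < x ∧ fockSum q' G ≠ ∞ := by
  classical
  obtain ⟨G, hG, hGx⟩ := exists_fockSum_lt h
  obtain ⟨G', hG', hGx'⟩ := exists_fockSum_lt h'
  -- The conditions on a chaos expansion concern each pair of degrees separately, so the form of
  -- smaller norm may be taken in each. This makes an appeal to uniqueness unnecessary.
  refine ⟨fun n m => if hsNormSq (G n m) ≤ hsNormSq (G' n m) then G n m else G' n m, ⟨?_, ?_⟩,
    lt_of_le_of_lt (fockSum_mono fun n m => ?_) hGx,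
    (lt_of_le_of_lt (fockSum_mono fun n m => ?_) hGx').ne⟩
  · intro n m
    split_ifs
    · exact hG.bosonic n m
    · exact hG'.bosonic n m
  · intro n m ρ
    split_ifs
    · exact hG.coeff n m ρ
    · exact hG'.coeff n m ρ
  · split_ifs with h
    · exact le_rfl
    · exact (not_le.1 h).le
  · split_ifs with h
    · exact h
    · exact le_rfl

/-- For `t = 1 - κ - X - Y`, which lies in `(0, 1)`, one has `t² ≤ t ≤ 1 - κ`. -/
theorem one_le_productConst {K q a b : ℝ} (h : IsAdmissible K q a b) : 1 ≤ productConst q a b K :=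
    by
  unfold IsAdmissible at h
  unfold productConst
  set κ := (2 : ℝ) ^ (-(a + b) / 2) * K ^ 2
  have h1 : 0 ≤ κ := by positivity
  have h2 : 0 < (2 : ℝ) ^ (q - a) := by positivity
  have h3 : 0 < (2 : ℝ) ^ (q - b) := by positivity
  rw [le_div_iff₀ (by have : 0 < 1 - κ - (2 : ℝ) ^ (q - a) - (2 : ℝ) ^ (q - b) := by linarith
                      positivity)]
  nlinarith

theorem _root_.ENNReal.le_mul_of_forall_gt {x y z : ℝ≥0∞} (hx : x ≠ ∞) (hy : y ≠ ∞)
    (h : ∀ x' > x, ∀ y' > y, z ≤ x' * y') : z ≤ x * y := by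
  have hx' : (nhdsWithin x (Set.Ioi x)).NeBot := by
    rw [mem_closure_iff_nhdsWithin_neBot.symm, closure_Ioi' ⟨∞, hx.lt_top⟩]
    exact Set.self_mem_Ici
  have hy' : (nhdsWithin y (Set.Ioi y)).NeBot := by
    rw [mem_closure_iff_nhdsWithin_neBot.symm, closure_Ioi' ⟨∞, hy.lt_top⟩]
    exact Set.self_mem_Ici
  have key : Filter.Tendsto (fun P : ℝ≥0∞ × ℝ≥0∞ => P.1 * P.2)
      (nhdsWithin x (Set.Ioi x) ×ˢ nhdsWithin y (Set.Ioi y)) (nhds (x * y)) :=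
    (ENNReal.tendsto_mul (Or.inr hy) (Or.inr hx)).mono_left
      (by rw [nhds_prod_eq]; exact Filter.prod_mono nhdsWithin_le_nhds nhdsWithin_le_nhds)
  refine ge_of_tendsto key ?_
  exact ((eventually_mem_nhdsWithin (a := x) (s := Set.Ioi x)).prod_mk
    (eventually_mem_nhdsWithin (a := y) (s := Set.Ioi y))).mono fun P hP => h P.1 hP.1 P.2 hP.2

/-- The product estimate, given one triple of exponents for which the product is square
integrable. -/
theorem IsWhiteNoise.fockNorm_mul_le (hβ : C.IsWhiteNoise β) {K : ℝ}
    (hK : C.EmbeddingBound p K) (hΨ : MemLp Ψ 2 β) (hΦ : MemLp Φ 2 β) {q a b q₀ a₀ b₀ : ℝ}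
    (h : IsAdmissible K q a b) (h₀ : IsAdmissible K q₀ a₀ b₀)
    (hemb : C.EmbeddingBound p ((2 : ℝ) ^ (q₀ / 2))) (hΨa : C.fockNorm β p a Ψ < ∞)
    (hΦb : C.fockNorm β p b Φ < ∞) (hΨ₀ : C.fockNorm β p a₀ Ψ < ∞)
    (hΦ₀ : C.fockNorm β p b₀ Φ < ∞) :
    MemLp (Ψ * Φ) 2 β ∧ C.fockNorm β p q (Ψ * Φ)
      ≤ ENNReal.ofReal (productConst q a b K) * C.fockNorm β p a Ψ * C.fockNorm β p b Φ := by
  rw [fockNorm_lt_top_iff] at hΨa hΦb hΨ₀ hΦ₀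
  have key : ∀ x > C.fockInf β p a Ψ, ∀ y > C.fockInf β p b Φ,
      MemLp (Ψ * Φ) 2 β ∧ C.fockInf β p q (Ψ * Φ) ≤ x * y := by
    intro x hx y hy
    obtain ⟨G, hG, hGx, hGf⟩ := exists_fockSum_lt_and_ne_top hx hΨ₀
    obtain ⟨G', hG', hGy, hGf'⟩ := exists_fockSum_lt_and_ne_top hy hΦ₀
    obtain ⟨h1, L, hL, hLe⟩ := hβ.exists_isChaosExpansion_mul hK hΨ hΦ hG hG' h₀ hemb hGf hGf'
    exact ⟨h1, ((fockInf_le hL).trans (hLe q a b h)).trans (mul_le_mul' hGx.le hGy.le)⟩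
  -- Square integrability does not involve the bounds `x` and `y`, so infinite ones serve.
  refine ⟨(key ∞ hΨa ∞ hΦb).1, ?_⟩
  have hle := ENNReal.le_mul_of_forall_gt hΨa.ne hΦb.ne fun x hx y hy => (key x hx y hy).2
  have h1 : C.fockNorm β p q (Ψ * Φ) ≤ C.fockNorm β p a Ψ * C.fockNorm β p b Φ := by
    simp only [fockNorm_eq]
    rw [← ENNReal.mul_rpow_of_nonneg _ _ (by norm_num)]
    exact ENNReal.rpow_le_rpow hle (by norm_num)
  refine h1.trans ?_
  rw [mul_assoc]
  refine le_mul_of_one_le_left' ?_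
  rw [← ENNReal.ofReal_one]
  exact ENNReal.ofReal_le_ofReal (one_le_productConst h)

theorem exists_embeddingBound (C : NFChain H) (p : ℕ) : ∃ K : ℝ, 0 ≤ K ∧ C.EmbeddingBound p K :=
  ⟨‖C.incl (Nat.zero_le p)‖, norm_nonneg _, fun ρ => by
    rw [← ρ.2 0 p (Nat.zero_le p)]
    exact ContinuousLinearMap.le_opNorm _ _⟩

/-- Once `K ≤ 2^(q₀/2)`, the choice `a₀ = q₀ + 3` makes each of the three admissibility terms at
most `1/8`. Natural exponents are the ones in the definition of a Hida function. -/
theorem exists_isAdmissible {K : ℝ} (hK : C.EmbeddingBound p K) (hK0 : 0 ≤ K) (q : ℝ) :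
    ∃ q₀ a₀ : ℕ, q ≤ q₀ ∧ IsAdmissible K q₀ a₀ a₀ ∧
      C.EmbeddingBound p ((2 : ℝ) ^ ((q₀ : ℝ) / 2)) := by
  obtain ⟨n, hn⟩ := pow_unbounded_of_one_lt (max K 1) (by norm_num : (1 : ℝ) < 2)
  obtain ⟨k, hk⟩ := exists_nat_ge q
  have hKn : K ≤ (2 : ℝ) ^ (n + k) :=
    ((le_max_left _ _).trans hn.le).trans (pow_le_pow_right₀ (by norm_num) (Nat.le_add_right _ _))
  refine ⟨2 * (n + k), 2 * (n + k) + 3, ?_, ?_, fun ρ => (hK ρ).trans ?_⟩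
  · push_cast
    have : (0 : ℝ) ≤ n := Nat.cast_nonneg n
    have : (0 : ℝ) ≤ k := Nat.cast_nonneg k
    linarith
  · unfold IsAdmissible
    have h1 : ((2 * (n + k) : ℕ) : ℝ) - ((2 * (n + k) + 3 : ℕ) : ℝ) = -((3 : ℕ) : ℝ) := by
      push_cast; ring
    have h2 : -(((2 * (n + k) + 3 : ℕ) : ℝ) + ((2 * (n + k) + 3 : ℕ) : ℝ)) / 2
        = -((2 * (n + k) + 3 : ℕ) : ℝ) := by ring
    rw [h1, h2, Real.rpow_neg (by norm_num), Real.rpow_neg (by norm_num), Real.rpow_natCast,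
      Real.rpow_natCast]
    have h3 : K ^ 2 ≤ (2 : ℝ) ^ (2 * (n + k)) := by
      rw [mul_comm, pow_mul]
      exact pow_le_pow_left₀ hK0 hKn 2
    have h4 : ((2 : ℝ) ^ (2 * (n + k) + 3))⁻¹ * K ^ 2 ≤ 1 / 8 := by
      rw [inv_mul_le_iff₀ (by positivity), pow_add]
      linarith
    norm_num at h4 ⊢
    linarith
  · refine mul_le_mul_of_nonneg_right ?_ (norm_nonneg _)
    have : ((2 * (n + k) : ℕ) : ℝ) / 2 = ((n + k : ℕ) : ℝ) := by push_cast; ring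
    rw [this, Real.rpow_natCast]
    exact hKn

theorem IsHida.fockNorm_lt_top (hΨ : C.IsHida β Ψ) (p : ℕ) (q : ℝ) : C.fockNorm β p q Ψ < ∞ := by
  obtain ⟨k, hk⟩ := exists_nat_ge q
  exact fockNorm_lt_top_iff.2 ((fockInf_mono hk).trans_lt (fockNorm_lt_top_iff.1 (hΨ p k).2))

theorem IsHida.memLp (hΨ : C.IsHida β Ψ) : MemLp Ψ 2 β := (hΨ 0 0).1

/-! ### The algebra of Hida test functions -/

theorem IsHida.mul (hβ : C.IsWhiteNoise β) (hΨ : C.IsHida β Ψ) (hΦ : C.IsHida β Φ) :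
    C.IsHida β (Ψ * Φ) := by
  intro p q
  obtain ⟨K, hK0, hK⟩ := C.exists_embeddingBound p
  obtain ⟨q₀, a₀, hq, hadm, hemb⟩ := exists_isAdmissible hK hK0 q
  obtain ⟨h1, h2⟩ := hβ.fockNorm_mul_le hK hΨ.memLp hΦ.memLp hadm hadm hemb
    (hΨ.fockNorm_lt_top p a₀) (hΦ.fockNorm_lt_top p a₀) (hΨ.fockNorm_lt_top p a₀)
    (hΦ.fockNorm_lt_top p a₀)
  refine ⟨h1, fockNorm_lt_top_iff.2 ((fockInf_mono hq).trans_lt (fockNorm_lt_top_iff.1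
    (h2.trans_lt ?_)))⟩
  exact ENNReal.mul_lt_top (ENNReal.mul_lt_top ENNReal.ofReal_lt_top (hΨ.fockNorm_lt_top p a₀))
    (hΦ.fockNorm_lt_top p a₀)

theorem _root_.hsNormSq_add_le {E : Type*} [NormedAddCommGroup E] [InnerProductSpace ℂ E]
    {n m : ℕ} (G G' : (Fin n → E) → (Fin m → E) → ℂ) :
    hsNormSq (fun u v => G u v + G' u v) ≤ 2 * hsNormSq G + 2 * hsNormSq G' := by
  refine iSup_le fun d => iSup_le fun e => iSup_le fun he => ?_
  refine le_trans ?_ (add_le_add (mul_le_mul_right (sum_enorm_sq_le_hsNormSq G he) 2)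
    (mul_le_mul_right (sum_enorm_sq_le_hsNormSq G' he) 2))
  simp only [Finset.mul_sum, ← Finset.sum_add_distrib]
  refine Finset.sum_le_sum fun I _ => Finset.sum_le_sum fun K _ => ?_
  have h1 : ∀ z : ℂ, ‖z‖ₑ ^ 2 = ENNReal.ofReal (‖z‖ ^ 2) := fun z => by
    rw [ENNReal.ofReal_pow (norm_nonneg _), ofReal_norm]
  have h2 : (2 : ℝ≥0∞) = ENNReal.ofReal 2 := by simp
  rw [h1, h1, h1, h2, ← ENNReal.ofReal_mul (by norm_num), ← ENNReal.ofReal_mul (by norm_num),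
    ← ENNReal.ofReal_add (by positivity) (by positivity)]
  refine ENNReal.ofReal_le_ofReal ?_
  have := norm_add_le (G (e ∘ I) (e ∘ K)) (G' (e ∘ I) (e ∘ K))
  have h3 := norm_nonneg (G (e ∘ I) (e ∘ K) + G' (e ∘ I) (e ∘ K))
  nlinarith [sq_nonneg (‖G (e ∘ I) (e ∘ K)‖ - ‖G' (e ∘ I) (e ∘ K)‖)]

theorem IsHida.add (hβ : C.IsWhiteNoise β) (hΨ : C.IsHida β Ψ) (hΦ : C.IsHida β Φ) :
    C.IsHida β (Ψ + Φ) := by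
  intro p q
  refine ⟨hΨ.memLp.add hΦ.memLp, fockNorm_lt_top_iff_exists.2 ?_⟩
  obtain ⟨G, hG, hGf⟩ := fockNorm_lt_top_iff_exists.1 (hΨ p q).2
  obtain ⟨G', hG', hGf'⟩ := fockNorm_lt_top_iff_exists.1 (hΦ p q).2
  refine ⟨fun n m u v => G n m u v + G' n m u v,
    ⟨fun n m => (hG.bosonic n m).add (hG'.bosonic n m), fun n m ρ => ?_⟩, ?_⟩
  · rw [mul_add, ← hG.coeff, ← hG'.coeff, ← integral_add
      (hβ.integrable_conj_wick_mul hΨ.memLp n m ρ) (hβ.integrable_conj_wick_mul hΦ.memLp n m ρ)]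
    simp only [Pi.add_apply, mul_add]
  · have h2 : 2 * fockSum q G + 2 * fockSum q G' < ∞ := by
      rw [ENNReal.add_lt_top]
      exact ⟨ENNReal.mul_lt_top (by simp) hGf, ENNReal.mul_lt_top (by simp) hGf'⟩
    refine lt_of_le_of_lt ?_ h2
    unfold fockSum
    simp only [← ENNReal.tsum_mul_left, ← ENNReal.tsum_add]
    refine ENNReal.tsum_le_tsum fun n => ENNReal.tsum_le_tsum fun m => ?_
    refine (mul_le_mul_right (hsNormSq_add_le (G n m) (G' n m)) _).trans (le_of_eq ?_)
    ring

/-- A constant is a chaos sum over the empty family, whose only multi-index is the empty one. -/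
theorem IsWhiteNoise.isHida_const (hβ : C.IsWhiteNoise β) (c : ℂ) : C.IsHida β fun _ => c := by
  have := hβ.prob
  intro p q
  refine ⟨memLp_const c, fockNorm_lt_top_iff_exists.2 ?_⟩
  have hcoeff := hβ.isChaosExpansion_chaosSum p (J := Fin 0) Fin.elim0 (fun i => i.elim0) 1
    (fun _ => c) fun A hA => absurd (mem_box.2 fun i => by rcases i with i | i <;> exact i.elim0) hA
  have hconst : C.chaosSum (J := Fin 0) Fin.elim0 1 (fun _ => c) = fun _ => c := by
    ext φ
    have hbox : box (Fin 0 ⊕ Fin 0) 1 = {0} := by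
      ext A
      simp only [mem_box, Finset.mem_singleton]
      exact ⟨fun _ => Subsingleton.elim _ _, fun _ i => by rcases i with i | i <;> exact i.elim0⟩
    rw [chaosSum_eq, hbox, Finset.sum_singleton]
    simp [herm, multiHerm, multiFactorial]
  rw [hconst] at hcoeff
  refine ⟨_, hcoeff, (fockSum_coeffForm_le ⟨fun i => i.elim0, fun i => i.elim0⟩ q 1 _
    fun A hA => absurd (mem_box.2 fun i => by rcases i with i | i <;> exact i.elim0) hA).trans_lt
    ENNReal.ofReal_lt_top⟩

/-- The algebra of complex Hida test functions. -/
def hidaSubalgebra (hβ : C.IsWhiteNoise β) : Subalgebra ℂ (C.Dual → ℂ) where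
  carrier := {Ψ | C.IsHida β Ψ}
  mul_mem' := IsHida.mul hβ
  add_mem' := IsHida.add hβ
  algebraMap_mem' c := hβ.isHida_const c

end FockNorm

end NFChain

theorem theoremA2 {H : ℕ → Type*} [∀ p, NormedAddCommGroup (H p)]
    [∀ p, InnerProductSpace ℂ (H p)] [∀ p, CompleteSpace (H p)]
    (C : NFChain H) (β : Measure C.Dual) (hβ : C.IsWhiteNoise β) :
    -- the embedding constants exist
    (∀ p : ℕ, ∃ K : ℝ, 0 ≤ K ∧ C.EmbeddingBound p K) ∧
    -- the product estimate
    (∀ (p : ℕ) (q a b K : ℝ), 0 ≤ q → 0 ≤ K → C.EmbeddingBound p K →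
      (2 : ℝ) ^ (-(a + b) / 2) * K ^ 2 + (2 : ℝ) ^ (q - a) + (2 : ℝ) ^ (q - b) < 1 →
      -- for all Hida test functions
      (∀ Ψ Φ : C.Dual → ℂ, C.IsHida β Ψ → C.IsHida β Φ →
        C.fockNorm β p q (Ψ * Φ)
          ≤ ENNReal.ofReal (productConst q a b K) * C.fockNorm β p a Ψ * C.fockNorm β p b Φ) ∧
      -- and, if `‖·‖₀ ≤ ‖·‖_{p,q}`, that is `Γ H_{p,q} ⊆ Γ H₀`, on the whole Fock spaces
      (C.EmbeddingBound p ((2 : ℝ) ^ (q / 2)) →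
        ∀ Ψ Φ : C.Dual → ℂ, C.InFock β p a Ψ → C.InFock β p b Φ →
          C.InFock β p q (Ψ * Φ) ∧
          C.fockNorm β p q (Ψ * Φ)
            ≤ ENNReal.ofReal (productConst q a b K) * C.fockNorm β p a Ψ *
              C.fockNorm β p b Φ)) ∧
    -- the Hida test functions form an algebra under pointwise multiplication
    (∃ A : Subalgebra ℂ (C.Dual → ℂ), ∀ Ψ : C.Dual → ℂ, Ψ ∈ A ↔ C.IsHida β Ψ) := by
  refine ⟨C.exists_embeddingBound, fun p q a b K _ hK0 hK h => ⟨fun Ψ Φ hΨ hΦ => ?_,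
    fun hemb Ψ Φ hΨ hΦ => ?_⟩, NFChain.hidaSubalgebra hβ, fun Ψ => Iff.rfl⟩
  -- The auxiliary exponents only secure square integrability of the product; the estimate itself is
  -- taken at `q`, `a`, `b`.
  · obtain ⟨q₀, a₀, -, hadm, hemb⟩ := NFChain.exists_isAdmissible hK hK0 q
    exact (hβ.fockNorm_mul_le hK hΨ.memLp hΦ.memLp h hadm hemb (hΨ.fockNorm_lt_top p a)
      (hΦ.fockNorm_lt_top p b) (hΨ.fockNorm_lt_top p a₀) (hΦ.fockNorm_lt_top p a₀)).2
  -- Under the embedding bound at `q` the given exponents serve as their own auxiliary triple.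
  · obtain ⟨h1, h2⟩ := hβ.fockNorm_mul_le hK hΨ.1 hΦ.1 h h hemb hΨ.2 hΦ.2 hΨ.2 hΦ.2
    refine ⟨⟨h1, h2.trans_lt ?_⟩, h2⟩
    exact ENNReal.mul_lt_top (ENNReal.mul_lt_top ENNReal.ofReal_lt_top hΨ.2) hΦ.2
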